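/- Let $\gamma>1$ and $r\in\mathbb R$. Put $$M_\gamma=\{(\zeta_1,\zeta_2)\in\mathbb C^2:\ \operatorname{Im}\zeta_2=|\zeta_1|^\gamma\},\qquad \Omega_\gamma=\{(z_1,z_2)\in\mathbb C^2:\ \operatorname{Im}z_2>|z_1|^\gamma\},$$ and, in the coordinates $\alpha=|\zeta_1|$, $\theta=\arg\zeta_1$, $s=\operatorname{Re}\zeta_2$ on $M_\gamma$, let $\mu_r=\alpha^r\,d\alpha\,d\theta\,ds$ and $\sigma=\mu_{\gamma-1}$. For a function $f$ on $M_\gamma$, the Leray integral of $f$ is $$\boldsymbol Lf(z)=\frac{\gamma^2}{4\pi^2}\int_{M_\gamma}\frac{f(\zeta)\,d\sigma(\zeta)}{\big[\gamma\bar\zeta_1|\zeta_1|^{\gamma-2}(\zeta_1-z_1)+i(\zeta_2-z_2)\big]^2},\qquad z\in\Omega_\gamma .$$ We say that the Leray transform $\boldsymbol Lf$ exists on $M_\gamma$ if this integral converges absolutely for every $z\in\Omega_\gamma$ and there is a measurable function on $M_\gamma$, again denoted $\boldsymbol Lf$, to which the functions $(z_1,z_2)\mapsto\boldsymbol Lf(z_1,z_2+i\varepsilon)$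 on $M_\gamma$ converge, as $\varepsilon\to0^+$, in $L^2(K,\sigma)$ for every compact $K\subset M_\gamma\setminus\{\zeta_1=0\}$. Then $\boldsymbol L$ is a bounded projection from $L^2(M_\gamma,\mu_r)$ to $L^2(M_\gamma,\mu_r)$ (that is, $\boldsymbol Lf$ exists for every $f\in L^2(M_\gamma,\mu_r)$, and $f\mapsto\boldsymbol Lf$ is a bounded linear operator on $L^2(M_\gamma,\mu_r)$ with $\boldsymbol L\circ\boldsymbol L=\boldsymbol L$) if and only if $$r\in\mathcal I_0=(-1,\,2\gamma-1).$$ Moreover, $\boldsymbol L$ is bounded in the $L^2(M_\gamma,\mu_r)$-norm on its natural domain (that is, there is a finite $C$ with $\|\boldsymbol Lf\|_{L^2(M_\gamma,\mu_r)}\le C\|f\|_{L^2(M_\gamma,\mu_r)}$ for every $f\in L^2(M_\gamma,\mu_r)$ for which $\boldsymbol Lf$ exists, the left side being $\infty$ if $\boldsymbol Lf\notin L^2(M_\gamma,\mu_r)$) if and only if $r\in\mathcal I_0$. -/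

import Mathlib

open MeasureTheory Filter Topology
open scoped ENNReal NNReal

noncomputable section

namespace LerayModel

/-- The hypersurface `M_γ = {(ζ₁, ζ₂) ∈ ℂ² : Im ζ₂ = |ζ₁|^γ}`. -/
def hypersurface (γ : ℝ) : Set (ℂ × ℂ) := {ζ | ζ.2.im = ‖ζ.1‖ ^ γ}

/-- The domain `Ω_γ = {(z₁, z₂) ∈ ℂ² : Im z₂ > |z₁|^γ}`. -/
def domain (γ : ℝ) : Set (ℂ × ℂ) := {z | ‖z.1‖ ^ γ < z.2.im}

/-- The point of `M_γ` with polar coordinates `p = (α, θ, s)`, namely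
`(α e^{iθ}, s + i α^γ)` when `α ≥ 0` (as then `‖α e^{iθ}‖ = α`). -/
def polarPoint (γ : ℝ) (p : ℝ × ℝ × ℝ) : hypersurface γ :=
  ⟨((p.1 : ℂ) * Complex.exp ((p.2.1 : ℂ) * Complex.I),
    ⟨p.2.2, ‖(p.1 : ℂ) * Complex.exp ((p.2.1 : ℂ) * Complex.I)‖ ^ γ⟩), rfl⟩

theorem measurable_polarPoint (γ : ℝ) : Measurable (polarPoint γ) := by
  apply Measurable.subtype_mk
  apply Measurable.prodMk
  · fun_prop
  · have h : Measurable (fun p : ℝ × ℝ × ℝ =>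
        Complex.equivRealProdCLM.symm
          (p.2.2, ‖(p.1 : ℂ) * Complex.exp ((p.2.1 : ℂ) * Complex.I)‖ ^ γ)) := by
      apply Complex.equivRealProdCLM.symm.continuous.measurable.comp
      fun_prop
    convert h using 2 with p
    apply Complex.ext <;> simp

/-- The measure `μ_r = α^r dα dθ ds` on `M_γ`, in the coordinates
`α = |ζ₁| > 0`, `θ = arg ζ₁ ∈ [0, 2π)`, `s = Re ζ₂ ∈ ℝ`. -/
def mu (γ r : ℝ) : Measure (hypersurface γ) :=
  Measure.map (polarPoint γ)
    ((volume.restrict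
        (Set.Ioi (0 : ℝ) ×ˢ Set.Ico (0 : ℝ) (2 * Real.pi) ×ˢ (Set.univ : Set ℝ))).withDensity
      (fun p => ENNReal.ofReal (p.1 ^ r)))

/-- The Leray kernel of `M_γ`, as a density with respect to `σ = μ_{γ-1}`:
`γ² / (4π²) · [γ ζ̄₁ |ζ₁|^{γ-2} (ζ₁ - z₁) + i (ζ₂ - z₂)]⁻²`.
With `ρ(ζ) = |ζ₁|^γ - Im ζ₂`, the bracket is `2 ⟨∂ρ(ζ), ζ - z⟩`, and on `M_γ`
`(2πi)⁻² ∂ρ ∧ ∂̄∂ρ = γ² / (16π²) · α^{γ-1} ds ∧ dα ∧ dθ`. -/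
def kernel (γ : ℝ) (z ζ : ℂ × ℂ) : ℂ :=
  ((γ ^ 2 / (4 * Real.pi ^ 2) : ℝ) : ℂ) /
    ((γ : ℂ) * (starRingEnd ℂ) ζ.1 * ((‖ζ.1‖ ^ (γ - 2) : ℝ) : ℂ) * (ζ.1 - z.1)
      + Complex.I * (ζ.2 - z.2)) ^ 2

/-- The Leray integral of `f` makes sense: it converges absolutely at every point of `Ω_γ`. -/
def LerayConverges (γ : ℝ) (f : hypersurface γ → ℂ) : Prop :=
  ∀ z ∈ domain γ, Integrable (fun ζ : hypersurface γ => f ζ * kernel γ z ζ) (mu γ (γ - 1))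

/-- The Leray integral of `f` at a point `z`, used for `z ∈ Ω_γ`. -/
def lerayIntegral (γ : ℝ) (f : hypersurface γ → ℂ) (z : ℂ × ℂ) : ℂ :=
  ∫ ζ : hypersurface γ, f ζ * kernel γ z ζ ∂(mu γ (γ - 1))

/-- `g` is the boundary function on `M_γ` of a function `F` on `Ω_γ`: the translates
`F(z₁, z₂ + iε)` converge to `g` as `ε → 0⁺` in `L²` on every compact subset of `M_γ` that
does not meet the null set `{ζ₁ = 0}`. On such sets the measures `μ_r` are all comparable, so
the notion does not depend on `r`; we use `σ = μ_{γ-1}`. -/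
def HasBoundaryFunction (γ : ℝ) (F : ℂ × ℂ → ℂ) (g : hypersurface γ → ℂ) : Prop :=
  AEStronglyMeasurable g (mu γ (γ - 1)) ∧
  ∀ K : Set (hypersurface γ), IsCompact K → (∀ z ∈ K, z.1.1 ≠ 0) →
    Tendsto
      (fun ε : ℝ => eLpNorm
        (fun z : hypersurface γ => F (z.1.1, z.1.2 + (ε : ℂ) * Complex.I) - g z)
        2 ((mu γ (γ - 1)).restrict K))
      (𝓝[>] 0) (𝓝 0)

/-- `g` is the Leray transform `L f` on `M_γ`: the Leray integral of `f` converges on `Ω_γ`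
and has boundary function `g`. (For given `f`, such a `g` is unique up to null sets.) -/
def IsLerayTransform (γ : ℝ) (f g : hypersurface γ → ℂ) : Prop :=
  LerayConverges γ f ∧ HasBoundaryFunction γ (lerayIntegral γ f) g

/-- `L` is bounded in the norm of `L²(M_γ, μ_r)` on its natural domain there, that is, on all
`f ∈ L²(M_γ, μ_r)` for which `L f` exists; in particular every such `L f` has finite norm. -/
def LerayBounded (γ r : ℝ) : Prop :=
  ∃ C : ℝ≥0, ∀ f g : hypersurface γ → ℂ, MemLp f 2 (mu γ r) → IsLerayTransform γ f g →
    eLpNorm g 2 (mu γ r) ≤ C * eLpNorm f 2 (mu γ r)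

/-- `L` is a bounded projection from `L²(M_γ, μ_r)` to itself: `L f` exists for every
`f ∈ L²(M_γ, μ_r)`, and `L` is a bounded linear operator there with `L ∘ L = L`. -/
def LerayBoundedProjection (γ r : ℝ) : Prop :=
  ∃ T : Lp ℂ 2 (mu γ r) →L[ℂ] Lp ℂ 2 (mu γ r),
    (∀ f : Lp ℂ 2 (mu γ r), IsLerayTransform γ f (T f)) ∧ T.comp T = T

end LerayModel

end

noncomputable section

namespace LerayModel

/-! Sufficiency. In polar coordinates the transform decouples. The kernel is a constant times the
inverse square of `bracket`, and the Laplace formula writes it as an integral over κ > 0 of κ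
exp(-2πκ · bracket). The bracket is affine in s = Re ζ₂ with slope i, so f enters only through its
Fourier transform in s at frequencies κ > 0, and the transform acts on each frequency by the
operator `slice` with l = 2πκ (`BoundedSupport.translate_eq`). Expanding exp(lγ α^(γ-1) a
e^{i(φ-θ)}) in powers splits a slice into rank one operators, one for each angular mode n ≥ 0
(`slice_eq_tsum`). The squared norm of the n-th one on L²(α^r dα) is controlled by ((lγ)^n / n!)²
times two Gamma integrals. These converge for every n exactly when -1 < r < 2γ - 1, and Stirling's
formula bounds the product by C / l² uniformly in n (`exists_mode_norm_le`). The factor κ in the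
Laplace formula compensates the 1 / l, so Plancherel in s and Parseval in θ bound the translates f ↦
L f(·, · + iε) uniformly in ε. Here ε enters only as the multiplier exp(-2πεκ), hence the translates
are Cauchy as ε → 0, and a density argument gives a bounded limit operator T on all of L²(μ_r)
(`exists_multiplier_bound`, `exists_translate_bound`, `exists_leray_limit`).

Projection. The Leray integral reproduces the exponentials exp(2πκ(B z₁ + i z₂))
(`integral_exp_mul_kernel`), by a Fourier inversion in s, an angular mean and a Gamma integral in
α^γ. As a function of its first argument the kernel is a superposition of such exponentials, so
transforming the translate of L f by ε translates it once more. The translation operators thus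
satisfy A_ε A_ε = A_{2ε} on a dense class, and ε → 0 gives T T = T.

Necessity. For f = α^p 1_{[δ,1]}(α) (1 - is)⁻² the transform is explicit, depends on z₂ only, and
exists for every p and δ > 0, whatever r is. Near the origin its modulus is at least a constant
times the integral of α^(p+γ-1) over [δ, 1]. With p = γ - 1 - r this integral V equals, up to a
constant, ‖f‖² in L²(μ_r). Boundedness gives V² μ_r(S) ≤ const · V on a fixed neighbourhood S, so V
times the integral of α^r over (0, 1] stays bounded as δ → 0, which forces both exponents above -1.
The norm bound on the natural domain alone thus yields the range of r, and the two equivalences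
close up in a cycle. -/

/-! ### Plancherel's inequality on the line -/

open FourierTransform SchwartzMap in
/-- The `L²` Fourier transform of an integrable square-integrable function is given by the
Fourier integral. -/
theorem fourier_toLp_ae_eq {G : ℝ → ℂ} (h1 : Integrable G) (h2 : MemLp G 2) :
    ((𝓕 (h2.toLp G) : Lp ℂ 2 (volume : Measure ℝ)) : ℝ → ℂ) =ᵐ[volume] 𝓕 G := by
  have hcont : Continuous (𝓕 G) := by
    have := VectorFourier.fourierIntegral_continuous (μ := volume) (L := innerₗ ℝ)
      Real.continuous_fourierChar (by exact continuous_inner) h1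
    exact this
  -- Both sides are locally integrable, so it suffices to test against smooth compactly supported
  -- functions. On the left the transform moves to the test function because it is the
  -- distributional one, on the right by Fubini.
  apply ae_eq_of_integral_contDiff_smul_eq
  · exact (Lp.memLp _).locallyIntegrable (by norm_num)
  · exact hcont.locallyIntegrable
  · intro g hg hsupp
    have hsupp' : HasCompactSupport (fun x => (g x : ℂ)) :=
      hsupp.comp_left (g := fun x : ℝ => (x : ℂ)) (by simp)
    have hg' : ContDiff ℝ ((⊤ : ℕ∞) : WithTop ℕ∞) (fun x => (g x : ℂ)) :=
      Complex.ofRealCLM.contDiff.comp hg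
    let φ : 𝓢(ℝ, ℂ) := hsupp'.toSchwartzMap hg'
    have hφ : ∀ x, φ x = (g x : ℂ) := fun x => rfl
    have e1 := congrArg (fun T : TemperedDistribution ℝ ℂ => T φ)
      (MeasureTheory.Lp.fourier_toTemperedDistribution_eq (h2.toLp G))
    simp only [TemperedDistribution.fourier_apply, Lp.toTemperedDistribution_apply] at e1
    have e2 : ∫ x, (𝓕 φ) x • (h2.toLp G) x = ∫ x, (𝓕 φ) x • G x := by
      apply integral_congr_ae
      filter_upwards [h2.coeFn_toLp] with x hx
      rw [hx]
    have e3 : ∫ x, (𝓕 φ) x • G x = ∫ x, φ x • (𝓕 G) x := by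
      have := VectorFourier.integral_fourierIntegral_smul_eq_flip (μ := volume) (ν := volume)
        (L := innerₗ ℝ) (f := φ) (g := G) Real.continuous_fourierChar
        (by exact continuous_inner) φ.integrable h1
      rw [SchwartzMap.fourier_coe]
      simp only [smul_eq_mul, flip_innerₗ] at this ⊢
      exact this
    rw [e2, e3] at e1
    simpa [hφ] using e1.symm

open FourierTransform in
/-- Plancherel's inequality for integrable functions. -/
theorem lintegral_enorm_fourier_sq_le {G : ℝ → ℂ} (h1 : Integrable G) :
    ∫⁻ x, ‖𝓕 G x‖ₑ ^ 2 ≤ ∫⁻ x, ‖G x‖ₑ ^ 2 := by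
  by_cases h : ∫⁻ x, ‖G x‖ₑ ^ 2 = ∞
  · rw [h]; exact le_top
  have h2 : MemLp G 2 := by
    refine ⟨h1.aestronglyMeasurable, ?_⟩
    rw [eLpNorm_lt_top_iff_lintegral_rpow_enorm_lt_top (by norm_num) (by norm_num)]
    simpa using lt_top_iff_ne_top.2 h
  have key : eLpNorm (𝓕 G) 2 volume = eLpNorm G 2 volume := by
    rw [← eLpNorm_congr_ae (fourier_toLp_ae_eq h1 h2), ← eLpNorm_congr_ae h2.coeFn_toLp,
      ← Lp.enorm_def, ← Lp.enorm_def]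
    simp [← ofReal_norm]
  have e : ∀ H : ℝ → ℂ, eLpNorm H 2 volume ^ 2 = ∫⁻ x, ‖H x‖ₑ ^ 2 := by
    intro H
    have := eLpNorm_nnreal_pow_eq_lintegral (μ := volume) (f := H) (p := 2) (by norm_num)
    simpa using this
  rw [← e, ← e, key]

theorem lintegral_enorm_integral_exp_sq_le {G : ℝ → ℂ} (h1 : Integrable G) :
    ∫⁻ t : ℝ, ‖∫ x : ℝ, Complex.exp (2 * Real.pi * x * t * Complex.I) * G x‖ₑ ^ 2
      ≤ ∫⁻ x, ‖G x‖ₑ ^ 2 := by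
  refine le_trans (le_of_eq ?_) (lintegral_enorm_fourier_sq_le h1)
  -- The opposite sign in the exponent is absorbed by the reflection t ↦ -t.
  rw [← (Measure.measurePreserving_neg volume).lintegral_comp_emb
    (MeasurableEquiv.neg ℝ).measurableEmbedding]
  refine lintegral_congr fun t => ?_
  simp only [Real.fourier_eq']
  refine congrArg (fun z : ℂ => ‖z‖ₑ ^ 2) (integral_congr_ae (.of_forall fun x => ?_))
  simp only [smul_eq_mul, RCLike.inner_apply, conj_trivial]
  congr 2
  push_cast
  ring

theorem lintegral_enorm_integral_exp_neg_sq_le {G : ℝ → ℂ} (h1 : Integrable G) :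
    ∫⁻ t : ℝ, ‖∫ x : ℝ, Complex.exp (-(2 * Real.pi * t * x * Complex.I)) * G x‖ₑ ^ 2
      ≤ ∫⁻ x, ‖G x‖ₑ ^ 2 := by
  refine le_trans (le_of_eq ?_) (lintegral_enorm_fourier_sq_le h1)
  refine lintegral_congr fun t => ?_
  simp only [Real.fourier_eq']
  refine congrArg (fun z : ℂ => ‖z‖ₑ ^ 2) (integral_congr_ae (.of_forall fun x => ?_))
  simp only [smul_eq_mul, RCLike.inner_apply, conj_trivial]
  congr 2
  push_cast
  ring

/-! ### Fourier series on the circle -/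

/-- Lebesgue measure `dθ` on `[0, 2π)`. -/
abbrev angle : Measure ℝ := volume.restrict (Set.Ico (0 : ℝ) (2 * Real.pi))

/-- Lebesgue measure `dα` on `(0, ∞)`. -/
abbrev ray : Measure ℝ := volume.restrict (Set.Ioi (0 : ℝ))

theorem exp_eq_tsum_pow_div (x : ℂ) : Complex.exp x = ∑' n : ℕ, x ^ n / (n.factorial : ℂ) := by
  rw [Complex.exp_eq_exp_ℂ, NormedSpace.exp_eq_tsum_div]

theorem integral_angle (f : ℝ → ℂ) : ∫ θ, f θ ∂angle = ∫ θ in (0 : ℝ)..(2 * Real.pi), f θ := by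
  rw [intervalIntegral.integral_of_le (by positivity)]
  exact congrArg (fun μ => ∫ θ, f θ ∂μ) (Measure.restrict_congr_set Ico_ae_eq_Ioc)

theorem integral_angle_exp (k : ℤ) :
    ∫ θ : ℝ, Complex.exp (k * θ * Complex.I) ∂angle =
      (if k = 0 then 2 * Real.pi else 0 : ℂ) := by
  rw [integral_angle]
  split_ifs with h
  · simp [h]
  · have hk : (k : ℂ) * Complex.I ≠ 0 := by simp [h]
    have := integral_exp_mul_complex (a := 0) (b := 2 * Real.pi) hk
    have e : ∀ θ : ℝ, Complex.exp (k * θ * Complex.I) = Complex.exp (k * Complex.I * θ) := by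
      intro θ; congr 1; ring
    simp only [e, this]
    have : (k : ℂ) * Complex.I * ((2 * Real.pi : ℝ) : ℂ) = k * (2 * Real.pi * Complex.I) := by
      push_cast; ring
    rw [this, Complex.exp_int_mul_two_pi_mul_I]
    simp

/-- Parseval for coefficients that are not divided by 2π: their squares gain (2π)² against the
normalised integral, which leaves a single factor 2π. -/
theorem tsum_enorm_fourier_sq {f : ℝ → ℂ} (hf : MemLp f 2 angle) :
    ∑' k : ℤ, ‖∫ θ : ℝ, Complex.exp (-(k * θ * Complex.I)) * f θ ∂angle‖ₑ ^ 2 =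
      ENNReal.ofReal (2 * Real.pi) * ∫⁻ θ, ‖f θ‖ₑ ^ 2 ∂angle := by
  have hpi : (0 : ℝ) < 2 * Real.pi := by positivity
  have hf' : MemLp f 2 (volume.restrict (Set.Ioc 0 (2 * Real.pi))) := by
    rwa [← Measure.restrict_congr_set Ico_ae_eq_Ioc]
  have h := hasSum_sq_fourierCoeffOn hpi hf'
  have hc : ∀ k : ℤ, ∫ θ : ℝ, Complex.exp (-(k * θ * Complex.I)) * f θ ∂angle =
      (2 * Real.pi : ℝ) * fourierCoeffOn hpi f k := by
    intro k
    rw [fourierCoeffOn_eq_integral, integral_angle]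
    simp only [sub_zero, Complex.real_smul, smul_eq_mul]
    rw [← mul_assoc, ← Complex.ofReal_mul, mul_one_div_cancel hpi.ne', Complex.ofReal_one, one_mul]
    refine intervalIntegral.integral_congr fun θ _ => ?_
    simp only [fourier_coe_apply]
    congr 2
    push_cast
    rw [sub_zero]
    field_simp
  have hint : ∫⁻ θ, ‖f θ‖ₑ ^ 2 ∂angle =
      ENNReal.ofReal (∫ θ in (0 : ℝ)..(2 * Real.pi), ‖f θ‖ ^ 2) := by
    rw [intervalIntegral.integral_of_le hpi.le, ← Measure.restrict_congr_set Ico_ae_eq_Ioc,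
      ofReal_integral_eq_lintegral_ofReal]
    · refine lintegral_congr fun θ => ?_
      rw [ENNReal.ofReal_pow (norm_nonneg _), ofReal_norm]
    · exact (memLp_two_iff_integrable_sq_norm hf.1).1 hf
    · exact .of_forall fun θ => by positivity
  rw [hint]
  have h2 : HasSum (fun k : ℤ => (2 * Real.pi) ^ 2 * ‖fourierCoeffOn hpi f k‖ ^ 2)
      (2 * Real.pi * ∫ θ in (0 : ℝ)..(2 * Real.pi), ‖f θ‖ ^ 2) := by
    have e : (2 * Real.pi) ^ 2 * ((2 * Real.pi - 0)⁻¹ •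
        ∫ θ in (0 : ℝ)..(2 * Real.pi), ‖f θ‖ ^ 2) =
        2 * Real.pi * ∫ θ in (0 : ℝ)..(2 * Real.pi), ‖f θ‖ ^ 2 := by
      rw [sub_zero, smul_eq_mul]
      field_simp
    rw [← e]
    exact h.mul_left _
  rw [← ENNReal.ofReal_mul hpi.le, ← h2.tsum_eq,
    ENNReal.ofReal_tsum_of_nonneg (fun k => by positivity) h2.summable]
  refine tsum_congr fun k => ?_
  rw [hc, ← mul_pow, ENNReal.ofReal_pow (by positivity), ← ofReal_norm, norm_mul,
    Complex.norm_real, Real.norm_of_nonneg hpi.le]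

/-- Bessel's inequality for the Fourier coefficients of nonnegative index. -/
theorem tsum_nat_enorm_fourier_sq_le {f : ℝ → ℂ} (hf : MemLp f 2 angle) :
    ∑' n : ℕ, ‖∫ θ : ℝ, Complex.exp (-(n * θ * Complex.I)) * f θ ∂angle‖ₑ ^ 2 ≤
      ENNReal.ofReal (2 * Real.pi) * ∫⁻ θ, ‖f θ‖ₑ ^ 2 ∂angle := by
  rw [← tsum_enorm_fourier_sq hf]
  have := ENNReal.tsum_comp_le_tsum_of_injective Nat.cast_injective
    (fun k : ℤ => ‖∫ θ : ℝ, Complex.exp (-(k * θ * Complex.I)) * f θ ∂angle‖ₑ ^ 2)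
  simpa using this

theorem norm_exp_nat_mul_I (n : ℕ) (θ : ℝ) : ‖Complex.exp (n * θ * Complex.I)‖ = 1 := by
  have := Complex.norm_exp_ofReal_mul_I (n * θ)
  simpa using this

/-- Parseval's identity for absolutely convergent power series on the unit circle. -/
theorem lintegral_enorm_tsum_exp_sq {c : ℕ → ℂ} (hc : Summable fun n => ‖c n‖) :
    ∫⁻ θ : ℝ, ‖∑' n : ℕ, c n * Complex.exp (n * θ * Complex.I)‖ₑ ^ 2 ∂angle =
      ENNReal.ofReal (2 * Real.pi) * ∑' n : ℕ, ‖c n‖ₑ ^ 2 := by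
  have hpi : (0 : ℝ) < 2 * Real.pi := by positivity
  set f : ℝ → ℂ := fun θ => ∑' n : ℕ, c n * Complex.exp (n * θ * Complex.I) with hfdef
  have hnorm : ∀ n (θ : ℝ), ‖c n * Complex.exp (n * θ * Complex.I)‖ = ‖c n‖ := by
    intro n θ
    rw [norm_mul, norm_exp_nat_mul_I, mul_one]
  have hcont : Continuous f :=
    continuous_tsum (fun n => by fun_prop) hc (fun n θ => (hnorm n θ).le)
  have hmem : MemLp f 2 angle := by
    refine MemLp.of_bound hcont.aestronglyMeasurable (∑' n, ‖c n‖) (.of_forall fun θ => ?_)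
    have h1 : Summable fun n => ‖c n * Complex.exp (n * θ * Complex.I)‖ := by
      simpa only [hnorm] using hc
    refine (norm_tsum_le_tsum_norm h1).trans (le_of_eq ?_)
    simp only [hnorm]
  -- By absolute convergence the series may be integrated term by term; orthogonality leaves the
  -- term n = k, and nothing when k is negative.
  have hcoef : ∀ k : ℤ, ∫ θ : ℝ, Complex.exp (-(k * θ * Complex.I)) * f θ ∂angle =
      2 * Real.pi * (if 0 ≤ k then c k.toNat else 0) := by
    intro k
    have h1 : ∀ θ : ℝ, Complex.exp (-(k * θ * Complex.I)) * f θ =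
        ∑' n : ℕ, c n * Complex.exp (((n - k : ℤ) : ℂ) * θ * Complex.I) := by
      intro θ
      rw [hfdef, ← tsum_mul_left]
      refine tsum_congr fun n => ?_
      rw [mul_left_comm, ← Complex.exp_add]
      congr 2
      push_cast
      ring
    simp only [h1]
    have hn2 : ∀ (n : ℕ) (θ : ℝ), ‖c n * Complex.exp (((n - k : ℤ) : ℂ) * θ * Complex.I)‖ = ‖c n‖ := by
      intro n θ
      have := Complex.norm_exp_ofReal_mul_I (((n - k : ℤ) : ℝ) * θ)
      push_cast at this ⊢
      rw [norm_mul, this, mul_one]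
    have h2 := hasSum_integral_of_summable_integral_norm (μ := angle)
      (F := fun (n : ℕ) (θ : ℝ) => c n * Complex.exp (((n - k : ℤ) : ℂ) * θ * Complex.I))
      (fun n => by
        refine Integrable.of_bound (C := ‖c n‖) (Continuous.aestronglyMeasurable (by fun_prop))
          (.of_forall fun θ => (hn2 n θ).le))
      (by
        simp only [hn2, integral_const, smul_eq_mul]
        exact hc.mul_left _)
    rw [← h2.tsum_eq]
    simp only [integral_const_mul, integral_angle_exp]
    split_ifs with hk
    · rw [tsum_eq_single k.toNat]
      · rw [if_pos (by omega)]; ring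
      · intro n hn
        rw [if_neg (by omega), mul_zero]
    · rw [mul_zero]
      convert tsum_zero with n
      rw [if_neg (by omega), mul_zero]
  have h := tsum_enorm_fourier_sq hmem
  simp only [hcoef] at h
  have h3 : ∑' k : ℤ, ‖(2 * Real.pi : ℂ) * (if 0 ≤ k then c k.toNat else 0)‖ₑ ^ 2 =
      ENNReal.ofReal (2 * Real.pi) ^ 2 * ∑' n : ℕ, ‖c n‖ₑ ^ 2 := by
    rw [← ENNReal.tsum_mul_left]
    have hinj : Function.Injective (Nat.cast : ℕ → ℤ) := Nat.cast_injective
    rw [← hinj.tsum_eq]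
    · refine tsum_congr fun n => ?_
      have e : ‖(2 * Real.pi : ℂ)‖ₑ = ENNReal.ofReal (2 * Real.pi) := by
        rw [← ofReal_norm]
        congr 1
        have := Complex.norm_real (2 * Real.pi)
        push_cast at this
        rw [this, Real.norm_of_nonneg hpi.le]
      simp [enorm_mul, mul_pow, e]
    · intro k hk
      rw [Function.mem_support] at hk
      by_cases h0 : 0 ≤ k
      · exact ⟨k.toNat, by omega⟩
      · simp [h0] at hk
  rw [h3, sq, mul_assoc] at h
  exact ((ENNReal.mul_right_inj (by simpa using hpi) ENNReal.ofReal_ne_top).1 h).symm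

/-- The angular mean of `exp (E e^{iθ} + G e^{-iθ})`. -/
theorem integral_angle_exp_add (E G : ℂ) :
    ∫ θ : ℝ, Complex.exp (E * Complex.exp (θ * Complex.I) + G * Complex.exp (-(θ * Complex.I)))
      ∂angle = 2 * Real.pi * ∑' n : ℕ, (E * G) ^ n / (n.factorial : ℂ) ^ 2 := by
  have hu : ∀ θ : ℝ, ‖Complex.exp (θ * Complex.I)‖ = 1 := Complex.norm_exp_ofReal_mul_I
  have hv : ∀ θ : ℝ, ‖Complex.exp (-(θ * Complex.I))‖ = 1 := by
    intro θ
    have := Complex.norm_exp_ofReal_mul_I (-θ)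
    simpa using this
  have hbound : ∀ (n : ℕ) (θ : ℝ), ‖E ^ n * Complex.exp (n * θ * Complex.I) / n.factorial *
      Complex.exp (G * Complex.exp (-(θ * Complex.I)))‖ ≤
        ‖E‖ ^ n / n.factorial * Real.exp ‖G‖ := by
    intro n θ
    rw [norm_mul, norm_div, norm_mul, norm_pow, norm_exp_nat_mul_I, mul_one, Complex.norm_natCast]
    gcongr
    refine (Complex.norm_exp_le_exp_norm _).trans ?_
    rw [norm_mul, hv, mul_one]
  -- Against e^{inθ} only the n-th term of the expansion of exp(G e^{-iθ}) survives, which pairs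
  -- Eⁿ/n! with Gⁿ/n!.
  have inner : ∀ n : ℕ, ∫ θ : ℝ, Complex.exp (n * θ * Complex.I) *
      Complex.exp (G * Complex.exp (-(θ * Complex.I))) ∂angle =
        2 * Real.pi * (G ^ n / n.factorial) := by
    intro n
    have h1 : ∀ θ : ℝ, Complex.exp (n * θ * Complex.I) *
        Complex.exp (G * Complex.exp (-(θ * Complex.I))) =
        ∑' m : ℕ, G ^ m / m.factorial * Complex.exp (((n - m : ℤ) : ℂ) * θ * Complex.I) := by
      intro θ
      rw [exp_eq_tsum_pow_div (G * _), ← tsum_mul_left]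
      refine tsum_congr fun m => ?_
      rw [mul_pow, ← Complex.exp_nat_mul, mul_div_assoc', mul_left_comm, ← Complex.exp_add,
        mul_div_right_comm]
      congr 2
      push_cast
      ring
    have hn2 : ∀ (m : ℕ) (θ : ℝ),
        ‖G ^ m / m.factorial * Complex.exp (((n - m : ℤ) : ℂ) * θ * Complex.I)‖ =
          ‖G‖ ^ m / m.factorial := by
      intro m θ
      have := Complex.norm_exp_ofReal_mul_I (((n - m : ℤ) : ℝ) * θ)
      push_cast at this ⊢
      rw [norm_mul, this, mul_one, norm_div, norm_pow, Complex.norm_natCast]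
    simp only [h1]
    have h2 := hasSum_integral_of_summable_integral_norm (μ := angle)
      (F := fun (m : ℕ) (θ : ℝ) =>
        G ^ m / m.factorial * Complex.exp (((n - m : ℤ) : ℂ) * θ * Complex.I))
      (fun m => by
        refine Integrable.of_bound (C := ‖G‖ ^ m / m.factorial)
          (Continuous.aestronglyMeasurable (by fun_prop)) (.of_forall fun θ => (hn2 m θ).le))
      (by
        simp only [hn2, integral_const, smul_eq_mul]
        exact (Real.summable_pow_div_factorial _).mul_left _)
    rw [← h2.tsum_eq]
    simp only [integral_const_mul, integral_angle_exp]
    rw [tsum_eq_single n]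
    · rw [if_pos (by omega)]; ring
    · intro m hm
      rw [if_neg (by omega), mul_zero]
  have h1 : ∀ θ : ℝ,
      Complex.exp (E * Complex.exp (θ * Complex.I) + G * Complex.exp (-(θ * Complex.I))) =
      ∑' n : ℕ, E ^ n * Complex.exp (n * θ * Complex.I) / n.factorial *
        Complex.exp (G * Complex.exp (-(θ * Complex.I))) := by
    intro θ
    rw [Complex.exp_add, tsum_mul_right]
    congr 1
    rw [exp_eq_tsum_pow_div]
    refine tsum_congr fun m => ?_
    rw [mul_pow, ← Complex.exp_nat_mul, mul_assoc]
  simp only [h1]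
  have h2 := hasSum_integral_of_summable_integral_norm (μ := angle)
    (F := fun (n : ℕ) (θ : ℝ) => E ^ n * Complex.exp (n * θ * Complex.I) / n.factorial *
        Complex.exp (G * Complex.exp (-(θ * Complex.I))))
    (fun n => Integrable.of_bound (Continuous.aestronglyMeasurable (by fun_prop))
      (‖E‖ ^ n / n.factorial * Real.exp ‖G‖) (.of_forall fun θ => hbound n θ))
    (by
      refine Summable.of_nonneg_of_le (fun n => by positivity) (fun n => ?_)
        (((Real.summable_pow_div_factorial ‖E‖).mul_right (Real.exp ‖G‖)).mul_left
          (2 * Real.pi))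
      calc ∫ θ : ℝ, _ ∂angle ≤ ∫ θ : ℝ, ‖E‖ ^ n / n.factorial * Real.exp ‖G‖ ∂angle := by
            refine integral_mono_of_nonneg (.of_forall fun θ => norm_nonneg _)
              (integrable_const _) (.of_forall fun θ => hbound n θ)
        _ = _ := by
            rw [integral_const, smul_eq_mul]
            simp [Measure.real, Real.pi_nonneg])
  rw [← h2.tsum_eq, ← tsum_mul_left]
  refine tsum_congr fun n => ?_
  have : ∀ θ : ℝ, E ^ n * Complex.exp (n * θ * Complex.I) / n.factorial *
        Complex.exp (G * Complex.exp (-(θ * Complex.I))) =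
      E ^ n / n.factorial * (Complex.exp (n * θ * Complex.I) *
        Complex.exp (G * Complex.exp (-(θ * Complex.I)))) := by
    intro θ; ring
  simp only [this, integral_const_mul, inner]
  rw [mul_pow]
  ring

/-! ### Stirling-type upper bounds for the Gamma function -/

/-- The Stirling sequence m! / (√(2m) (m/e)^m) decreases from its value e/√2 at m = 1. -/
theorem factorial_le_stirling {m : ℕ} (hm : m ≠ 0) :
    (m.factorial : ℝ) ≤ Real.exp 1 * (√m * (m / Real.exp 1) ^ m) := by
  obtain ⟨k, rfl⟩ := Nat.exists_eq_succ_of_ne_zero hm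
  have h := Stirling.stirlingSeq'_antitone (Nat.zero_le k)
  simp only [Function.comp, Stirling.stirlingSeq, Nat.succ_eq_add_one, zero_add,
    Nat.factorial_one, Nat.cast_one, mul_one, one_div, pow_one] at h
  rw [div_le_iff₀ (by positivity)] at h
  refine h.trans (le_of_eq ?_)
  rw [Real.sqrt_mul (by norm_num)]
  have : (√2 : ℝ) ≠ 0 := by positivity
  field_simp

/-- For m < w ≤ m + 1, log-convexity gives Γ(w) ≤ Γ(m) m^(w-m), and Γ(m) = m!/m is bounded by
Stirling. One factor e comes from Stirling, the other from replacing e^{-m} by e^{1-w}. -/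
theorem Gamma_le_of_one_lt {w : ℝ} (hw : 1 < w) :
    Real.Gamma w ≤ Real.exp 2 * (w ^ (w - 1 / 2) * Real.exp (-w)) := by
  obtain ⟨m, hm0, hm1, hm2⟩ : ∃ m : ℕ, m ≠ 0 ∧ (m : ℝ) < w ∧ w ≤ m + 1 := by
    refine ⟨⌈w⌉₊ - 1, ?_, ?_, ?_⟩
    · have := Nat.lt_ceil.2 (by simpa using hw : ((1 : ℕ) : ℝ) < w)
      omega
    · have h1 : 1 ≤ ⌈w⌉₊ := Nat.one_le_ceil_iff.2 (by linarith)
      have := Nat.ceil_lt_add_one (by linarith : 0 ≤ w)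
      push_cast [h1]
      linarith
    · have h1 : 1 ≤ ⌈w⌉₊ := Nat.one_le_ceil_iff.2 (by linarith)
      have := Nat.le_ceil w
      push_cast [h1]
      linarith
  have hmpos : (0 : ℝ) < m := by exact_mod_cast Nat.pos_of_ne_zero hm0
  have h := Real.BohrMollerup.f_add_nat_le (f := Real.log ∘ Real.Gamma) (n := m) (x := w - m)
    Real.convexOn_log_Gamma (fun {y} hy => by
      simp only [Function.comp]
      rw [Real.Gamma_add_one hy.ne', Real.log_mul hy.ne' (Real.Gamma_pos_of_pos hy).ne', add_comm])
    hm0 (by linarith) (by linarith)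
  simp only [Function.comp, add_sub_cancel] at h
  have hG : Real.Gamma w ≤ Real.Gamma m * (m : ℝ) ^ (w - m) := by
    rw [← Real.log_le_log_iff (Real.Gamma_pos_of_pos (by linarith))
      (mul_pos (Real.Gamma_pos_of_pos hmpos) (Real.rpow_pos_of_pos hmpos _)),
      Real.log_mul (Real.Gamma_pos_of_pos hmpos).ne' (Real.rpow_pos_of_pos hmpos _).ne',
      Real.log_rpow hmpos]
    exact h
  have hGm : Real.Gamma m = m.factorial / m := by
    rw [eq_div_iff hmpos.ne', mul_comm, ← Real.Gamma_add_one hmpos.ne',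
      Real.Gamma_nat_eq_factorial]
  have h1 : Real.Gamma m ≤ Real.exp 1 * ((m : ℝ) ^ ((m : ℝ) - 1 / 2) * Real.exp (-m)) := by
    rw [hGm, div_le_iff₀ hmpos]
    refine (factorial_le_stirling hm0).trans (le_of_eq ?_)
    rw [Real.sqrt_eq_rpow, div_pow, ← Real.exp_nat_mul, mul_one, Real.exp_neg,
      sub_eq_add_neg, Real.rpow_add hmpos, Real.rpow_natCast, Real.rpow_neg hmpos.le]
    have h2 : (m : ℝ) = (m : ℝ) ^ (1 / 2 : ℝ) * (m : ℝ) ^ (1 / 2 : ℝ) := by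
      rw [← Real.rpow_add hmpos]; norm_num
    have h3 : (m : ℝ) ^ (1 / 2 : ℝ) ≠ 0 := (Real.rpow_pos_of_pos hmpos _).ne'
    field_simp
    rw [sq, ← h2]
  calc Real.Gamma w ≤ Real.Gamma m * (m : ℝ) ^ (w - m) := hG
    _ ≤ Real.exp 1 * ((m : ℝ) ^ ((m : ℝ) - 1 / 2) * Real.exp (-m)) * (m : ℝ) ^ (w - m) := by
        gcongr
    _ = Real.exp 1 * ((m : ℝ) ^ (w - 1 / 2) * Real.exp (-m)) := by
        have : (m : ℝ) ^ (w - 1 / 2) = (m : ℝ) ^ ((m : ℝ) - 1 / 2) * (m : ℝ) ^ (w - m) := by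
          rw [← Real.rpow_add hmpos]; congr 1; ring
        rw [this]; ring
    _ ≤ Real.exp 1 * (w ^ (w - 1 / 2) * Real.exp (1 - w)) := by
        gcongr
        · linarith
        · linarith
    _ = _ := by
        have e : Real.exp 1 * Real.exp (1 - w) = Real.exp 2 * Real.exp (-w) := by
          rw [← Real.exp_add, ← Real.exp_add]; congr 1; ring
        rw [mul_left_comm, e]; ring

/-- The previous bound at y + 1 is brought down by Γ(y + 1) = y Γ(y). The cost is (1 + 1/y)^(y +
1/2) ≤ exp(1 + 1/(2y)), uniform for y ≥ y₀; this is what reaches arguments close to 0. -/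
theorem Gamma_le_of_le {y₀ y : ℝ} (h0 : 0 < y₀) (hy : y₀ ≤ y) :
    Real.Gamma y ≤ Real.exp (2 + 1 / (2 * y₀)) * (y ^ (y - 1 / 2) * Real.exp (-y)) := by
  have hy0 : 0 < y := h0.trans_le hy
  have h := Gamma_le_of_one_lt (w := y + 1) (by linarith)
  rw [Real.Gamma_add_one hy0.ne'] at h
  have h2 : (y + 1) ^ (y + 1 - 1 / 2) ≤
      y ^ (y + 1 - 1 / 2) * Real.exp (1 + 1 / (2 * y₀)) := by
    have e : y + 1 = y * (1 + 1 / y) := by field_simp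
    have : (y + 1) ^ (y + 1 - 1 / 2) = y ^ (y + 1 - 1 / 2) * (1 + 1 / y) ^ (y + 1 - 1 / 2) := by
      conv_lhs => rw [show (y + 1) ^ (y + 1 - 1 / 2) = (y * (1 + 1 / y)) ^ (y + 1 - 1 / 2) by
        rw [← e]]
      rw [Real.mul_rpow hy0.le (by positivity)]
    rw [this]
    gcongr
    calc (1 + 1 / y) ^ (y + 1 - 1 / 2) ≤ (Real.exp (1 / y)) ^ (y + 1 - 1 / 2) := by
          gcongr
          · linarith
          · rw [add_comm]; exact Real.add_one_le_exp _
      _ = Real.exp (1 + 1 / (2 * y)) := by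
          rw [← Real.exp_mul]; congr 1; field_simp; ring
      _ ≤ _ := by gcongr
  have h3 : y ^ (y + 1 - 1 / 2) = y * y ^ (y - 1 / 2) := by
    rw [show y + 1 - 1 / 2 = 1 + (y - 1 / 2) by ring, Real.rpow_add hy0, Real.rpow_one]
  have h4 : y * Real.Gamma y ≤
      y * (Real.exp (2 + 1 / (2 * y₀)) * (y ^ (y - 1 / 2) * Real.exp (-y))) := by
    calc y * Real.Gamma y ≤ _ := h
      _ ≤ Real.exp 2 * (y ^ (y + 1 - 1 / 2) * Real.exp (1 + 1 / (2 * y₀)) * Real.exp (-(y + 1))) := by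
          gcongr
      _ = _ := by
          rw [h3, neg_add, Real.exp_add (-y), Real.exp_add 1, Real.exp_add 2, Real.exp_neg 1]
          have := Real.exp_ne_zero 1
          field_simp
  exact le_of_mul_le_mul_left h4 hy0

/-- Stirling's upper bound along an arithmetic progression. -/
theorem exists_Gamma_le_progression {p d : ℝ} (hp : 0 < p) (hd : 0 < p + d) :
    ∃ C : ℝ, 0 < C ∧ ∀ n : ℕ, Real.Gamma (p * (n + 1) + d) ≤
      C * ((p * (n + 1)) ^ (p * (n + 1) + d) * Real.exp (-(p * (n + 1))) / √((n : ℝ) + 1)) := by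
  -- With this c the argument p (n + 1) + d is at least c (n + 1), whatever the sign of d.
  set c := min p (p + d) with hc
  have hc0 : 0 < c := lt_min hp hd
  refine ⟨Real.exp (2 + 1 / (2 * c)) * Real.exp (|d| * (1 + |d| / p)) * Real.exp |d| / √c,
    by positivity, fun n => ?_⟩
  set N : ℝ := (n : ℝ) + 1 with hN
  have hN1 : 1 ≤ N := by simp [hN]
  have hN0 : 0 < N := by linarith
  set x := p * N + d with hx
  have hcx : c * N ≤ x := by
    rcases le_total 0 d with h | h
    · have : c ≤ p := min_le_left _ _
      nlinarith
    · have : c ≤ p + d := min_le_right _ _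
      nlinarith
  have hx0 : 0 < x := lt_of_lt_of_le (by positivity) hcx
  have h1 := Gamma_le_of_le hc0 (y := x) (by nlinarith)
  have hpN : 0 < p * N := by positivity
  -- The shift d costs only a bounded factor: (1 + d/(pN))^x ≤ exp(d x/(pN)), and d x/(pN) = d (1 +
  -- d/(pN)).
  have hxx : x ^ x ≤ (p * N) ^ x * Real.exp (|d| * (1 + |d| / p)) := by
    have e : x = p * N * (1 + d / (p * N)) := by rw [hx]; field_simp
    have hpos : 0 < 1 + d / (p * N) := by
      have : 0 < p * N * (1 + d / (p * N)) := by rwa [← e]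
      exact pos_of_mul_pos_right this hpN.le
    have : x ^ x = (p * N) ^ x * (1 + d / (p * N)) ^ x := by
      rw [← Real.mul_rpow hpN.le hpos.le, ← e]
    rw [this]
    gcongr
    calc (1 + d / (p * N)) ^ x ≤ (Real.exp (d / (p * N))) ^ x := by
          gcongr
          rw [add_comm]; exact Real.add_one_le_exp _
      _ = Real.exp (d / (p * N) * x) := by rw [← Real.exp_mul]
      _ ≤ _ := by
          apply Real.exp_le_exp.2
          have : d / (p * N) * x = d * (1 + d / (p * N)) := by
            rw [hx]; field_simp
          rw [this]
          calc d * (1 + d / (p * N)) ≤ |d| * (1 + d / (p * N)) := by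
                gcongr; exact le_abs_self d
            _ ≤ |d| * (1 + |d| / p) := by
                gcongr
                · exact le_abs_self d
                · nlinarith
  have hsplit : x ^ (x - 1 / 2) = x ^ x / √x := by
    rw [Real.rpow_sub hx0, Real.sqrt_eq_rpow]
  have hsqrt : √c * √N ≤ √x := by
    rw [← Real.sqrt_mul hc0.le]
    exact Real.sqrt_le_sqrt hcx
  have hexp : Real.exp (-x) ≤ Real.exp (-(p * N)) * Real.exp |d| := by
    rw [← Real.exp_add]
    gcongr
    have := neg_abs_le d
    rw [hx]; linarith
  calc Real.Gamma x ≤ _ := h1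
    _ ≤ Real.exp (2 + 1 / (2 * c)) * (((p * N) ^ x * Real.exp (|d| * (1 + |d| / p))) /
          (√c * √N) * (Real.exp (-(p * N)) * Real.exp |d|)) := by
        rw [hsplit]
        gcongr
    _ = _ := by
        have : √N ≠ 0 := by positivity
        have : √c ≠ 0 := by positivity
        field_simp

/-! ### Uniform bound for the angular modes -/

/-- The norms of the rank one Fourier modes of the Leray transform are uniformly bounded. -/
theorem exists_mode_norm_le {γ r : ℝ} (hγ : 1 < γ) (hr : -1 < r) (hr' : r < 2 * γ - 1) :
    ∃ C : ℝ, 0 < C ∧ ∀ (n : ℕ) (l : ℝ), 0 < l →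
      ((l * γ) ^ n / n.factorial) ^ 2 *
        ((∫ a in Set.Ioi (0 : ℝ), a ^ (2 * n + r) * Real.exp (-(2 * l) * a ^ γ)) *
        ∫ a in Set.Ioi (0 : ℝ), a ^ (2 * (γ - 1) * (n + 1) - r) *
          Real.exp (-(2 * l * (γ - 1)) * a ^ γ)) ≤ C / l ^ 2 := by
  have hγ0 : 0 < γ := by linarith
  have hγ1 : 0 < γ - 1 := by linarith
  -- The two Gamma arguments at n = 0 are (r + 1)/γ and (2γ - 1 - r)/γ. Their positivity is exactly
  -- the condition on r.
  obtain ⟨C₁, hC₁, h₁⟩ := exists_Gamma_le_progression (p := 2 / γ) (d := (r - 1) / γ)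
    (by positivity) (by rw [← add_div]; apply div_pos <;> linarith)
  obtain ⟨C₂, hC₂, h₂⟩ := exists_Gamma_le_progression (p := 2 * (γ - 1) / γ) (d := (1 - r) / γ)
    (by positivity) (by rw [← add_div]; apply div_pos <;> linarith)
  refine ⟨C₁ * C₂ / γ ^ 4, by positivity, fun n l hl => ?_⟩
  have hn0 : (0 : ℝ) ≤ n := Nat.cast_nonneg n
  rw [integral_rpow_mul_exp_neg_mul_rpow hγ0 (by linarith) (by positivity),
    integral_rpow_mul_exp_neg_mul_rpow hγ0 (by nlinarith) (by positivity)]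
  set N : ℝ := (n : ℝ) + 1 with hN
  have hN0 : 0 < N := by positivity
  set x := (2 * n + r + 1) / γ with hx
  set y := (2 * (γ - 1) * N - r + 1) / γ with hy
  have hx' : 2 / γ * N + (r - 1) / γ = x := by rw [hx, hN]; field_simp; ring
  have hy' : 2 * (γ - 1) / γ * N + (1 - r) / γ = y := by rw [hy]; field_simp; ring
  -- The key cancellation: the Gamma arguments add up to 2(n + 1), independently of r. Hence the
  -- powers of 2l and of 2N/γ combine to integer powers that match (lγ)^(2n) and n!², while the
  -- powers (γ - 1)^(±y) cancel each other.
  have hxy : x + y = ((2 * (n + 1) : ℕ) : ℝ) := by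
    rw [hx, hy, hN]; push_cast; field_simp; ring
  have g₁ := h₁ n
  have g₂ := h₂ n
  rw [← hN, hx'] at g₁
  rw [← hN, hy'] at g₂
  have hfact : √(2 * Real.pi * ((n + 1 : ℕ) : ℝ)) * (((n + 1 : ℕ) : ℝ) / Real.exp 1) ^ (n + 1) ≤
      ((n + 1).factorial : ℝ) := Stirling.le_factorial_stirling (n + 1)
  -- Squared lower Stirling bound for (n + 1)! = N · n!, with the factor 2π lowered to 1.
  have hfact' : N ^ (2 * (n + 1)) * Real.exp (-(2 * N)) * N ≤ (N * (n.factorial : ℝ)) ^ 2 := by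
    have e1 : ((n + 1 : ℕ) : ℝ) = N := by push_cast; rfl
    rw [e1, Nat.factorial_succ, Nat.cast_mul, e1] at hfact
    calc N ^ (2 * (n + 1)) * Real.exp (-(2 * N)) * N
        ≤ N ^ (2 * (n + 1)) * Real.exp (-(2 * N)) * (2 * Real.pi * N) := by
          gcongr
          have := Real.pi_gt_three
          nlinarith
      _ = (√(2 * Real.pi * N) * (N / Real.exp 1) ^ (n + 1)) ^ 2 := by
          rw [mul_pow, Real.sq_sqrt (by positivity), div_pow, ← Real.exp_nat_mul, e1, mul_one,
            div_pow, ← pow_mul, ← Real.exp_nat_mul, mul_comm (n + 1) 2, Real.exp_neg]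
          push_cast
          field_simp
      _ ≤ _ := by gcongr
  have e2 : (2 * l) ^ (-(2 * n + r + 1) / γ) = (2 * l) ^ (-x) := by
    congr 1; rw [hx]; ring
  have e3 : (2 * l * (γ - 1)) ^ (-(2 * (γ - 1) * N - r + 1) / γ) =
      (2 * l) ^ (-y) * (γ - 1) ^ (-y) := by
    rw [← Real.mul_rpow (by positivity) (by positivity)]
    congr 1; rw [hy]; ring
  rw [e2, e3]
  have hl2 : 0 < 2 * l := by positivity
  have e4 : (2 * l) ^ (-x) * (2 * l) ^ (-y) = ((2 * l) ^ (2 * (n + 1)))⁻¹ := by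
    rw [← Real.rpow_add hl2, ← neg_add, hxy, Real.rpow_neg hl2.le, Real.rpow_natCast]
  have e5 : (2 / γ * N) ^ x * (2 * (γ - 1) / γ * N) ^ y =
      (2 / γ * N) ^ (2 * (n + 1)) * (γ - 1) ^ y := by
    rw [show 2 * (γ - 1) / γ * N = (2 / γ * N) * (γ - 1) by ring,
      Real.mul_rpow (y := γ - 1) (by positivity) hγ1.le, ← mul_assoc,
      ← Real.rpow_add (by positivity), hxy, Real.rpow_natCast]
  have e6 : Real.exp (-(2 / γ * N)) * Real.exp (-(2 * (γ - 1) / γ * N)) = Real.exp (-(2 * N)) := by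
    rw [← Real.exp_add]; congr 1; field_simp; ring
  have e7 : (γ - 1) ^ (-y) * (γ - 1) ^ y = 1 := by
    rw [← Real.rpow_add hγ1]; simp
  have hsq : √N * √N = N := Real.mul_self_sqrt hN0.le
  have hfp : (0 : ℝ) < n.factorial := by exact_mod_cast n.factorial_pos
  calc ((l * γ) ^ n / n.factorial) ^ 2 *
        ((2 * l) ^ (-x) * (1 / γ) * Real.Gamma x *
          ((2 * l) ^ (-y) * (γ - 1) ^ (-y) * (1 / γ) * Real.Gamma y))
      = ((l * γ) ^ n / n.factorial) ^ 2 * (1 / γ) ^ 2 * ((2 * l) ^ (-x) * (2 * l) ^ (-y)) *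
          (γ - 1) ^ (-y) * (Real.Gamma x * Real.Gamma y) := by ring
    _ ≤ ((l * γ) ^ n / n.factorial) ^ 2 * (1 / γ) ^ 2 * ((2 * l) ^ (-x) * (2 * l) ^ (-y)) *
          (γ - 1) ^ (-y) * ((C₁ * ((2 / γ * N) ^ x * Real.exp (-(2 / γ * N)) / √N)) *
          (C₂ * ((2 * (γ - 1) / γ * N) ^ y * Real.exp (-(2 * (γ - 1) / γ * N)) / √N))) := by
        have : 0 < Real.Gamma y := Real.Gamma_pos_of_pos (by
          rw [hy]; apply div_pos _ hγ0; rw [hN]; nlinarith)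
        gcongr
    _ = ((l * γ) ^ n / n.factorial) ^ 2 * (1 / γ) ^ 2 * ((2 * l) ^ (-x) * (2 * l) ^ (-y)) *
          (γ - 1) ^ (-y) * (C₁ * C₂ * (((2 / γ * N) ^ x * (2 * (γ - 1) / γ * N) ^ y) *
          (Real.exp (-(2 / γ * N)) * Real.exp (-(2 * (γ - 1) / γ * N)))) / (√N * √N)) := by
        ring
    _ = (C₁ * C₂) * ((l * γ) ^ n / n.factorial) ^ 2 * (1 / γ) ^ 2 *
          ((2 * l) ^ (2 * (n + 1)))⁻¹ *
          ((γ - 1) ^ (-y) * (γ - 1) ^ y) * ((2 / γ * N) ^ (2 * (n + 1)) *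
          Real.exp (-(2 * N))) / N := by
        rw [e4, e5, e6, hsq]; ring
    _ = C₁ * C₂ / γ ^ 4 / l ^ 2 * ((N ^ (2 * (n + 1)) * Real.exp (-(2 * N)) * N) /
          (N * (n.factorial : ℝ)) ^ 2) := by
        rw [e7]
        simp only [mul_pow, div_pow]
        rw [show 2 * (n + 1) = n * 2 + 2 by ring]
        simp only [pow_add, pow_mul]
        field_simp
    _ ≤ C₁ * C₂ / γ ^ 4 / l ^ 2 * 1 := by
        gcongr
        rw [div_le_one (by positivity)]
        exact hfact'
    _ = _ := mul_one _

/-! ### Slice operators at a fixed vertical frequency -/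

theorem sq_lintegral_mul_le {X : Type*} [MeasurableSpace X] (μ : Measure X) {f g : X → ℝ≥0∞}
    (hf : AEMeasurable f μ) (hg : AEMeasurable g μ) :
    (∫⁻ x, f x * g x ∂μ) ^ 2 ≤ (∫⁻ x, f x ^ 2 ∂μ) * ∫⁻ x, g x ^ 2 ∂μ := by
  have h := ENNReal.lintegral_mul_le_Lp_mul_Lq μ (p := 2) (q := 2)
    ⟨by norm_num, by norm_num, by norm_num⟩ hf hg
  calc (∫⁻ x, f x * g x ∂μ) ^ 2 ≤
      ((∫⁻ x, f x ^ (2 : ℝ) ∂μ) ^ (1 / (2 : ℝ)) * (∫⁻ x, g x ^ (2 : ℝ) ∂μ) ^ (1 / (2 : ℝ))) ^ 2 := by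
        gcongr
        exact h
    _ = _ := by
        rw [mul_pow, ← ENNReal.rpow_natCast, ← ENNReal.rpow_natCast, ← ENNReal.rpow_mul,
          ← ENNReal.rpow_mul]
        norm_num

theorem norm_exp_sub_mul_I (φ θ : ℝ) : ‖Complex.exp ((φ - θ) * Complex.I)‖ = 1 := by
  have := Complex.norm_exp_ofReal_mul_I (φ - θ)
  simpa using this

theorem integrable_of_bound_of_support {f : ℝ × ℝ → ℂ} {M N : ℝ}
    (hf : AEStronglyMeasurable f (ray.prod angle))
    (hb : ∀ p, 0 < p.1 → p.1 ≤ N → ‖f p‖ ≤ M) (hs : ∀ p, N < p.1 → f p = 0) :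
    Integrable f (ray.prod angle) := by
  have hfin : (ray.prod angle) (Set.Iic N ×ˢ Set.univ) < ∞ := by
    rw [Measure.prod_prod]
    refine ENNReal.mul_lt_top ?_ (measure_lt_top _ _)
    rw [Measure.restrict_apply measurableSet_Iic, Set.Iic_inter_Ioi]
    exact measure_Ioc_lt_top
  have h : Integrable ((Set.Iic N ×ˢ Set.univ).indicator fun _ : ℝ × ℝ => M) (ray.prod angle) :=
    (integrableOn_const (hs := hfin.ne)).integrable_indicator
      (measurableSet_Iic.prod MeasurableSet.univ)
  refine h.mono' hf ?_
  have hpos : ∀ᵐ p : ℝ × ℝ ∂(ray.prod angle), 0 < p.1 :=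
    Measure.quasiMeasurePreserving_fst.ae (ae_restrict_mem measurableSet_Ioi)
  filter_upwards [hpos] with p hp
  by_cases hN : p.1 ≤ N
  · rw [Set.indicator_of_mem (by exact ⟨hN, Set.mem_univ _⟩)]
    exact hb p hp hN
  · rw [Set.indicator_of_notMem (by simpa using hN), hs p (by linarith), norm_zero]

/-- The action of the Leray transform on the slice of frequency `l` in the variable
`s = Re ζ₂`, in polar coordinates and up to a constant. -/
def slice (γ l : ℝ) (g : ℝ × ℝ → ℂ) (a φ : ℝ) : ℂ :=
  ∫ p : ℝ × ℝ, g p * ((p.1 ^ (γ - 1) : ℝ) : ℂ) *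
    Complex.exp (-l * (((γ - 1) * p.1 ^ γ + a ^ γ : ℝ) -
      ((γ * p.1 ^ (γ - 1) * a : ℝ) : ℂ) * Complex.exp ((φ - p.2) * Complex.I))) ∂(ray.prod angle)

/-- The radial moment of the `n`-th Fourier coefficient of `g`. -/
def moment (γ l : ℝ) (g : ℝ × ℝ → ℂ) (n : ℕ) : ℂ :=
  ∫ α : ℝ, ((α ^ ((γ - 1) * (n + 1)) * Real.exp (-(l * (γ - 1)) * α ^ γ) : ℝ) : ℂ) *
    ∫ θ : ℝ, Complex.exp (-(n * θ * Complex.I)) * g (α, θ) ∂angle ∂ray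

/-- Expanding exp(lγ α^(γ-1) a e^{i(φ-θ)}) in powers separates (a, φ) from (α, θ): the n-th term has
rank one and sees only the n-th angular coefficient of g. Boundedness and bounded radial support of
g dominate the series by an exponential series. -/
theorem slice_eq_tsum {γ l : ℝ} {g : ℝ × ℝ → ℂ} {M N : ℝ} (hγ : 1 < γ) (hl : 0 < l)
    (hg : Measurable g) (hM : ∀ p, ‖g p‖ ≤ M) (hN : ∀ p, N < p.1 → g p = 0) {a : ℝ} (ha : 0 < a) :
    (Summable fun n : ℕ => ‖((Real.exp (-l * a ^ γ) * ((l * γ) ^ n / n.factorial * a ^ n) : ℝ) : ℂ)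
      * moment γ l g n‖) ∧
    ∀ φ : ℝ, slice γ l g a φ =
      ∑' n : ℕ, ((Real.exp (-l * a ^ γ) * ((l * γ) ^ n / n.factorial * a ^ n) : ℝ) : ℂ)
        * moment γ l g n * Complex.exp (n * φ * Complex.I) := by
  have hM0 : 0 ≤ M := (norm_nonneg _).trans (hM 0)
  set N' := max N 0 with hN'
  set F : ℝ → ℕ → ℝ × ℝ → ℂ := fun φ n p =>
    g p * ((p.1 ^ (γ - 1) * Real.exp (-(l * (γ - 1)) * p.1 ^ γ) * Real.exp (-l * a ^ γ) : ℝ) : ℂ) *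
      (((l * γ * p.1 ^ (γ - 1) * a) ^ n / n.factorial : ℝ) : ℂ) *
      Complex.exp (n * (φ - p.2) * Complex.I) with hF
  have hexp1 : ∀ (n : ℕ) (φ θ : ℝ), ‖Complex.exp (n * (φ - θ) * Complex.I)‖ = 1 := by
    intro n φ θ
    have := norm_exp_nat_mul_I n (φ - θ)
    push_cast at this
    exact this
  have hFm : ∀ φ n, Measurable (F φ n) := by
    intro φ n
    simp only [hF]
    fun_prop
  have hFb : ∀ φ n p, 0 < p.1 → p.1 ≤ N → ‖F φ n p‖ ≤
      (M * N' ^ (γ - 1)) * ((l * γ * N' ^ (γ - 1) * a) ^ n / n.factorial) := by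
    intro φ n p hp hpN
    simp only [hF]
    rw [norm_mul, hexp1, mul_one, norm_mul, norm_mul, Complex.norm_real, Complex.norm_real,
      Real.norm_of_nonneg (by positivity), Real.norm_of_nonneg (by positivity)]
    have h1 : p.1 ^ (γ - 1) ≤ N' ^ (γ - 1) :=
      Real.rpow_le_rpow hp.le (hpN.trans (le_max_left _ _)) (by linarith)
    have h2 : Real.exp (-(l * (γ - 1)) * p.1 ^ γ) ≤ 1 := by
      rw [Real.exp_le_one_iff]
      have : 0 < l * (γ - 1) := mul_pos hl (by linarith)
      have := Real.rpow_nonneg hp.le γ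
      nlinarith
    have h3 : Real.exp (-l * a ^ γ) ≤ 1 := by
      rw [Real.exp_le_one_iff]
      have := Real.rpow_nonneg ha.le γ
      nlinarith
    have h4 : p.1 ^ (γ - 1) * Real.exp (-(l * (γ - 1)) * p.1 ^ γ) * Real.exp (-l * a ^ γ) ≤
        N' ^ (γ - 1) * 1 * 1 := by gcongr
    rw [mul_one, mul_one] at h4
    have hγ0 : 0 < γ := by linarith
    have h5 : 0 ≤ p.1 ^ (γ - 1) * Real.exp (-(l * (γ - 1)) * p.1 ^ γ) * Real.exp (-l * a ^ γ) := by
      positivity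
    have h6 : (l * γ * p.1 ^ (γ - 1) * a) ^ n / n.factorial ≤
        (l * γ * N' ^ (γ - 1) * a) ^ n / n.factorial := by gcongr
    have h7 : 0 ≤ (l * γ * p.1 ^ (γ - 1) * a) ^ n / n.factorial := by positivity
    have := hM p
    gcongr
  have hFs : ∀ φ n p, N < p.1 → F φ n p = 0 := by
    intro φ n p hp
    simp only [hF]
    rw [hN p hp]
    ring
  have hFi : ∀ φ n, Integrable (F φ n) (ray.prod angle) := fun φ n =>
    integrable_of_bound_of_support (hFm φ n).aestronglyMeasurable (hFb φ n) (hFs φ n)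
  have hFsum : ∀ φ, Summable fun n => ∫ p, ‖F φ n p‖ ∂(ray.prod angle) := by
    intro φ
    set W : ℝ := ∫ p : ℝ × ℝ, (Set.Iic N ×ˢ Set.univ).indicator (fun _ => (1 : ℝ)) p
      ∂(ray.prod angle)
    refine Summable.of_nonneg_of_le (fun n => integral_nonneg fun p => norm_nonneg _) (fun n => ?_)
      (((Real.summable_pow_div_factorial (l * γ * N' ^ (γ - 1) * a)).mul_left
        (M * N' ^ (γ - 1))).mul_right W)
    rw [← integral_const_mul]
    have hind : Integrable ((Set.Iic N ×ˢ Set.univ).indicator fun _ : ℝ × ℝ => (1 : ℂ))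
        (ray.prod angle) := by
      refine integrable_of_bound_of_support (M := 1) (N := N) ?_ ?_ ?_
      · exact (measurable_const.indicator
          (measurableSet_Iic.prod MeasurableSet.univ)).aestronglyMeasurable
      · intro p _ _
        by_cases h : p ∈ Set.Iic N ×ˢ (Set.univ : Set ℝ) <;> simp [h]
      · intro p hp
        rw [Set.indicator_of_notMem (by simpa using hp)]
    have hind' : Integrable ((Set.Iic N ×ˢ Set.univ).indicator fun _ : ℝ × ℝ => (1 : ℝ))
        (ray.prod angle) := by
      refine hind.norm.congr (.of_forall fun p => ?_)
      by_cases h : p ∈ Set.Iic N ×ˢ (Set.univ : Set ℝ) <;> simp [h]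
    have hpos : ∀ᵐ p : ℝ × ℝ ∂(ray.prod angle), 0 < p.1 :=
      Measure.quasiMeasurePreserving_fst.ae (ae_restrict_mem measurableSet_Ioi)
    refine integral_mono_ae (hFi φ n).norm (hind'.const_mul _) ?_
    filter_upwards [hpos] with p hp
    by_cases h : p.1 ≤ N
    · rw [Set.indicator_of_mem (by exact ⟨h, Set.mem_univ _⟩), mul_one]
      exact hFb φ n p hp h
    · rw [Set.indicator_of_notMem (by simpa using h), hFs φ n p (by linarith), norm_zero, mul_zero]
  have hFint : ∀ φ n, ∫ p, F φ n p ∂(ray.prod angle) =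
      ((Real.exp (-l * a ^ γ) * ((l * γ) ^ n / n.factorial * a ^ n) : ℝ) : ℂ)
        * moment γ l g n * Complex.exp (n * φ * Complex.I) := by
    intro φ n
    rw [integral_prod _ (hFi φ n), moment, mul_right_comm, ← integral_const_mul]
    refine setIntegral_congr_fun measurableSet_Ioi fun α (hα : 0 < α) => ?_
    rw [← mul_assoc, ← integral_const_mul]
    refine integral_congr_ae (.of_forall fun θ => ?_)
    simp only [hF]
    have e1 : Complex.exp (n * (φ - θ) * Complex.I) =
        Complex.exp (n * φ * Complex.I) * Complex.exp (-(n * θ * Complex.I)) := by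
      rw [← Complex.exp_add]; congr 1; ring
    have e2 : α ^ ((γ - 1) * ((n : ℝ) + 1)) = α ^ (γ - 1) * (α ^ (γ - 1)) ^ n := by
      rw [← Real.rpow_natCast, ← Real.rpow_mul hα.le, ← Real.rpow_add hα]
      congr 1; ring
    rw [e1, e2]
    push_cast
    ring
  refine ⟨?_, fun φ => ?_⟩
  -- The phases e^{inφ} have modulus one, so the case φ = 0 already gives the summability.
  · refine Summable.of_nonneg_of_le (fun n => norm_nonneg _) (fun n => ?_) (hFsum 0)
    have := norm_integral_le_integral_norm (μ := ray.prod angle) (F 0 n)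
    rw [hFint 0 n] at this
    simpa using this
  · have h := hasSum_integral_of_summable_integral_norm (hFi φ) (hFsum φ)
    simp only [hFint] at h
    rw [h.tsum_eq, slice]
    refine integral_congr_ae (.of_forall fun p => ?_)
    simp only [hF]
    have e1 : ∀ n : ℕ, g p * ((p.1 ^ (γ - 1) * Real.exp (-(l * (γ - 1)) * p.1 ^ γ) *
        Real.exp (-l * a ^ γ) : ℝ) : ℂ) * (((l * γ * p.1 ^ (γ - 1) * a) ^ n / n.factorial : ℝ) : ℂ) *
        Complex.exp (n * (φ - p.2) * Complex.I) =
        g p * ((p.1 ^ (γ - 1) * Real.exp (-(l * (γ - 1)) * p.1 ^ γ) *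
        Real.exp (-l * a ^ γ) : ℝ) : ℂ) * ((((l * γ * p.1 ^ (γ - 1) * a : ℝ) : ℂ) *
          Complex.exp ((φ - p.2) * Complex.I)) ^ n / n.factorial) := by
      intro n
      rw [mul_pow (((l * γ * p.1 ^ (γ - 1) * a : ℝ) : ℂ)), ← Complex.exp_nat_mul,
        ← mul_assoc (n : ℂ)]
      push_cast
      ring
    simp only [e1]
    rw [tsum_mul_left, ← exp_eq_tsum_pow_div]
    have e2 : Complex.exp (-l * (((γ - 1) * p.1 ^ γ + a ^ γ : ℝ) -
        ((γ * p.1 ^ (γ - 1) * a : ℝ) : ℂ) * Complex.exp ((φ - p.2) * Complex.I))) =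
        ((Real.exp (-(l * (γ - 1)) * p.1 ^ γ) * Real.exp (-l * a ^ γ) : ℝ) : ℂ) *
        Complex.exp (((l * γ * p.1 ^ (γ - 1) * a : ℝ) : ℂ) *
          Complex.exp ((φ - p.2) * Complex.I)) := by
      rw [← Real.exp_add, Complex.ofReal_exp, ← Complex.exp_add]
      congr 1
      push_cast
      ring
    rw [e2]
    push_cast
    ring

theorem measurable_fourier_angle {g : ℝ × ℝ → ℂ} (hg : Measurable g) (n : ℕ) :
    Measurable fun α : ℝ => ∫ θ : ℝ, Complex.exp (-(n * θ * Complex.I)) * g (α, θ) ∂angle := by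
  have : StronglyMeasurable fun p : ℝ × ℝ => Complex.exp (-(n * p.2 * Complex.I)) * g p :=
    Measurable.stronglyMeasurable (by fun_prop)
  exact this.integral_prod_right'.measurable

/-- Cauchy–Schwarz after splitting the weight as α^((γ-1)(n+1) - r/2) · α^(r/2). The first factor is
square integrable at 0 for every n ≥ 0 because r < 2γ - 1, the binding case being n = 0. -/
theorem enorm_moment_sq_le {γ l r : ℝ} {g : ℝ × ℝ → ℂ} (n : ℕ) (hγ : 1 < γ) (hr' : r < 2 * γ - 1)
    (hl : 0 < l) (hg : Measurable g) :
    ‖moment γ l g n‖ₑ ^ 2 ≤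
      ENNReal.ofReal (∫ a in Set.Ioi (0 : ℝ), a ^ (2 * (γ - 1) * (n + 1) - r) *
          Real.exp (-(2 * l * (γ - 1)) * a ^ γ)) *
      ∫⁻ α, ENNReal.ofReal (α ^ r) *
        ‖∫ θ : ℝ, Complex.exp (-(n * θ * Complex.I)) * g (α, θ) ∂angle‖ₑ ^ 2 ∂ray := by
  have hm := measurable_fourier_angle hg n
  set G : ℝ → ℂ := fun α => ∫ θ : ℝ, Complex.exp (-(n * θ * Complex.I)) * g (α, θ) ∂angle
  have h1 : ‖moment γ l g n‖ₑ ≤ ∫⁻ α : ℝ,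
      ENNReal.ofReal (α ^ ((γ - 1) * (n + 1) - r / 2) * Real.exp (-(l * (γ - 1)) * α ^ γ)) *
        (ENNReal.ofReal (α ^ (r / 2)) * ‖G α‖ₑ) ∂ray := by
    refine (enorm_integral_le_lintegral_enorm _).trans ?_
    refine le_of_eq (setLIntegral_congr_fun measurableSet_Ioi fun α (hα : 0 < α) => ?_)
    rw [enorm_mul, ← mul_assoc, ← ENNReal.ofReal_mul (by positivity)]
    congr 1
    rw [← ofReal_norm, Complex.norm_real, Real.norm_of_nonneg (by positivity)]
    congr 1
    rw [mul_right_comm, ← Real.rpow_add hα]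
    congr 2
    ring
  calc ‖moment γ l g n‖ₑ ^ 2 ≤ _ := by gcongr
    _ ≤ _ := sq_lintegral_mul_le ray (by fun_prop) (by fun_prop)
    _ = _ := by
      congr 1
      · rw [ofReal_integral_eq_lintegral_ofReal]
        · refine setLIntegral_congr_fun measurableSet_Ioi fun α (hα : 0 < α) => ?_
          rw [← ENNReal.ofReal_pow (by positivity)]
          congr 1
          rw [mul_pow, ← Real.rpow_natCast, ← Real.rpow_mul hα.le, ← Real.exp_nat_mul]
          congr 2
          · push_cast; ring
          · push_cast; ring
        · have := (integrableOn_rpow_mul_exp_neg_mul_rpow (p := γ)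
            (s := 2 * (γ - 1) * (n + 1) - r) (b := 2 * l * (γ - 1))
            (by have : (0 : ℝ) ≤ n := Nat.cast_nonneg n
                nlinarith) (by linarith)
            (mul_pos (by linarith) (by linarith)))
          exact this
        · filter_upwards [ae_restrict_mem measurableSet_Ioi] with α hα
          have : (0 : ℝ) < α := hα
          simp only [Pi.zero_apply]
          positivity
      · refine setLIntegral_congr_fun measurableSet_Ioi fun α (hα : 0 < α) => ?_
        rw [mul_pow, ← ENNReal.ofReal_pow (by positivity), ← Real.rpow_natCast,
          ← Real.rpow_mul hα.le]
        congr 3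
        push_cast; ring

/-- The slice operators are bounded on `L²(α^r dα dθ)`, with norm `O(1 / l)`. -/
theorem exists_lintegral_slice_le {γ r : ℝ} (hγ : 1 < γ) (hr : -1 < r) (hr' : r < 2 * γ - 1) :
    ∃ C : ℝ≥0, ∀ (l : ℝ) (g : ℝ × ℝ → ℂ) (M N : ℝ), 0 < l → Measurable g →
      (∀ p, ‖g p‖ ≤ M) → (∀ p, N < p.1 → g p = 0) →
      ENNReal.ofReal (l ^ 2) *
        ∫⁻ a, ENNReal.ofReal (a ^ r) * ∫⁻ φ, ‖slice γ l g a φ‖ₑ ^ 2 ∂angle ∂ray ≤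
      C * ∫⁻ α, ENNReal.ofReal (α ^ r) * ∫⁻ θ, ‖g (α, θ)‖ₑ ^ 2 ∂angle ∂ray := by
  obtain ⟨C, hC, hmode⟩ := exists_mode_norm_le hγ hr hr'
  -- One factor 2π comes from Parseval in φ, the other from Bessel in θ.
  refine ⟨(2 * Real.pi * C * (2 * Real.pi)).toNNReal, fun l g M N hl hg hM hN => ?_⟩
  set G : ℕ → ℝ → ℂ := fun n α => ∫ θ : ℝ, Complex.exp (-(n * θ * Complex.I)) * g (α, θ) ∂angle
  have hG : ∀ n, Measurable (G n) := measurable_fourier_angle hg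
  set U : ℕ → ℝ := fun n => ∫ a in Set.Ioi (0 : ℝ), a ^ (2 * n + r) * Real.exp (-(2 * l) * a ^ γ)
  set V : ℕ → ℝ := fun n => ∫ a in Set.Ioi (0 : ℝ), a ^ (2 * (γ - 1) * (n + 1) - r) *
          Real.exp (-(2 * l * (γ - 1)) * a ^ γ)
  set K : ℕ → ℝ := fun n => (l * γ) ^ n / n.factorial
  have hγ0 : 0 < γ := by linarith
  have h1 : ∀ a : ℝ, 0 < a → ∫⁻ φ, ‖slice γ l g a φ‖ₑ ^ 2 ∂angle =
      ENNReal.ofReal (2 * Real.pi) * ∑' n : ℕ,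
        ENNReal.ofReal (K n ^ 2 * (a ^ (2 * n) * Real.exp (-(2 * l) * a ^ γ))) *
          ‖moment γ l g n‖ₑ ^ 2 := by
    intro a ha
    obtain ⟨hs, he⟩ := slice_eq_tsum hγ hl hg hM hN ha
    simp only [he]
    rw [lintegral_enorm_tsum_exp_sq hs]
    congr 1
    refine tsum_congr fun n => ?_
    rw [enorm_mul, mul_pow, ← ofReal_norm, Complex.norm_real, Real.norm_of_nonneg (by positivity),
      ← ENNReal.ofReal_pow (by positivity)]
    congr 2
    rw [mul_pow, mul_pow, ← Real.exp_nat_mul, ← pow_mul, mul_comm n 2]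
    push_cast
    rw [show 2 * (-l * a ^ γ) = -(2 * l) * a ^ γ by ring]
    ring
  have h2 : ∫⁻ a, ENNReal.ofReal (a ^ r) * ∫⁻ φ, ‖slice γ l g a φ‖ₑ ^ 2 ∂angle ∂ray =
      ENNReal.ofReal (2 * Real.pi) * ∑' n : ℕ,
        ENNReal.ofReal (K n ^ 2 * U n) * ‖moment γ l g n‖ₑ ^ 2 := by
    calc _ = ∫⁻ a, ENNReal.ofReal (2 * Real.pi) * ∑' n : ℕ, ENNReal.ofReal (K n ^ 2) *
            ENNReal.ofReal (a ^ (2 * n + r) * Real.exp (-(2 * l) * a ^ γ)) *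
          ‖moment γ l g n‖ₑ ^ 2 ∂ray := by
          refine setLIntegral_congr_fun measurableSet_Ioi fun a (ha : 0 < a) => ?_
          rw [h1 a ha, mul_left_comm, ← ENNReal.tsum_mul_left]
          congr 1
          refine tsum_congr fun n => ?_
          rw [← mul_assoc, ← ENNReal.ofReal_mul (by positivity),
            ← ENNReal.ofReal_mul (by positivity)]
          congr 2
          rw [Real.rpow_add ha, show (2 * (n : ℝ)) = ((2 * n : ℕ) : ℝ) by push_cast; ring,
            Real.rpow_natCast]
          ring
      _ = _ := by
          rw [lintegral_const_mul _ (by fun_prop), lintegral_tsum (fun n => by fun_prop)]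
          congr 1
          refine tsum_congr fun n => ?_
          rw [lintegral_mul_const _ (by fun_prop), lintegral_const_mul _ (by fun_prop),
            ENNReal.ofReal_mul (by positivity), ofReal_integral_eq_lintegral_ofReal]
          · exact (integrableOn_rpow_mul_exp_neg_mul_rpow (p := γ)
              (s := 2 * n + r) (b := 2 * l)
              (by have : (0 : ℝ) ≤ n := Nat.cast_nonneg n
                  linarith) (by linarith) (by positivity))
          · filter_upwards [ae_restrict_mem measurableSet_Ioi] with α hα
            have : (0 : ℝ) < α := hα
            simp only [Pi.zero_apply]
            positivity
  -- Cauchy–Schwarz for the moment turns the n-th term into K n ^ 2 * U n * V n, which the mode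
  -- bound controls by C / l² with C free of n.
  have h3 : ∀ n : ℕ, ENNReal.ofReal (l ^ 2) *
      (ENNReal.ofReal (K n ^ 2 * U n) * ‖moment γ l g n‖ₑ ^ 2) ≤
      ENNReal.ofReal C * ∫⁻ α, ENNReal.ofReal (α ^ r) * ‖G n α‖ₑ ^ 2 ∂ray := by
    intro n
    have hU : 0 ≤ U n := setIntegral_nonneg measurableSet_Ioi fun a (ha : 0 < a) => by positivity
    have hV : 0 ≤ V n := setIntegral_nonneg measurableSet_Ioi fun a (ha : 0 < a) => by positivity
    calc _ ≤ ENNReal.ofReal (l ^ 2) * (ENNReal.ofReal (K n ^ 2 * U n) *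
          (ENNReal.ofReal (V n) * ∫⁻ α, ENNReal.ofReal (α ^ r) * ‖G n α‖ₑ ^ 2 ∂ray)) := by
          gcongr
          exact enorm_moment_sq_le n hγ hr' hl hg
      _ = ENNReal.ofReal (l ^ 2 * (K n ^ 2 * (U n * V n))) *
          ∫⁻ α, ENNReal.ofReal (α ^ r) * ‖G n α‖ₑ ^ 2 ∂ray := by
          rw [ENNReal.ofReal_mul (p := l ^ 2) (by positivity), ← mul_assoc (K n ^ 2),
            ENNReal.ofReal_mul (p := K n ^ 2 * U n) (q := V n) (by positivity)]
          ring
      _ ≤ _ := by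
          gcongr
          have h := hmode n l hl
          rw [le_div_iff₀ (by positivity), mul_comm] at h
          exact h
  have h4 : ∑' n : ℕ, ∫⁻ α, ENNReal.ofReal (α ^ r) * ‖G n α‖ₑ ^ 2 ∂ray ≤
      ENNReal.ofReal (2 * Real.pi) *
        ∫⁻ α, ENNReal.ofReal (α ^ r) * ∫⁻ θ, ‖g (α, θ)‖ₑ ^ 2 ∂angle ∂ray := by
    rw [← lintegral_tsum (fun n => by fun_prop), ← lintegral_const_mul']
    · refine lintegral_mono fun α => ?_
      rw [ENNReal.tsum_mul_left, mul_left_comm]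
      gcongr
      refine tsum_nat_enorm_fourier_sq_le ?_
      refine MemLp.of_bound ?_ M (.of_forall fun θ => hM _)
      exact (hg.comp measurable_prodMk_left).aestronglyMeasurable
    · exact ENNReal.ofReal_ne_top
  calc _ = ENNReal.ofReal (2 * Real.pi) * ∑' n : ℕ, ENNReal.ofReal (l ^ 2) *
      (ENNReal.ofReal (K n ^ 2 * U n) * ‖moment γ l g n‖ₑ ^ 2) := by
        rw [h2, ENNReal.tsum_mul_left, mul_left_comm]
    _ ≤ ENNReal.ofReal (2 * Real.pi) * ∑' n : ℕ,
      (ENNReal.ofReal C * ∫⁻ α, ENNReal.ofReal (α ^ r) * ‖G n α‖ₑ ^ 2 ∂ray) := by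
        exact mul_le_mul_right (ENNReal.tsum_le_tsum h3) _
    _ ≤ ENNReal.ofReal (2 * Real.pi) * (ENNReal.ofReal C * (ENNReal.ofReal (2 * Real.pi) *
        ∫⁻ α, ENNReal.ofReal (α ^ r) * ∫⁻ θ, ‖g (α, θ)‖ₑ ^ 2 ∂angle ∂ray)) := by
        rw [ENNReal.tsum_mul_left]
        gcongr
    _ = _ := by
        rw [← mul_assoc, ← mul_assoc, ← ENNReal.ofReal_mul (by positivity),
          ← ENNReal.ofReal_mul (by positivity)]
        rfl

/-! ### The measures μ_r in polar coordinates -/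

/-- The measure `dα dθ ds` on the coordinate space `(0, ∞) × [0, 2π) × ℝ`. -/
abbrev coords : Measure (ℝ × ℝ × ℝ) := ray.prod (angle.prod volume)

theorem mu_eq_map (γ r : ℝ) :
    mu γ r = Measure.map (polarPoint γ) (coords.withDensity fun p => ENNReal.ofReal (p.1 ^ r)) := by
  rw [mu]
  congr 2
  rw [Measure.volume_eq_prod, ← Measure.prod_restrict, Measure.volume_eq_prod,
    ← Measure.prod_restrict, Measure.restrict_univ]

theorem ae_coords_pos : ∀ᵐ p : ℝ × ℝ × ℝ ∂coords, 0 < p.1 :=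
  Measure.quasiMeasurePreserving_fst.ae (ae_restrict_mem measurableSet_Ioi)

instance (γ r : ℝ) : SFinite (mu γ r) := by
  rw [mu_eq_map]; infer_instance

theorem norm_polarPoint_fst (γ : ℝ) {p : ℝ × ℝ × ℝ} (hp : 0 ≤ p.1) :
    ‖(polarPoint γ p).1.1‖ = p.1 := by
  simp [polarPoint, Complex.norm_exp_ofReal_mul_I, abs_of_nonneg hp]

theorem lintegral_mu {γ r : ℝ} {F : hypersurface γ → ℝ≥0∞} (hF : AEMeasurable F (mu γ r)) :
    ∫⁻ ζ, F ζ ∂(mu γ r) = ∫⁻ p, ENNReal.ofReal (p.1 ^ r) * F (polarPoint γ p) ∂coords := by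
  rw [mu_eq_map] at hF ⊢
  rw [lintegral_map' hF (measurable_polarPoint γ).aemeasurable,
    lintegral_withDensity_eq_lintegral_mul₀' (by fun_prop)
      (g := fun p => F (polarPoint γ p)) (hF.comp_measurable (measurable_polarPoint γ))]
  rfl

theorem mu_add (γ r q : ℝ) :
    mu γ (r + q) = (mu γ r).withDensity fun ζ => ENNReal.ofReal (‖ζ.1.1‖ ^ q) := by
  ext s hs
  rw [withDensity_apply _ hs, ← lintegral_indicator hs, ← lintegral_indicator_one hs,
    lintegral_mu (measurable_one.indicator hs).aemeasurable,
    lintegral_mu (Measurable.indicator (by fun_prop) hs).aemeasurable]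
  refine lintegral_congr_ae ?_
  filter_upwards [ae_coords_pos] with p hp
  by_cases h : polarPoint γ p ∈ s
  · rw [Set.indicator_of_mem h, Set.indicator_of_mem h, norm_polarPoint_fst γ hp.le,
      Real.rpow_add hp, ENNReal.ofReal_mul (by positivity)]
    simp
  · rw [Set.indicator_of_notMem h, Set.indicator_of_notMem h]
    simp

/-- The density |ζ₁|^(r-r') relates any two of these measures, so measurability and almost
everywhere statements pass freely between exponents. -/
theorem mu_absolutelyContinuous (γ r r' : ℝ) : mu γ r ≪ mu γ r' := by
  have h := mu_add γ r' (r - r')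
  rw [add_sub_cancel] at h
  rw [h]
  exact withDensity_absolutelyContinuous _ _

theorem ae_mu_norm_pos (γ r : ℝ) : ∀ᵐ ζ ∂(mu γ r), 0 < ‖ζ.1.1‖ := by
  rw [mu_eq_map, ae_map_iff (measurable_polarPoint γ).aemeasurable
    (measurableSet_lt measurable_const (by fun_prop))]
  refine (withDensity_absolutelyContinuous _ _).ae_le ?_
  filter_upwards [ae_coords_pos] with p hp
  rwa [norm_polarPoint_fst γ hp.le]

theorem aemeasurable_comp_polarPoint {γ r : ℝ} {β : Type*} [MeasurableSpace β]
    {F : hypersurface γ → β} (hF : AEMeasurable F (mu γ r)) :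
    AEMeasurable (fun p => F (polarPoint γ p)) coords := by
  -- At exponent 0 the weight is 1, and the measure is the plain image of `coords`.
  have h := hF.mono_ac (mu_absolutelyContinuous γ 0 r)
  rw [mu_eq_map] at h
  have h1 : (fun p : ℝ × ℝ × ℝ => ENNReal.ofReal (p.1 ^ (0 : ℝ))) = 1 := by
    ext p; simp
  rw [h1, withDensity_one] at h
  exact h.comp_measurable (measurable_polarPoint γ)

theorem integral_mu {γ r : ℝ} {F : hypersurface γ → ℂ} (hF : AEStronglyMeasurable F (mu γ r)) :
    ∫ ζ, F ζ ∂(mu γ r) = ∫ p, ((p.1 ^ r : ℝ) : ℂ) * F (polarPoint γ p) ∂coords := by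
  rw [mu_eq_map] at hF ⊢
  rw [integral_map (measurable_polarPoint γ).aemeasurable hF,
    integral_withDensity_eq_integral_toReal_smul (by fun_prop) (.of_forall fun p => by simp)]
  refine integral_congr_ae ?_
  filter_upwards [ae_coords_pos] with p hp
  rw [ENNReal.toReal_ofReal (by positivity), Complex.real_smul]

theorem lintegral_coords {F : ℝ × ℝ × ℝ → ℝ≥0∞} (hF : Measurable F) :
    ∫⁻ p, F p ∂coords = ∫⁻ α, ∫⁻ θ, ∫⁻ s, F (α, θ, s) ∂volume ∂angle ∂ray := by
  rw [lintegral_prod _ hF.aemeasurable]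
  refine lintegral_congr fun α => ?_
  rw [lintegral_prod _ (by fun_prop)]

/-- Cauchy–Schwarz after splitting the weight α^((r+q)/2). With q = 2(γ - 1) - r the middle measure
is σ, so L²(μ_r) and L²(μ_q) are in duality under the pairing of the Leray integral. -/
theorem sq_lintegral_mul_mu_le {γ r q : ℝ} {f h : hypersurface γ → ℝ≥0∞}
    (hf : AEMeasurable f (mu γ r)) (hh : AEMeasurable h (mu γ q)) :
    (∫⁻ ζ, f ζ * h ζ ∂(mu γ ((r + q) / 2))) ^ 2 ≤
      (∫⁻ ζ, f ζ ^ 2 ∂(mu γ r)) * ∫⁻ ζ, h ζ ^ 2 ∂(mu γ q) := by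
  have hf' := aemeasurable_comp_polarPoint hf
  have hh' := aemeasurable_comp_polarPoint hh
  have hfh : AEMeasurable (fun ζ => f ζ * h ζ) (mu γ ((r + q) / 2)) :=
    (hf.mono_ac (mu_absolutelyContinuous _ _ _)).mul (hh.mono_ac (mu_absolutelyContinuous _ _ _))
  rw [lintegral_mu hfh,
    lintegral_mu (by fun_prop), lintegral_mu (by fun_prop)]
  have e : ∫⁻ p, ENNReal.ofReal (p.1 ^ ((r + q) / 2)) *
      (f (polarPoint γ p) * h (polarPoint γ p)) ∂coords =
      ∫⁻ p, (ENNReal.ofReal (p.1 ^ (r / 2)) * f (polarPoint γ p)) *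
        (ENNReal.ofReal (p.1 ^ (q / 2)) * h (polarPoint γ p)) ∂coords := by
    refine lintegral_congr_ae ?_
    filter_upwards [ae_coords_pos] with p hp
    rw [add_div, Real.rpow_add hp, ENNReal.ofReal_mul (by positivity)]
    ring
  rw [e]
  have hw : ∀ q : ℝ, AEMeasurable (fun p : ℝ × ℝ × ℝ => ENNReal.ofReal (p.1 ^ q)) coords :=
    fun q => Measurable.aemeasurable (by fun_prop)
  refine (sq_lintegral_mul_le coords ((hw _).mul hf') ((hw _).mul hh')).trans (le_of_eq ?_)
  congr 1
  all_goals
    refine lintegral_congr_ae ?_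
    filter_upwards [ae_coords_pos] with p hp
    simp only [Pi.mul_apply]
    rw [mul_pow, ← ENNReal.ofReal_pow (by positivity), ← Real.rpow_natCast, ← Real.rpow_mul hp.le]
    congr 3
    push_cast
    ring

theorem lintegral_enorm_sq_eq {X : Type*} [MeasurableSpace X] {μ : Measure X} (f : X → ℂ) :
    ∫⁻ x, ‖f x‖ₑ ^ 2 ∂μ = eLpNorm f 2 μ ^ 2 := by
  have := eLpNorm_nnreal_pow_eq_lintegral (μ := μ) (f := f) (p := 2) (by norm_num)
  simpa using this.symm

/-! ### Size and integrability of the kernel -/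

/-- The denominator of the Leray kernel. -/
def bracket (γ : ℝ) (z ζ : ℂ × ℂ) : ℂ :=
  (γ : ℂ) * (starRingEnd ℂ) ζ.1 * ((‖ζ.1‖ ^ (γ - 2) : ℝ) : ℂ) * (ζ.1 - z.1)
      + Complex.I * (ζ.2 - z.2)

theorem kernel_eq (γ : ℝ) (z ζ : ℂ × ℂ) :
    kernel γ z ζ = ((γ ^ 2 / (4 * Real.pi ^ 2) : ℝ) : ℂ) / bracket γ z ζ ^ 2 := rfl

/-- The bracket is affine in s with slope i. Along vertical lines the kernel is therefore a multiple
of (D + is)⁻², with D independent of s. -/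
theorem bracket_polarPoint {γ : ℝ} (z : ℂ × ℂ) {p : ℝ × ℝ × ℝ} (hp : 0 < p.1) :
    bracket γ z (polarPoint γ p).1 =
      (((γ - 1) * p.1 ^ γ + z.2.im : ℝ) : ℂ) -
        ((γ * p.1 ^ (γ - 1) : ℝ) : ℂ) * (Complex.exp (-(p.2.1 * Complex.I)) * z.1) +
        ((p.2.2 - z.2.re : ℝ) : ℂ) * Complex.I := by
  have hn : ‖(p.1 : ℂ) * Complex.exp ((p.2.1 : ℂ) * Complex.I)‖ = p.1 :=
    norm_polarPoint_fst γ hp.le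
  have hc : (starRingEnd ℂ) ((p.1 : ℂ) * Complex.exp ((p.2.1 : ℂ) * Complex.I)) =
      (p.1 : ℂ) * Complex.exp (-(p.2.1 * Complex.I)) := by
    rw [map_mul, Complex.conj_ofReal, ← Complex.exp_conj, map_mul, Complex.conj_ofReal,
      Complex.conj_I, mul_neg]
  have h2 : (⟨p.2.2, p.1 ^ γ⟩ : ℂ) = (p.2.2 : ℂ) + ((p.1 ^ γ : ℝ) : ℂ) * Complex.I := by
    apply Complex.ext <;> simp
  have h3 : Complex.exp (-(p.2.1 * Complex.I)) * Complex.exp (p.2.1 * Complex.I) = 1 := by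
    rw [← Complex.exp_add]; simp
  have h4 : (p.1 : ℝ) ^ (γ - 1) = p.1 * p.1 ^ (γ - 2) := by
    rw [show γ - 1 = 1 + (γ - 2) by ring, Real.rpow_add hp, Real.rpow_one]
  have h5 : (p.1 : ℝ) ^ γ = p.1 * (p.1 * p.1 ^ (γ - 2)) := by
    rw [show γ = 1 + (1 + (γ - 2)) by ring, Real.rpow_add hp, Real.rpow_add hp, Real.rpow_one]
    congr 4
    ring
  have h6 : z.2 = z.2.re + z.2.im * Complex.I := (Complex.re_add_im _).symm
  simp only [bracket, polarPoint, hn, hc, h2]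
  rw [h4, h5]
  conv_lhs => rw [h6]
  push_cast
  have hI := Complex.I_mul_I
  linear_combination (γ * p.1 ^2 * ((p.1 ^ (γ - 2) : ℝ) : ℂ)) * h3 + (p.1 * (p.1 * ((p.1 ^ (γ - 2) : ℝ) : ℂ)) - z.2.im) * hI

/-- Weighted AM–GM for α^γ and a^γ with weights (γ-1)/γ and 1/γ. It yields Re bracket ≥ Im z₂ -
|z₁|^γ, the positivity on which every Laplace formula below rests. -/
theorem young_rpow {γ α a : ℝ} (hγ : 1 < γ) (hα : 0 ≤ α) (ha : 0 ≤ a) :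
    γ * α ^ (γ - 1) * a ≤ (γ - 1) * α ^ γ + a ^ γ := by
  have hγ0 : 0 < γ := by linarith
  have h := Real.geom_mean_le_arith_mean2_weighted (w₁ := (γ - 1) / γ) (w₂ := 1 / γ)
    (div_nonneg (by linarith) hγ0.le) (by positivity) (Real.rpow_nonneg hα γ)
    (Real.rpow_nonneg ha γ) (by field_simp; ring)
  rw [← Real.rpow_mul hα, ← Real.rpow_mul ha, mul_div_cancel₀ _ hγ0.ne',
    mul_one_div_cancel hγ0.ne', Real.rpow_one] at h
  have := mul_le_mul_of_nonneg_left h hγ0.le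
  calc γ * α ^ (γ - 1) * a = γ * (α ^ (γ - 1) * a) := by ring
    _ ≤ _ := this
    _ = _ := by field_simp

/-- For z in the open domain, b = (Im z₂)^(1/γ) exceeds |z₁|. Young's inequality at b, multiplied by
|z₁|/b < 1, leaves the fraction 1 - |z₁|/b of the positive part. -/
theorem exists_coercive_of_mem_domain {γ : ℝ} (hγ : 1 < γ) {z : ℂ × ℂ} (hz : z ∈ domain γ) :
    ∃ c : ℝ, 0 < c ∧ ∀ α : ℝ, 0 ≤ α →
      c * (1 + α ^ γ) ≤ (γ - 1) * α ^ γ + z.2.im - γ * α ^ (γ - 1) * ‖z.1‖ := by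
  have hγ0 : 0 < γ := by linarith
  set a := ‖z.1‖
  set y := z.2.im
  have hay : a ^ γ < y := hz
  have ha : 0 ≤ a := norm_nonneg _
  have hy : 0 < y := lt_of_le_of_lt (Real.rpow_nonneg ha γ) hay
  set b := y ^ (1 / γ)
  have hb : 0 < b := Real.rpow_pos_of_pos hy _
  have hbγ : b ^ γ = y := by
    rw [← Real.rpow_mul hy.le, one_div_mul_cancel hγ0.ne', Real.rpow_one]
  have hab : a < b := by
    rw [← hbγ] at hay
    exact (Real.rpow_lt_rpow_iff ha hb.le hγ0).1 hay
  have hq : a / b < 1 := (div_lt_one hb).2 hab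
  refine ⟨(1 - a / b) * min (γ - 1) y, mul_pos (by linarith) (lt_min (by linarith) hy),
    fun α hα => ?_⟩
  have h1 := young_rpow hγ hα hb.le
  rw [hbγ] at h1
  have h2 : γ * α ^ (γ - 1) * a = a / b * (γ * α ^ (γ - 1) * b) := by field_simp
  have hq0 : 0 ≤ a / b := by positivity
  have h3 : γ * α ^ (γ - 1) * a ≤ a / b * ((γ - 1) * α ^ γ + y) := by
    rw [h2]; gcongr
  have h4 : min (γ - 1) y * (1 + α ^ γ) ≤ (γ - 1) * α ^ γ + y := by
    have := min_le_left (γ - 1) y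
    have := min_le_right (γ - 1) y
    have := Real.rpow_nonneg hα γ
    nlinarith
  have h5 : (1 - a / b) * (min (γ - 1) y * (1 + α ^ γ)) ≤
      (1 - a / b) * ((γ - 1) * α ^ γ + y) := by
    apply mul_le_mul_of_nonneg_left h4; linarith
  nlinarith

/-- Here α is bounded and the estimate is uniform in a. Young's inequality is applied to κα and a/Q
with Q = κ^(γ-1) > 1, which leaves the mixed term unchanged: the term in α grows by at most ε/2 by
the choice of κ^γ = 1 + η, while a^γ keeps the fraction 1 - Q^(-γ). -/
theorem exists_coercive_of_le {γ ε N : ℝ} (hγ : 1 < γ) (hε : 0 < ε) :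
    ∃ c : ℝ, 0 < c ∧ ∀ α a : ℝ, 0 ≤ α → α ≤ N → 0 ≤ a →
      c * (1 + a ^ γ) ≤ (γ - 1) * α ^ γ + (a ^ γ + ε) - γ * α ^ (γ - 1) * a := by
  have hγ0 : 0 < γ := by linarith
  have hγ1 : 0 < γ - 1 := by linarith
  set M := max N 1
  have hM : 0 < M ^ γ := Real.rpow_pos_of_pos (lt_of_lt_of_le one_pos (le_max_right _ _)) _
  set η := ε / (2 * (γ - 1)) / M ^ γ
  have hη : 0 < η := by positivity
  set κ := (1 + η) ^ (1 / γ)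
  have hκ1 : 1 < κ := Real.one_lt_rpow (by linarith) (by positivity)
  have hκγ : κ ^ γ = 1 + η := by
    rw [← Real.rpow_mul (by positivity), one_div_mul_cancel hγ0.ne', Real.rpow_one]
  set Q := κ ^ (γ - 1)
  have hQ : 1 < Q := Real.one_lt_rpow hκ1 hγ1
  have hQγ : 1 < Q ^ γ := Real.one_lt_rpow hQ hγ0
  have hq : 0 < 1 - (Q ^ γ)⁻¹ := by
    have := inv_lt_one_of_one_lt₀ hQγ
    linarith
  refine ⟨min (ε / 2) (1 - (Q ^ γ)⁻¹), lt_min (by positivity) hq, fun α a hα hαN ha => ?_⟩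
  have h1 := young_rpow hγ (α := κ * α) (a := a / Q) (by positivity) (by positivity)
  rw [Real.mul_rpow (by positivity) hα, Real.mul_rpow (by positivity) hα,
    Real.div_rpow ha (by positivity), hκγ] at h1
  have h2 : γ * (Q * α ^ (γ - 1)) * (a / Q) = γ * α ^ (γ - 1) * a := by
    have : Q ≠ 0 := by positivity
    field_simp
  change γ * (Q * α ^ (γ - 1)) * (a / Q) ≤ _ at h1
  rw [h2] at h1
  have h3 : α ^ γ ≤ M ^ γ := Real.rpow_le_rpow hα (hαN.trans (le_max_left _ _)) hγ0.le
  have h4 : (γ - 1) * (η * α ^ γ) ≤ ε / 2 := by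
    calc (γ - 1) * (η * α ^ γ) ≤ (γ - 1) * (η * M ^ γ) := by gcongr
      _ = ε / 2 := by simp only [η]; field_simp
  have h5 := Real.rpow_nonneg ha γ
  have h6 := min_le_left (ε / 2) (1 - (Q ^ γ)⁻¹)
  have h7 := min_le_right (ε / 2) (1 - (Q ^ γ)⁻¹)
  have h8 : a ^ γ / Q ^ γ = a ^ γ * (Q ^ γ)⁻¹ := div_eq_mul_inv _ _
  nlinarith

theorem bracket_re {γ : ℝ} (z : ℂ × ℂ) {p : ℝ × ℝ × ℝ} (hp : 0 < p.1) :
    (bracket γ z (polarPoint γ p).1).re = (γ - 1) * p.1 ^ γ + z.2.im -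
      γ * p.1 ^ (γ - 1) * (Complex.exp (-(p.2.1 * Complex.I)) * z.1).re := by
  rw [bracket_polarPoint z hp]
  simp only [Complex.add_re, Complex.sub_re, Complex.ofReal_re, Complex.re_ofReal_mul,
    Complex.I_re, mul_zero, add_zero]

theorem bracket_im {γ : ℝ} (z : ℂ × ℂ) {p : ℝ × ℝ × ℝ} (hp : 0 < p.1) :
    (bracket γ z (polarPoint γ p).1).im = p.2.2 - (z.2.re +
      γ * p.1 ^ (γ - 1) * (Complex.exp (-(p.2.1 * Complex.I)) * z.1).im) := by
  rw [bracket_polarPoint z hp]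
  simp only [Complex.add_im, Complex.sub_im, Complex.ofReal_im, Complex.im_ofReal_mul,
    Complex.I_im]
  ring

theorem le_bracket_re {γ : ℝ} (hγ : 1 < γ) (z : ℂ × ℂ) {p : ℝ × ℝ × ℝ} (hp : 0 < p.1) :
    (γ - 1) * p.1 ^ γ + z.2.im - γ * p.1 ^ (γ - 1) * ‖z.1‖ ≤
      (bracket γ z (polarPoint γ p).1).re := by
  rw [bracket_re z hp]
  have h1 : (Complex.exp (-(p.2.1 * Complex.I)) * z.1).re ≤ ‖z.1‖ := by
    refine (Complex.re_le_norm _).trans (le_of_eq ?_)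
    have := Complex.norm_exp_ofReal_mul_I (-p.2.1)
    push_cast at this
    rw [norm_mul, ← neg_mul, this, one_mul]
  have h2 : 0 ≤ γ * p.1 ^ (γ - 1) := by positivity
  nlinarith [mul_le_mul_of_nonneg_left h1 h2]

theorem bracket_re_pos {γ : ℝ} (hγ : 1 < γ) {z : ℂ × ℂ} (hz : z ∈ domain γ) {p : ℝ × ℝ × ℝ}
    (hp : 0 < p.1) : 0 < (bracket γ z (polarPoint γ p).1).re := by
  refine lt_of_lt_of_le ?_ (le_bracket_re hγ z hp)
  have h := young_rpow hγ hp.le (norm_nonneg z.1)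
  have : ‖z.1‖ ^ γ < z.2.im := hz
  linarith

/-- Along `M_γ` the Leray kernel decays like a Cauchy density in `s = Re ζ₂`, centred at `τ`. -/
theorem exists_norm_kernel_le {γ : ℝ} (hγ : 1 < γ) {z : ℂ × ℂ} (hz : z ∈ domain γ) :
    ∃ (K : ℝ) (τ : ℝ × ℝ → ℝ), 0 < K ∧ Measurable τ ∧ ∀ p : ℝ × ℝ × ℝ, 0 < p.1 →
      ‖kernel γ z (polarPoint γ p).1‖ ≤ K * (1 + (p.2.2 - τ (p.1, p.2.1)) ^ 2)⁻¹ ∧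
      ‖kernel γ z (polarPoint γ p).1‖ ^ 2 ≤
        K * (((1 + p.1 ^ γ) ^ 2)⁻¹ * (1 + (p.2.2 - τ (p.1, p.2.1)) ^ 2)⁻¹) := by
  obtain ⟨c, hc, hcα⟩ := exists_coercive_of_mem_domain hγ hz
  set d := min (c ^ 2) 1
  have hd : 0 < d := lt_min (by positivity) one_pos
  set A : ℝ := γ ^ 2 / (4 * Real.pi ^ 2)
  have hA : 0 < A := by positivity
  refine ⟨max (A / d) ((A / d) ^ 2), fun q => z.2.re + γ * q.1 ^ (γ - 1) *
    (Complex.exp (-(q.2 * Complex.I)) * z.1).im, lt_max_of_lt_left (by positivity),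
    by fun_prop, fun p hp => ?_⟩
  have hre := (hcα p.1 hp.le).trans (le_bracket_re hγ z hp)
  have him := bracket_im z hp (γ := γ)
  set b := bracket γ z (polarPoint γ p).1
  set u := p.2.2 - (z.2.re + γ * p.1 ^ (γ - 1) * (Complex.exp (-(p.2.1 * Complex.I)) * z.1).im)
  set w := 1 + p.1 ^ γ
  have hw : 1 ≤ w := by have := Real.rpow_nonneg hp.le γ; simp only [w]; linarith
  -- Coercivity gives Re b ≥ c w, and Im b is u exactly. The first kernel bound then lowers w to 1;
  -- the second spends one factor of the square on w and the other on u.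
  have hb : d * (w ^ 2 + u ^ 2) ≤ ‖b‖ ^ 2 := by
    rw [← Complex.normSq_eq_norm_sq, Complex.normSq_apply, him]
    have h1 : d ≤ c ^ 2 := min_le_left _ _
    have h2 : d ≤ 1 := min_le_right _ _
    have h3 : (c * w) ^ 2 ≤ b.re ^ 2 := by gcongr
    nlinarith [sq_nonneg u, sq_nonneg w]
  have hk : ‖kernel γ z (polarPoint γ p).1‖ ≤ A / d * (w ^ 2 + u ^ 2)⁻¹ := by
    rw [kernel_eq, norm_div, Complex.norm_real, Real.norm_of_nonneg hA.le, norm_pow]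
    calc A / ‖b‖ ^ 2 ≤ A / (d * (w ^ 2 + u ^ 2)) :=
          div_le_div_of_nonneg_left hA.le (by positivity) hb
      _ = _ := by rw [← div_div, div_eq_mul_inv (A / d)]
  have hwu : (w ^ 2 + u ^ 2)⁻¹ ≤ (1 + u ^ 2)⁻¹ := by
    gcongr
    nlinarith
  constructor
  · refine hk.trans ?_
    gcongr
    exact le_max_left _ _
  · calc ‖kernel γ z (polarPoint γ p).1‖ ^ 2 ≤ (A / d * (w ^ 2 + u ^ 2)⁻¹) ^ 2 := by gcongr
      _ = (A / d) ^ 2 * ((w ^ 2 + u ^ 2)⁻¹ * (w ^ 2 + u ^ 2)⁻¹) := by ring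
      _ ≤ (A / d) ^ 2 * ((w ^ 2)⁻¹ * (1 + u ^ 2)⁻¹) := by
          gcongr
          nlinarith
      _ ≤ _ := by
          gcongr
          exact le_max_right _ _

/-- The s-integral equals π wherever the centre τ lies. The α-integral converges at 0 because q >
-1, and at infinity, where the integrand is at most α^(q-2γ), because q < 2γ - 1. -/
theorem lintegral_cauchy_density_lt_top {γ q : ℝ} (hq : -1 < q) (hq' : q < 2 * γ - 1)
    {τ : ℝ × ℝ → ℝ} (hτ : Measurable τ) :
    ∫⁻ p : ℝ × ℝ × ℝ, ENNReal.ofReal (p.1 ^ q) * ENNReal.ofReal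
      (((1 + p.1 ^ γ) ^ 2)⁻¹ * (1 + (p.2.2 - τ (p.1, p.2.1)) ^ 2)⁻¹) ∂coords < ∞ := by
  have hs : ∀ t : ℝ, ∫⁻ s : ℝ, ENNReal.ofReal ((1 + (s - t) ^ 2)⁻¹) =
      ENNReal.ofReal Real.pi := by
    intro t
    rw [lintegral_sub_right_eq_self (fun s : ℝ => ENNReal.ofReal ((1 + s ^ 2)⁻¹)) t,
      ← ofReal_integral_eq_lintegral_ofReal integrable_inv_one_add_sq
        (.of_forall fun s => by positivity), integral_univ_inv_one_add_sq]
  have hr : ∫⁻ α : ℝ, ENNReal.ofReal (α ^ q * ((1 + α ^ γ) ^ 2)⁻¹) ∂ray < ∞ := by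
    have hint : IntegrableOn (fun α : ℝ => α ^ q * ((1 + α ^ γ) ^ 2)⁻¹) (Set.Ioi 0) := by
      rw [← Set.Ioc_union_Ioi_eq_Ioi zero_le_one]
      refine IntegrableOn.union ?_ ?_
      · have h1 : IntegrableOn (fun α : ℝ => α ^ q) (Set.Ioc 0 1) :=
          (intervalIntegrable_iff_integrableOn_Ioc_of_le zero_le_one).1
            (intervalIntegral.intervalIntegrable_rpow' hq)
        refine h1.mono' (Measurable.aestronglyMeasurable (by fun_prop)) ?_
        filter_upwards [ae_restrict_mem measurableSet_Ioc] with α hα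
        have h0 : 0 < α := hα.1
        rw [Real.norm_of_nonneg (by positivity)]
        refine mul_le_of_le_one_right (by positivity) (inv_le_one_of_one_le₀ ?_)
        have := Real.rpow_nonneg h0.le γ
        nlinarith
      · have h1 : IntegrableOn (fun α : ℝ => α ^ (q - 2 * γ)) (Set.Ioi 1) :=
          integrableOn_Ioi_rpow_of_lt (by linarith) one_pos
        refine h1.mono' (Measurable.aestronglyMeasurable (by fun_prop)) ?_
        filter_upwards [ae_restrict_mem measurableSet_Ioi] with α hα
        have h0 : 0 < α := lt_trans one_pos hα
        rw [Real.norm_of_nonneg (by positivity), Real.rpow_sub h0, div_eq_mul_inv]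
        gcongr
        rw [mul_comm 2 γ, Real.rpow_mul h0.le, Real.rpow_two]
        have := Real.rpow_nonneg h0.le γ
        gcongr
        linarith
    exact hint.lintegral_lt_top
  rw [lintegral_coords (by fun_prop)]
  calc ∫⁻ α : ℝ, ∫⁻ θ : ℝ, ∫⁻ s : ℝ, ENNReal.ofReal (α ^ q) * ENNReal.ofReal
          (((1 + α ^ γ) ^ 2)⁻¹ * (1 + (s - τ (α, θ)) ^ 2)⁻¹) ∂volume ∂angle ∂ray
      = ∫⁻ α : ℝ, ENNReal.ofReal (α ^ q * ((1 + α ^ γ) ^ 2)⁻¹) *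
          (ENNReal.ofReal Real.pi * angle Set.univ) ∂ray := by
        refine setLIntegral_congr_fun measurableSet_Ioi fun α (hα : 0 < α) => ?_
        have h1 : ∀ θ : ℝ, ∫⁻ s, ENNReal.ofReal (α ^ q) * ENNReal.ofReal
            (((1 + α ^ γ) ^ 2)⁻¹ * (1 + (s - τ (α, θ)) ^ 2)⁻¹) =
            ENNReal.ofReal (α ^ q * ((1 + α ^ γ) ^ 2)⁻¹) * ENNReal.ofReal Real.pi := by
          intro θ
          rw [← hs (τ (α, θ)), ← lintegral_const_mul _ (by fun_prop)]
          refine lintegral_congr fun s => ?_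
          rw [ENNReal.ofReal_mul (p := ((1 + α ^ γ) ^ 2)⁻¹) (by positivity),
            ENNReal.ofReal_mul (by positivity), mul_assoc]
        simp only [h1, lintegral_const, mul_assoc]
    _ < ∞ := by
        rw [lintegral_mul_const _ (by fun_prop)]
        exact ENNReal.mul_lt_top hr (ENNReal.mul_lt_top ENNReal.ofReal_lt_top (measure_lt_top _ _))

theorem measurable_kernel (γ : ℝ) :
    Measurable fun q : (ℂ × ℂ) × (ℂ × ℂ) => kernel γ q.1 q.2 := by
  unfold kernel
  have : Measurable (starRingEnd ℂ) := Complex.continuous_conj.measurable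
  fun_prop

/-- The interval (-1, 2γ - 1) is invariant under q ↦ 2(γ - 1) - q. Applied at q = 2(γ - 1) - r, this
puts the kernel in the space dual to L²(μ_r) with respect to σ. -/
theorem lintegral_kernel_sq_lt_top {γ q : ℝ} (hγ : 1 < γ) (hq : -1 < q) (hq' : q < 2 * γ - 1)
    {z : ℂ × ℂ} (hz : z ∈ domain γ) :
    ∫⁻ ζ, ‖kernel γ z ζ.1‖ₑ ^ 2 ∂(mu γ q) < ∞ := by
  obtain ⟨K, τ, hK, hτ, h⟩ := exists_norm_kernel_le hγ hz
  have hm : Measurable fun ζ : hypersurface γ => ‖kernel γ z ζ.1‖ₑ ^ 2 :=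
    (((measurable_kernel γ).comp
      (measurable_const.prodMk measurable_subtype_coe)).enorm).pow_const 2
  rw [lintegral_mu hm.aemeasurable]
  calc _ ≤ ∫⁻ p : ℝ × ℝ × ℝ, ENNReal.ofReal K * (ENNReal.ofReal (p.1 ^ q) * ENNReal.ofReal
      (((1 + p.1 ^ γ) ^ 2)⁻¹ * (1 + (p.2.2 - τ (p.1, p.2.1)) ^ 2)⁻¹)) ∂coords := by
        refine lintegral_mono_ae ?_
        filter_upwards [ae_coords_pos] with p hp
        rw [mul_left_comm, ← ENNReal.ofReal_mul hK.le]
        gcongr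
        rw [← ofReal_norm, ← ENNReal.ofReal_pow (norm_nonneg _)]
        exact ENNReal.ofReal_le_ofReal (h p hp).2
    _ < ∞ := by
        rw [lintegral_const_mul' _ _ ENNReal.ofReal_ne_top]
        exact ENNReal.mul_lt_top ENNReal.ofReal_lt_top
          (lintegral_cauchy_density_lt_top hq hq' hτ)

/-- The first kernel bound decays in s only. The weight supplies the radial decay; when two kernels
are composed it comes from the other kernel, and this integral justifies Fubini. -/
theorem lintegral_weighted_kernel_lt_top {γ : ℝ} (hγ : 1 < γ) {z : ℂ × ℂ} (hz : z ∈ domain γ) :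
    ∫⁻ ζ, ENNReal.ofReal (((1 + ‖ζ.1.1‖ ^ γ) ^ 2)⁻¹) * ‖kernel γ z ζ.1‖ₑ ∂(mu γ (γ - 1)) < ∞ := by
  obtain ⟨K, τ, hK, hτ, h⟩ := exists_norm_kernel_le hγ hz
  have hm : Measurable fun ζ : hypersurface γ => ‖kernel γ z ζ.1‖ₑ :=
    ((measurable_kernel γ).comp (measurable_const.prodMk measurable_subtype_coe)).enorm
  have hm2 : Measurable fun ζ : hypersurface γ => ENNReal.ofReal (((1 + ‖ζ.1.1‖ ^ γ) ^ 2)⁻¹) := by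
    fun_prop
  have hm3 : Measurable fun ζ : hypersurface γ =>
      ENNReal.ofReal (((1 + ‖ζ.1.1‖ ^ γ) ^ 2)⁻¹) * ‖kernel γ z ζ.1‖ₑ := hm2.mul hm
  rw [lintegral_mu hm3.aemeasurable]
  calc _ ≤ ∫⁻ p : ℝ × ℝ × ℝ, ENNReal.ofReal K * (ENNReal.ofReal (p.1 ^ (γ - 1)) * ENNReal.ofReal
      (((1 + p.1 ^ γ) ^ 2)⁻¹ * (1 + (p.2.2 - τ (p.1, p.2.1)) ^ 2)⁻¹)) ∂coords := by
        refine lintegral_mono_ae ?_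
        filter_upwards [ae_coords_pos] with p hp
        rw [mul_left_comm (ENNReal.ofReal K), norm_polarPoint_fst γ hp.le,
          ENNReal.ofReal_mul (p := ((1 + p.1 ^ γ) ^ 2)⁻¹) (by positivity),
          mul_left_comm (ENNReal.ofReal K), ← ENNReal.ofReal_mul hK.le]
        gcongr
        rw [← ofReal_norm]
        exact ENNReal.ofReal_le_ofReal (h p hp).1
    _ < ∞ := by
        rw [lintegral_const_mul' _ _ ENNReal.ofReal_ne_top]
        exact ENNReal.mul_lt_top ENNReal.ofReal_lt_top
          (lintegral_cauchy_density_lt_top (by linarith) (by linarith) hτ)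

/-! ### Laplace representation of inverse powers -/

theorem integrable_pow_mul_exp_neg (n : ℕ) {c : ℝ} (hc : 0 < c) :
    Integrable (fun κ : ℝ => κ ^ n * Real.exp (-c * κ)) ray := by
  have h := integrableOn_rpow_mul_exp_neg_mul_rpow (p := 1) (s := n) (b := c)
    (by have : (0 : ℝ) ≤ n := Nat.cast_nonneg n
        linarith) one_pos hc
  simpa [IntegrableOn] using h

theorem integrable_pow_mul_cexp_neg (n : ℕ) {c : ℂ} (hc : 0 < c.re) :
    Integrable (fun κ : ℝ => (κ : ℂ) ^ n * Complex.exp (-c * κ)) ray := by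
  refine (integrable_pow_mul_exp_neg n hc).mono' (Continuous.aestronglyMeasurable (by fun_prop)) ?_
  filter_upwards [ae_restrict_mem measurableSet_Ioi] with κ hκ
  have hκ0 : (0 : ℝ) < κ := hκ
  rw [norm_mul, norm_pow, Complex.norm_real, Real.norm_of_nonneg hκ0.le, Complex.norm_exp]
  simp

theorem integral_pow_mul_cexp_neg (n : ℕ) {c : ℂ} (hc : 0 < c.re) :
    ∫ κ : ℝ, (κ : ℂ) ^ n * Complex.exp (-c * κ) ∂ray = n.factorial / c ^ (n + 1) := by
  have hc0 : c ≠ 0 := by rintro rfl; simp at hc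
  induction n with
  | zero =>
    have := integral_exp_mul_complex_Ioi (a := -c) (by simpa using hc) 0
    simpa [neg_div_neg_eq] using this
  | succ n ih =>
    -- Integrating the derivative of κ^(n+1) e^{-cκ} over the half line gives 0, which is the
    -- recursion from n to n + 1.
    have hd : ∀ κ ∈ Set.Ici (0 : ℝ), HasDerivAt (fun κ : ℝ => (κ : ℂ) ^ (n + 1) *
        Complex.exp (-c * κ)) ((n + 1) * ((κ : ℂ) ^ n * Complex.exp (-c * κ)) -
          c * ((κ : ℂ) ^ (n + 1) * Complex.exp (-c * κ))) κ := by
      intro κ _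
      have h1 : HasDerivAt (fun w : ℂ => w ^ (n + 1) * Complex.exp (-c * w))
          ((n + 1) * ((κ : ℂ) ^ n * Complex.exp (-c * κ)) -
          c * ((κ : ℂ) ^ (n + 1) * Complex.exp (-c * κ))) (κ : ℂ) := by
        have h2 := (hasDerivAt_pow (n + 1) (κ : ℂ)).mul
          (((hasDerivAt_id (κ : ℂ)).const_mul (-c)).cexp)
        refine HasDerivAt.congr_deriv h2 ?_
        simp only [id, Nat.add_sub_cancel]
        push_cast
        ring
      exact h1.comp_ofReal
    have hi := ((integrable_pow_mul_cexp_neg n hc).const_mul ((n : ℂ) + 1)).sub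
      ((integrable_pow_mul_cexp_neg (n + 1) hc).const_mul c)
    have hlim : Tendsto (fun κ : ℝ => (κ : ℂ) ^ (n + 1) * Complex.exp (-c * κ)) atTop (𝓝 0) := by
      rw [tendsto_zero_iff_norm_tendsto_zero]
      have h1 := tendsto_rpow_mul_exp_neg_mul_atTop_nhds_zero ((n + 1 : ℕ) : ℝ) c.re hc
      refine h1.congr' ?_
      filter_upwards [eventually_gt_atTop 0] with κ hκ
      rw [norm_mul, norm_pow, Complex.norm_real, Real.norm_of_nonneg hκ.le, Complex.norm_exp,
        Real.rpow_natCast]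
      simp
    have h := integral_Ioi_of_hasDerivAt_of_tendsto' hd hi hlim
    rw [integral_sub ((integrable_pow_mul_cexp_neg n hc).const_mul _)
      ((integrable_pow_mul_cexp_neg (n + 1) hc).const_mul _), integral_const_mul,
      integral_const_mul, ih] at h
    simp only [Complex.ofReal_zero, ne_eq, Nat.add_eq_zero_iff, one_ne_zero, and_false,
      not_false_eq_true, zero_pow, zero_mul, sub_zero] at h
    rw [sub_eq_zero, eq_comm] at h
    have h' : c * ∫ κ : ℝ, (κ : ℂ) ^ (n + 1) * Complex.exp (-c * κ) ∂ray =
        c * (((n + 1).factorial : ℂ) / c ^ (n + 1 + 1)) := by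
      rw [h, Nat.factorial_succ]
      push_cast
      field_simp
      ring
    exact mul_left_cancel₀ hc0 h'

/-- Laplace representation of the inverse square. -/
theorem integral_laplace {b : ℂ} (hb : 0 < b.re) :
    ∫ κ : ℝ, (κ : ℂ) * Complex.exp (-(2 * Real.pi * b) * κ) ∂ray =
      1 / (4 * Real.pi ^ 2 * b ^ 2) := by
  have h := integral_pow_mul_cexp_neg 1 (c := 2 * Real.pi * b)
    (by have := Complex.re_ofReal_mul (2 * Real.pi) b
        push_cast at this
        rw [this]; positivity)
  simp only [pow_one] at h
  rw [h]
  norm_num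
  rw [mul_pow, mul_pow]
  norm_num

theorem lintegral_laplace {b : ℝ} (hb : 0 < b) :
    ∫⁻ κ : ℝ, ENNReal.ofReal (κ * Real.exp (-(2 * Real.pi * b) * κ)) ∂ray =
      ENNReal.ofReal (1 / (4 * Real.pi ^ 2 * b ^ 2)) := by
  have hi := integrable_pow_mul_exp_neg 1 (c := 2 * Real.pi * b) (by positivity)
  simp only [pow_one] at hi
  rw [← ofReal_integral_eq_lintegral_ofReal hi]
  · congr 1
    have h := integral_laplace (b := b) (by simpa using hb)
    have e : ∀ κ : ℝ, (κ : ℂ) * Complex.exp (-(2 * Real.pi * b) * κ) =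
        ((κ * Real.exp (-(2 * Real.pi * b) * κ) : ℝ) : ℂ) := by
      intro κ; push_cast; rfl
    simp only [e] at h
    rw [integral_complex_ofReal] at h
    apply Complex.ofReal_injective
    rw [h]
    push_cast
    rfl
  · filter_upwards [ae_restrict_mem measurableSet_Ioi] with κ hκ
    have hκ0 : (0 : ℝ) < κ := hκ
    simp only [Pi.zero_apply]
    positivity

/-! ### Fourier representation of the vertical translates -/

/-- Bounded measurable functions on `M_γ` that vanish outside a bounded set. -/
structure BoundedSupport (γ N : ℝ) (f : hypersurface γ → ℂ) : Prop where
  measurable : Measurable f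
  norm_le : ∀ ζ, ‖f ζ‖ ≤ N
  eq_zero_of_norm : ∀ ζ, N < ‖ζ.1.1‖ → f ζ = 0
  eq_zero_of_re : ∀ ζ, N < |ζ.1.2.re| → f ζ = 0

/-- Vertical translation by `ε`, from `M_γ` into `Ω_γ`. -/
def lift (γ ε : ℝ) (ζ : hypersurface γ) : ℂ × ℂ := (ζ.1.1, ζ.1.2 + (ε : ℂ) * Complex.I)

/-- The function `ζ ↦ L f (ζ₁, ζ₂ + iε)` on `M_γ`. -/
def translate (γ : ℝ) (f : hypersurface γ → ℂ) (ε : ℝ) (ζ : hypersurface γ) : ℂ :=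
  lerayIntegral γ f (lift γ ε ζ)

theorem lift_mem_domain {γ ε : ℝ} (hε : 0 < ε) (ζ : hypersurface γ) : lift γ ε ζ ∈ domain γ := by
  have h : ζ.1.2.im = ‖ζ.1.1‖ ^ γ := ζ.2
  simp only [domain, lift, Set.mem_ofPred_eq, Complex.add_im, Complex.im_ofReal_mul, Complex.I_im,
    mul_one]
  linarith

theorem measurable_lift (γ ε : ℝ) : Measurable (lift γ ε) := by
  unfold lift
  fun_prop

theorem measurable_kernel_comp (γ : ℝ) {X : Type*} [MeasurableSpace X] {u v : X → ℂ × ℂ}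
    (hu : Measurable u) (hv : Measurable v) : Measurable fun x => kernel γ (u x) (v x) :=
  (measurable_kernel γ).comp (f := fun x => (u x, v x)) (hu.prodMk hv)

theorem measurable_translate {γ : ℝ} {f : hypersurface γ → ℂ} (hf : Measurable f) (ε : ℝ) :
    Measurable (translate γ f ε) := by
  have h : StronglyMeasurable fun q : hypersurface γ × hypersurface γ =>
      f q.2 * kernel γ (lift γ ε q.1) q.2.1 := by
    refine Measurable.stronglyMeasurable ?_
    exact (hf.comp measurable_snd).mul (measurable_kernel_comp γ
      ((measurable_lift γ ε).comp measurable_fst) (measurable_subtype_coe.comp measurable_snd))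
  exact h.integral_prod_right'.measurable

theorem lerayIntegral_congr {γ r : ℝ} {f g : hypersurface γ → ℂ} (h : f =ᵐ[mu γ r] g) :
    lerayIntegral γ f = lerayIntegral γ g := by
  ext z
  refine integral_congr_ae ?_
  filter_upwards [(mu_absolutelyContinuous γ (γ - 1) r).ae_eq h] with ζ hζ
  rw [hζ]

theorem integral_coords {G : ℝ × ℝ × ℝ → ℂ} (hG : Integrable G coords) :
    ∫ p, G p ∂coords = ∫ q : ℝ × ℝ, ∫ s : ℝ, G (q.1, q.2, s) ∂volume ∂(ray.prod angle) := by
  have hmp := measurePreserving_prodAssoc ray angle (volume : Measure ℝ)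
  have h1 := hmp.integral_comp' (g := G)
  have h2 : Integrable (fun q : (ℝ × ℝ) × ℝ => G (MeasurableEquiv.prodAssoc q))
      ((ray.prod angle).prod volume) :=
    (hmp.integrable_comp_emb MeasurableEquiv.prodAssoc.measurableEmbedding).2 hG
  rw [← h1, integral_prod _ h2]
  rfl

namespace BoundedSupport

variable {γ N : ℝ} {f : hypersurface γ → ℂ}

theorem nonneg (hf : BoundedSupport γ N f) : 0 ≤ N :=
  (norm_nonneg _).trans (hf.norm_le (polarPoint γ (0, 0, 0)))

theorem eq_zero_of_lt (hf : BoundedSupport γ N f) {p : ℝ × ℝ × ℝ} (hp : N < p.1) :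
    f (polarPoint γ p) = 0 := by
  apply hf.eq_zero_of_norm
  rwa [norm_polarPoint_fst γ (hf.nonneg.trans hp.le)]

theorem eq_zero_of_abs (hf : BoundedSupport γ N f) {p : ℝ × ℝ × ℝ} (hp : N < |p.2.2|) :
    f (polarPoint γ p) = 0 := hf.eq_zero_of_re _ hp

theorem measurable_comp (hf : BoundedSupport γ N f) :
    Measurable fun p => f (polarPoint γ p) := hf.measurable.comp (measurable_polarPoint γ)

theorem integrable_coords (hf : BoundedSupport γ N f) (hγ : 1 < γ) :
    Integrable (fun p => ((p.1 ^ (γ - 1) : ℝ) : ℂ) * f (polarPoint γ p)) coords := by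
  set S : Set (ℝ × ℝ × ℝ) := Set.Iic N ×ˢ (Set.univ ×ˢ Set.Icc (-N) N)
  have hS : MeasurableSet S :=
    measurableSet_Iic.prod (MeasurableSet.univ.prod measurableSet_Icc)
  have hfin : coords S < ∞ := by
    rw [Measure.prod_prod, Measure.prod_prod, Measure.restrict_apply measurableSet_Iic,
      Set.Iic_inter_Ioi]
    exact ENNReal.mul_lt_top measure_Ioc_lt_top
      (ENNReal.mul_lt_top (measure_lt_top _ _) measure_Icc_lt_top)
  have h : Integrable (S.indicator fun _ => N ^ (γ - 1) * N) coords :=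
    (integrableOn_const (hs := hfin.ne)).integrable_indicator hS
  refine h.mono' (Measurable.aestronglyMeasurable
    (Measurable.mul (by fun_prop) hf.measurable_comp)) ?_
  filter_upwards [ae_coords_pos] with p hp
  by_cases h1 : N < p.1
  · rw [hf.eq_zero_of_lt h1, mul_zero, norm_zero]
    exact Set.indicator_nonneg (fun _ _ => mul_nonneg (Real.rpow_nonneg hf.nonneg _) hf.nonneg) _
  by_cases h2 : N < |p.2.2|
  · rw [hf.eq_zero_of_abs h2, mul_zero, norm_zero]
    exact Set.indicator_nonneg (fun _ _ => mul_nonneg (Real.rpow_nonneg hf.nonneg _) hf.nonneg) _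
  rw [Set.indicator_of_mem (by exact ⟨not_lt.1 h1, Set.mem_univ _, abs_le.1 (not_lt.1 h2)⟩),
    norm_mul, Complex.norm_real, Real.norm_of_nonneg (by positivity)]
  have h3 : p.1 ^ (γ - 1) ≤ N ^ (γ - 1) := Real.rpow_le_rpow hp.le (not_lt.1 h1) (by linarith)
  have := hf.norm_le (polarPoint γ p)
  gcongr
  exact Real.rpow_nonneg hf.nonneg _

theorem integrable_mu (hf : BoundedSupport γ N f) (hγ : 1 < γ) :
    Integrable f (mu γ (γ - 1)) := by
  refine ⟨hf.measurable.aestronglyMeasurable, ?_⟩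
  have h := (hf.integrable_coords hγ).2
  rw [hasFiniteIntegral_iff_enorm] at h ⊢
  rw [lintegral_mu hf.measurable.enorm.aemeasurable]
  refine lt_of_eq_of_lt (lintegral_congr_ae ?_) h
  filter_upwards [ae_coords_pos] with p hp
  rw [enorm_mul, ← ofReal_norm ((p.1 ^ (γ - 1) : ℝ) : ℂ), Complex.norm_real,
    Real.norm_of_nonneg (by positivity)]

theorem integrable_line (hf : BoundedSupport γ N f) (α θ : ℝ) :
    Integrable fun s : ℝ => f (polarPoint γ (α, θ, s)) := by
  have h : Integrable ((Set.Icc (-N) N).indicator fun _ : ℝ => N) :=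
    (integrableOn_const (hs := measure_Icc_lt_top.ne)).integrable_indicator measurableSet_Icc
  refine h.mono' (Measurable.aestronglyMeasurable (hf.measurable_comp.comp
    (f := fun s : ℝ => (α, θ, s)) (by fun_prop))) (.of_forall fun s => ?_)
  by_cases h2 : N < |s|
  · rw [hf.eq_zero_of_abs h2, norm_zero]
    exact Set.indicator_nonneg (fun _ _ => hf.nonneg) _
  · rw [Set.indicator_of_mem (by exact abs_le.1 (not_lt.1 h2))]
    exact hf.norm_le _

end BoundedSupport

/-- The Fourier transform of `f` in the variable `s = Re ζ₂`, in polar coordinates. -/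
def partialFourier (γ : ℝ) (f : hypersurface γ → ℂ) (κ : ℝ) (q : ℝ × ℝ) : ℂ :=
  ∫ s : ℝ, Complex.exp (-(2 * Real.pi * κ * s * Complex.I)) * f (polarPoint γ (q.1, q.2, s))

theorem measurable_partialFourier {γ : ℝ} {f : hypersurface γ → ℂ} (hf : Measurable f) :
    Measurable fun x : ℝ × (ℝ × ℝ) => partialFourier γ f x.1 x.2 := by
  have hf' := hf.comp (measurable_polarPoint γ)
  have h : StronglyMeasurable fun y : (ℝ × (ℝ × ℝ)) × ℝ =>
      Complex.exp (-(2 * Real.pi * y.1.1 * y.2 * Complex.I)) *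
        f (polarPoint γ (y.1.2.1, y.1.2.2, y.2)) := by
    refine Measurable.stronglyMeasurable (Measurable.mul (by fun_prop) ?_)
    exact hf'.comp (g := fun p => f (polarPoint γ p)) (by fun_prop)
  exact h.integral_prod_right'.measurable

theorem measurable_slice_partialFourier {γ : ℝ} {f : hypersurface γ → ℂ} (hf : Measurable f) :
    Measurable fun x : (ℝ × ℝ) × ℝ =>
      slice γ (2 * Real.pi * x.2) (partialFourier γ f x.2) x.1.1 x.1.2 := by
  have hm := measurable_partialFourier hf
  have h : StronglyMeasurable fun y : ((ℝ × ℝ) × ℝ) × (ℝ × ℝ) =>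
      partialFourier γ f y.1.2 y.2 * ((y.2.1 ^ (γ - 1) : ℝ) : ℂ) *
      Complex.exp (-((2 * Real.pi * y.1.2 : ℝ) : ℂ) * (((γ - 1) * y.2.1 ^ γ + y.1.1.1 ^ γ : ℝ) -
      ((γ * y.2.1 ^ (γ - 1) * y.1.1.1 : ℝ) : ℂ) *
        Complex.exp ((y.1.1.2 - y.2.2) * Complex.I))) := by
    refine Measurable.stronglyMeasurable (Measurable.mul (Measurable.mul ?_ (by fun_prop))
      (by fun_prop))
    exact hm.comp (g := fun x : ℝ × (ℝ × ℝ) => partialFourier γ f x.1 x.2)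
      (f := fun y : ((ℝ × ℝ) × ℝ) × (ℝ × ℝ) => (y.1.2, y.2)) (by fun_prop)
  exact h.integral_prod_right'.measurable

namespace BoundedSupport

variable {γ N : ℝ} {f : hypersurface γ → ℂ}

theorem norm_partialFourier_le (hf : BoundedSupport γ N f) (κ : ℝ) (q : ℝ × ℝ) :
    ‖partialFourier γ f κ q‖ ≤ N * (2 * N) := by
  have h : ∀ s : ℝ, s ∉ Set.Icc (-N) N → Complex.exp (-(2 * Real.pi * κ * s * Complex.I)) *
      f (polarPoint γ (q.1, q.2, s)) = 0 := by
    intro s hs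
    rw [hf.eq_zero_of_abs (p := (q.1, q.2, s)), mul_zero]
    by_contra h
    exact hs (abs_le.1 (not_lt.1 h))
  rw [partialFourier, ← setIntegral_eq_integral_of_forall_compl_eq_zero h]
  refine (norm_setIntegral_le_of_norm_le_const (C := N) measure_Icc_lt_top
    fun s _ => ?_).trans (le_of_eq ?_)
  · have := Complex.norm_exp_ofReal_mul_I (-(2 * Real.pi * κ * s))
    push_cast at this
    rw [norm_mul, ← neg_mul, this, one_mul]
    exact hf.norm_le _
  · rw [Real.volume_real_Icc_of_le (by linarith [hf.nonneg])]
    ring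

theorem partialFourier_eq_zero (hf : BoundedSupport γ N f) (κ : ℝ) (q : ℝ × ℝ) (hq : N < q.1) :
    partialFourier γ f κ q = 0 := by
  have h : ∀ s : ℝ, f (polarPoint γ (q.1, q.2, s)) = 0 := fun s => hf.eq_zero_of_lt hq
  simp [partialFourier, h]

/-- Fubini puts the κ-integral innermost, where Plancherel in s applies for each (α, θ). Only an
inequality remains, since negative frequencies are dropped. -/
theorem lintegral_partialFourier_le (hf : BoundedSupport γ N f) (r : ℝ) :
    ∫⁻ κ : ℝ, ∫⁻ α : ℝ, ENNReal.ofReal (α ^ r) *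
      ∫⁻ θ : ℝ, ‖partialFourier γ f κ (α, θ)‖ₑ ^ 2 ∂angle ∂ray ∂ray ≤
    ∫⁻ ζ, ‖f ζ‖ₑ ^ 2 ∂(mu γ r) := by
  have hm := measurable_partialFourier hf.measurable
  have hm1 : Measurable fun x : (ℝ × ℝ) × ℝ => ‖partialFourier γ f x.1.1 (x.1.2, x.2)‖ₑ ^ 2 :=
    (hm.comp (g := fun x : ℝ × (ℝ × ℝ) => partialFourier γ f x.1 x.2)
      (f := fun x : (ℝ × ℝ) × ℝ => (x.1.1, (x.1.2, x.2))) (by fun_prop)).enorm.pow_const 2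
  have hm2 : Measurable fun x : ℝ × ℝ =>
      ∫⁻ θ : ℝ, ‖partialFourier γ f x.1 (x.2, θ)‖ₑ ^ 2 ∂angle := hm1.lintegral_prod_right'
  have hm3 : ∀ α, Measurable fun x : ℝ × ℝ => ‖partialFourier γ f x.1 (α, x.2)‖ₑ ^ 2 := fun α =>
    hm1.comp (g := fun x : (ℝ × ℝ) × ℝ => ‖partialFourier γ f x.1.1 (x.1.2, x.2)‖ₑ ^ 2)
      (f := fun x : ℝ × ℝ => ((x.1, α), x.2)) (by fun_prop)
  have hfc := hf.measurable_comp
  have hm4 : Measurable fun p : ℝ × ℝ × ℝ =>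
      ENNReal.ofReal (p.1 ^ r) * ‖f (polarPoint γ p)‖ₑ ^ 2 :=
    Measurable.mul (by fun_prop) (hfc.enorm.pow_const 2)
  rw [lintegral_lintegral_swap, lintegral_mu (hf.measurable.enorm.pow_const 2).aemeasurable,
    lintegral_coords hm4]
  · refine lintegral_mono fun α => ?_
    rw [lintegral_const_mul' _ _ ENNReal.ofReal_ne_top, lintegral_lintegral_swap,
      ← lintegral_const_mul' _ _ ENNReal.ofReal_ne_top]
    · refine lintegral_mono fun θ => ?_
      simp only
      rw [lintegral_const_mul' _ _ ENNReal.ofReal_ne_top]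
      refine mul_le_mul_right ?_ _
      exact (setLIntegral_le_lintegral _ _).trans
        (lintegral_enorm_integral_exp_neg_sq_le (hf.integrable_line α θ))
    · exact (hm3 α).aemeasurable
  · refine Measurable.aemeasurable (Measurable.mul (by fun_prop) ?_)
    exact hm2

/-- By `young_rpow` the exponential in the slice has modulus at most 1, so one constant serves all
frequencies κ > 0. -/
theorem norm_slice_le (hf : BoundedSupport γ N f) (hγ : 1 < γ) {a : ℝ} (ha : 0 < a) (φ : ℝ) :
    ∃ K : ℝ, ∀ κ : ℝ, 0 < κ → ‖slice γ (2 * Real.pi * κ) (partialFourier γ f κ) a φ‖ ≤ K := by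
  set B : ℝ × ℝ → ℝ := fun q => ‖(Set.Iic N ×ˢ (Set.univ : Set ℝ)).indicator
    (fun _ => ((N * (2 * N) * N ^ (γ - 1) : ℝ) : ℂ)) q‖
  have hN := hf.nonneg
  have hB : Integrable B (ray.prod angle) := by
    refine Integrable.norm (integrable_of_bound_of_support (M := N * (2 * N) * N ^ (γ - 1))
      (N := N) ?_ ?_ ?_)
    · exact (measurable_const.indicator
          (measurableSet_Iic.prod MeasurableSet.univ)).aestronglyMeasurable
    · intro p _ hp
      rw [Set.indicator_of_mem (by exact ⟨hp, Set.mem_univ _⟩), Complex.norm_real,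
        Real.norm_of_nonneg (by positivity)]
    · intro p hp
      rw [Set.indicator_of_notMem (by simpa using hp)]
  refine ⟨∫ q, B q ∂(ray.prod angle), fun κ hκ => ?_⟩
  refine norm_integral_le_of_norm_le hB ?_
  have hpos : ∀ᵐ p : ℝ × ℝ ∂(ray.prod angle), 0 < p.1 :=
    Measure.quasiMeasurePreserving_fst.ae (ae_restrict_mem measurableSet_Ioi)
  filter_upwards [hpos] with p hp
  by_cases h : N < p.1
  · rw [hf.partialFourier_eq_zero κ p h, zero_mul, zero_mul, norm_zero]
    exact norm_nonneg _
  simp only [B]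
  have h' := not_lt.1 h
  rw [Set.indicator_of_mem (by exact ⟨h', Set.mem_univ _⟩), Complex.norm_real (_ * _),
        Real.norm_of_nonneg (by positivity), norm_mul, norm_mul, Complex.norm_real,
        Real.norm_of_nonneg (by positivity)]
  have h1 := hf.norm_partialFourier_le κ p
  have h2 : p.1 ^ (γ - 1) ≤ N ^ (γ - 1) := Real.rpow_le_rpow hp.le h' (by linarith)
  have h3 : ‖Complex.exp (-((2 * Real.pi * κ : ℝ) : ℂ) * (((γ - 1) * p.1 ^ γ + a ^ γ : ℝ) -
      ((γ * p.1 ^ (γ - 1) * a : ℝ) : ℂ) * Complex.exp ((φ - p.2) * Complex.I)))‖ ≤ 1 := by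
    rw [Complex.norm_exp, Real.exp_le_one_iff, ← Complex.ofReal_neg, Complex.re_ofReal_mul,
      Complex.sub_re, Complex.ofReal_re, Complex.re_ofReal_mul]
    have h4 := young_rpow hγ hp.le ha.le
    have h5 : (Complex.exp ((φ - p.2) * Complex.I)).re ≤ 1 :=
      (Complex.re_le_norm _).trans (norm_exp_sub_mul_I φ p.2).le
    have h6 : 0 ≤ γ * p.1 ^ (γ - 1) * a := by positivity
    have h7 := mul_le_mul_of_nonneg_left h5 h6
    have h8 : 0 < 2 * Real.pi * κ := by positivity
    nlinarith
  calc _ ≤ N * (2 * N) * N ^ (γ - 1) * 1 := by gcongr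
    _ = _ := mul_one _

/-- The Laplace formula linearises the kernel into exponentials of the bracket. The part of the
exponent linear in s produces the partial Fourier transform of f, the part in t an inverse Fourier
transform, and ε only the damping factor exp(-2πεκ); what is left is `slice` at l = 2πκ. -/
theorem translate_eq (hf : BoundedSupport γ N f) (hγ : 1 < γ) {ε : ℝ} (hε : 0 < ε)
    {a : ℝ} (ha : 0 < a) (φ t : ℝ) :
    translate γ f ε (polarPoint γ (a, φ, t)) = (γ ^ 2 : ℝ) * ∫ κ : ℝ,
      Complex.exp (2 * Real.pi * κ * t * Complex.I) * (κ * ((Real.exp (-(2 * Real.pi * ε) * κ) : ℝ) *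
        slice γ (2 * Real.pi * κ) (partialFourier γ f κ) a φ)) ∂ray := by
  set z := lift γ ε (polarPoint γ (a, φ, t)) with hz
  have hzd : z ∈ domain γ := lift_mem_domain hε _
  set b : ℝ × ℝ × ℝ → ℂ := fun p => bracket γ z (polarPoint γ p).1 with hb
  have hbm : Measurable b := by
    have h1 : Measurable fun ζ : ℂ × ℂ => bracket γ z ζ := by
      unfold bracket
      have : Measurable (starRingEnd ℂ) := Complex.continuous_conj.measurable
      fun_prop
    exact h1.comp (measurable_subtype_coe.comp (measurable_polarPoint γ))
  have hz1 : z.1 = a * Complex.exp (φ * Complex.I) := rfl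
  have hz1n : ‖z.1‖ = a := by
    rw [hz1, norm_mul, Complex.norm_exp_ofReal_mul_I, mul_one, Complex.norm_real,
      Real.norm_of_nonneg ha.le]
  have hz2r : z.2.re = t := by simp [hz, lift, polarPoint]
  have hz2i : z.2.im = a ^ γ + ε := by
    rw [← hz1n]; simp [hz, lift, polarPoint]
  -- The upward shift keeps the real part at least ε, which supplies the decay in κ that Fubini
  -- needs.
  have hbre : ∀ p, 0 < p.1 → ε ≤ (b p).re := by
    intro p hp
    refine le_trans ?_ (le_bracket_re hγ z hp)
    have := young_rpow hγ hp.le ha.le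
    rw [hz2i, hz1n]
    linarith
  have hker : ∀ p, 0 < p.1 → kernel γ z (polarPoint γ p).1 = (γ ^ 2 : ℝ) *
      ∫ κ : ℝ, (κ : ℂ) * Complex.exp (-(2 * Real.pi * b p) * κ) ∂ray := by
    intro p hp
    rw [integral_laplace (bracket_re_pos hγ hzd hp), kernel_eq]
    push_cast
    rw [mul_one_div, ← div_div, ← div_div, ← div_div]
  set Φ : (ℝ × ℝ × ℝ) × ℝ → ℂ := fun x => (((x.1.1 ^ (γ - 1) : ℝ) : ℂ) * f (polarPoint γ x.1)) *
    (x.2 * Complex.exp (-(2 * Real.pi * b x.1) * x.2)) with hΦ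
  have hfm := hf.measurable_comp
  have hΦi : Integrable Φ (coords.prod ray) := by
    have h1 := (hf.integrable_coords hγ).norm.mul_prod
      (integrable_pow_mul_exp_neg 1 (c := 2 * Real.pi * ε) (by positivity))
    have hΦm : Measurable Φ := by
      refine Measurable.mul (Measurable.mul (by fun_prop) (hfm.comp measurable_fst)) ?_
      have : Measurable fun x : (ℝ × ℝ × ℝ) × ℝ => b x.1 := hbm.comp measurable_fst
      fun_prop
    refine h1.mono' hΦm.aestronglyMeasurable ?_
    have hp1 : ∀ᵐ x : (ℝ × ℝ × ℝ) × ℝ ∂(coords.prod ray), 0 < x.1.1 :=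
      Measure.quasiMeasurePreserving_fst.ae ae_coords_pos
    have hp2 : ∀ᵐ x : (ℝ × ℝ × ℝ) × ℝ ∂(coords.prod ray), 0 < x.2 :=
      Measure.quasiMeasurePreserving_snd.ae (ae_restrict_mem measurableSet_Ioi)
    filter_upwards [hp1, hp2] with x hx1 hx2
    simp only [hΦ]
    rw [norm_mul, norm_mul (x.2 : ℂ), Complex.norm_real x.2, Real.norm_of_nonneg hx2.le, pow_one,
      Complex.norm_exp]
    gcongr
    have e : (-(2 * Real.pi * b x.1) * (x.2 : ℂ)).re = -(2 * Real.pi * (b x.1).re) * x.2 := by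
      have h2 : -(2 * Real.pi * b x.1) * (x.2 : ℂ) = ((-(2 * Real.pi * x.2) : ℝ) : ℂ) * b x.1 := by
        push_cast; ring
      rw [h2, Complex.re_ofReal_mul]; ring
    rw [e]
    have := hbre x.1 hx1
    have h3 : 2 * Real.pi * ε ≤ 2 * Real.pi * (b x.1).re := by gcongr
    nlinarith
  have hswap := integral_integral_swap (f := fun p κ => Φ (p, κ)) hΦi
  have hkm : AEStronglyMeasurable (fun ζ : hypersurface γ => f ζ * kernel γ z ζ.1)
      (mu γ (γ - 1)) :=
    (hf.measurable.mul (measurable_kernel_comp γ measurable_const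
      measurable_subtype_coe)).aestronglyMeasurable
  have hΦκ : ∀ᵐ κ ∂ray, Integrable (fun p => Φ (p, κ)) coords := hΦi.prod_left_ae
  calc translate γ f ε (polarPoint γ (a, φ, t))
      = ∫ p, ((p.1 ^ (γ - 1) : ℝ) : ℂ) * (f (polarPoint γ p) * kernel γ z (polarPoint γ p).1)
          ∂coords := by
        rw [translate, ← hz, lerayIntegral, integral_mu hkm]
    _ = (γ ^ 2 : ℝ) * ∫ p, ∫ κ, Φ (p, κ) ∂ray ∂coords := by
        rw [← integral_const_mul]
        refine integral_congr_ae ?_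
        filter_upwards [ae_coords_pos] with p hp
        simp only [hΦ]
        rw [hker p hp, integral_const_mul]
        ring
    _ = (γ ^ 2 : ℝ) * ∫ κ, ∫ p, Φ (p, κ) ∂coords ∂ray := by rw [hswap]
    _ = _ := by
        congr 1
        refine integral_congr_ae ?_
        filter_upwards [hΦκ] with κ hκ
        rw [integral_coords hκ, slice, ← integral_const_mul, ← integral_const_mul,
          ← integral_const_mul]
        refine integral_congr_ae ?_
        have hpos : ∀ᵐ p : ℝ × ℝ ∂(ray.prod angle), 0 < p.1 :=
          Measure.quasiMeasurePreserving_fst.ae (ae_restrict_mem measurableSet_Ioi)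
        filter_upwards [hpos] with q hq
        rw [partialFourier]
        simp only [hΦ]
        rw [← integral_mul_const, ← integral_mul_const, ← integral_const_mul,
          ← integral_const_mul, ← integral_const_mul]
        refine integral_congr_ae (.of_forall fun s => ?_)
        simp only [hb]
        rw [bracket_polarPoint z (p := (q.1, q.2, s)) hq, hz2i, hz2r, hz1]
        have e1 : Complex.exp (-(q.2 * Complex.I)) * (a * Complex.exp (φ * Complex.I)) =
            a * Complex.exp ((φ - q.2) * Complex.I) := by
          rw [mul_left_comm, ← Complex.exp_add]; congr 2; ring
        simp only [e1]
        have e2 : Complex.exp (-(2 * Real.pi * ((((γ - 1) * q.1 ^ γ + (a ^ γ + ε) : ℝ) : ℂ) -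
            ((γ * q.1 ^ (γ - 1) : ℝ) : ℂ) * (a * Complex.exp ((φ - q.2) * Complex.I)) +
            ((s - t : ℝ) : ℂ) * Complex.I)) * κ) =
            Complex.exp (2 * Real.pi * κ * t * Complex.I) *
            ((Real.exp (-(2 * Real.pi * ε) * κ) : ℝ) *
            (Complex.exp (-(2 * Real.pi * κ * s * Complex.I)) *
            Complex.exp (-((2 * Real.pi * κ : ℝ) : ℂ) * (((γ - 1) * q.1 ^ γ + a ^ γ : ℝ) -
              ((γ * q.1 ^ (γ - 1) * a : ℝ) : ℂ) * Complex.exp ((φ - q.2) * Complex.I))))) := by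
          rw [Complex.ofReal_exp, ← Complex.exp_add, ← Complex.exp_add, ← Complex.exp_add]
          congr 1
          push_cast
          ring
        rw [e2]
        ring

end BoundedSupport

/-! ### Uniform L² bounds for the translates -/

theorem lintegral_ray_exp_sq_le {G : ℝ → ℂ} (hG : Integrable G ray) :
    ∫⁻ t : ℝ, ‖∫ x : ℝ, Complex.exp (2 * Real.pi * x * t * Complex.I) * G x ∂ray‖ₑ ^ 2
      ≤ ∫⁻ x, ‖G x‖ₑ ^ 2 ∂ray := by
  have h1 : Integrable ((Set.Ioi (0 : ℝ)).indicator G) :=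
    (integrable_indicator_iff measurableSet_Ioi).2 hG
  refine le_trans (le_of_eq ?_) ((lintegral_enorm_integral_exp_sq_le h1).trans (le_of_eq ?_))
  · refine lintegral_congr fun t => ?_
    rw [← integral_indicator measurableSet_Ioi]
    refine congrArg (fun z : ℂ => ‖z‖ₑ ^ 2) (integral_congr_ae (.of_forall fun x => ?_))
    by_cases h : x ∈ Set.Ioi (0 : ℝ)
    · simp only [Set.indicator_of_mem h]
    · simp only [Set.indicator_of_notMem h, mul_zero]
  · rw [← lintegral_indicator measurableSet_Ioi]
    refine lintegral_congr fun x => ?_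
    by_cases h : x ∈ Set.Ioi (0 : ℝ)
    · simp only [Set.indicator_of_mem h]
    · simp [Set.indicator_of_notMem h]

theorem integrable_exp_mul_ray {G : ℝ → ℂ} (hG : Integrable G ray) (t : ℝ) :
    Integrable (fun x : ℝ => Complex.exp (2 * Real.pi * x * t * Complex.I) * G x) ray := by
  refine hG.bdd_mul (c := 1) (Continuous.aestronglyMeasurable (by fun_prop))
    (.of_forall fun x => ?_)
  have := Complex.norm_exp_ofReal_mul_I (2 * Real.pi * x * t)
  push_cast at this
  exact this.le

theorem BoundedSupport.integrable_mul_slice {γ N : ℝ} {f : hypersurface γ → ℂ}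
    (hf : BoundedSupport γ N f) (hγ : 1 < γ) {a : ℝ} (ha : 0 < a) (φ : ℝ) {m : ℝ → ℂ}
    (hmi : Integrable (fun κ : ℝ => (κ : ℂ) * m κ) ray) :
    Integrable (fun κ : ℝ => (κ : ℂ) * (m κ *
      slice γ (2 * Real.pi * κ) (partialFourier γ f κ) a φ)) ray := by
  obtain ⟨K, hK⟩ := hf.norm_slice_le hγ ha φ
  have hb : Integrable (fun κ : ℝ => ((κ : ℂ) * m κ) *
      slice γ (2 * Real.pi * κ) (partialFourier γ f κ) a φ) ray := by
    refine hmi.mul_bdd (c := K) ?_ ?_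
    · exact ((measurable_slice_partialFourier hf.measurable).comp
        (f := fun κ : ℝ => ((a, φ), κ)) (by fun_prop)).aestronglyMeasurable
    · filter_upwards [ae_restrict_mem measurableSet_Ioi] with κ hκ
      exact hK κ hκ
  simpa only [mul_assoc] using hb

/-- Plancherel in t reduces the estimate to single frequencies, where the factor κ offsets the
O(1/l) norm of the slice at l = 2πκ. A general multiplier m is kept so that one statement covers
both the translates and their differences. -/
theorem exists_multiplier_bound {γ r : ℝ} (hγ : 1 < γ) (hr : -1 < r) (hr' : r < 2 * γ - 1) :
    ∃ C : ℝ≥0, ∀ (f : hypersurface γ → ℂ) (N : ℝ), BoundedSupport γ N f →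
      ∀ m : ℝ → ℂ, Measurable m → Integrable (fun κ : ℝ => (κ : ℂ) * m κ) ray →
      ∫⁻ a : ℝ, ∫⁻ φ : ℝ, ∫⁻ t : ℝ, ENNReal.ofReal (a ^ r) * ‖(γ ^ 2 : ℝ) * ∫ κ : ℝ,
        Complex.exp (2 * Real.pi * κ * t * Complex.I) * (κ * (m κ *
          slice γ (2 * Real.pi * κ) (partialFourier γ f κ) a φ)) ∂ray‖ₑ ^ 2 ∂volume ∂angle ∂ray ≤
      C * ∫⁻ κ : ℝ, ‖m κ‖ₑ ^ 2 * ∫⁻ α : ℝ, ENNReal.ofReal (α ^ r) *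
        ∫⁻ θ : ℝ, ‖partialFourier γ f κ (α, θ)‖ₑ ^ 2 ∂angle ∂ray ∂ray := by
  obtain ⟨C, hC⟩ := exists_lintegral_slice_le hγ hr hr'
  refine ⟨(γ ^ 2).toNNReal ^ 2 * C, fun f N hf m hm hmi => ?_⟩
  have hsm := measurable_slice_partialFourier hf.measurable
  set S : ℝ → ℝ → ℝ → ℂ := fun κ a φ => slice γ (2 * Real.pi * κ) (partialFourier γ f κ) a φ
    with hS
  have hc : ‖((γ ^ 2 : ℝ) : ℂ)‖ₑ = ((γ ^ 2).toNNReal : ℝ≥0∞) := by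
    rw [← ofReal_norm, Complex.norm_real, Real.norm_of_nonneg (by positivity)]
    rfl
  have h1 : ∀ a : ℝ, 0 < a → ∀ φ : ℝ, ∫⁻ t : ℝ, ENNReal.ofReal (a ^ r) * ‖(γ ^ 2 : ℝ) * ∫ κ : ℝ,
        Complex.exp (2 * Real.pi * κ * t * Complex.I) * (κ * (m κ * S κ a φ)) ∂ray‖ₑ ^ 2 ≤
      ENNReal.ofReal (a ^ r) * (((γ ^ 2).toNNReal : ℝ≥0∞) ^ 2 *
        ∫⁻ κ : ℝ, ‖κ * (m κ * S κ a φ)‖ₑ ^ 2 ∂ray) := by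
    intro a ha φ
    rw [lintegral_const_mul' _ _ ENNReal.ofReal_ne_top]
    refine mul_le_mul_right ?_ _
    simp only [enorm_mul _ (∫ κ : ℝ, _ ∂ray), mul_pow, hc]
    rw [lintegral_const_mul' _ _ (by finiteness)]
    exact mul_le_mul_right (lintegral_ray_exp_sq_le (hf.integrable_mul_slice hγ ha φ hmi)) _
  have hM : Measurable fun x : (ℝ × ℝ) × ℝ => ‖x.2 * (m x.2 * S x.2 x.1.1 x.1.2)‖ₑ ^ 2 :=
    (Measurable.mul (by fun_prop) (Measurable.mul (by fun_prop) hsm)).enorm.pow_const 2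
  have hM2 : Measurable fun x : ℝ × ℝ => ∫⁻ φ, ‖x.2 * (m x.2 * S x.2 x.1 φ)‖ₑ ^ 2 ∂angle := by
    refine Measurable.lintegral_prod_right' (f := fun y : (ℝ × ℝ) × ℝ =>
      ‖y.1.2 * (m y.1.2 * S y.1.2 y.1.1 y.2)‖ₑ ^ 2) ?_
    exact hM.comp (g := fun x : (ℝ × ℝ) × ℝ => ‖x.2 * (m x.2 * S x.2 x.1.1 x.1.2)‖ₑ ^ 2)
      (f := fun y : (ℝ × ℝ) × ℝ => ((y.1.1, y.2), y.1.2)) (by fun_prop)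
  calc _ ≤ ∫⁻ a : ℝ, ∫⁻ φ : ℝ, ENNReal.ofReal (a ^ r) * (((γ ^ 2).toNNReal : ℝ≥0∞) ^ 2 *
        ∫⁻ κ : ℝ, ‖κ * (m κ * S κ a φ)‖ₑ ^ 2 ∂ray) ∂angle ∂ray := by
        refine setLIntegral_mono_ae' measurableSet_Ioi (.of_forall fun a (ha : 0 < a) => ?_)
        exact lintegral_mono fun φ => h1 a ha φ
    _ = ((γ ^ 2).toNNReal : ℝ≥0∞) ^ 2 * ∫⁻ a : ℝ, ∫⁻ κ : ℝ, ENNReal.ofReal (a ^ r) *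
          ∫⁻ φ : ℝ, ‖κ * (m κ * S κ a φ)‖ₑ ^ 2 ∂angle ∂ray ∂ray := by
        rw [← lintegral_const_mul' _ _ (by finiteness)]
        refine lintegral_congr fun a => ?_
        rw [lintegral_const_mul' _ _ ENNReal.ofReal_ne_top,
          lintegral_const_mul' _ _ (by finiteness), lintegral_const_mul' _ _ ENNReal.ofReal_ne_top,
          lintegral_lintegral_swap, mul_left_comm]
        exact (hM.comp (g := fun x : (ℝ × ℝ) × ℝ => ‖x.2 * (m x.2 * S x.2 x.1.1 x.1.2)‖ₑ ^ 2)
          (f := fun y : ℝ × ℝ => ((a, y.1), y.2)) (by fun_prop)).aemeasurable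
    _ = ((γ ^ 2).toNNReal : ℝ≥0∞) ^ 2 * ∫⁻ κ : ℝ, ∫⁻ a : ℝ, ENNReal.ofReal (a ^ r) *
          ∫⁻ φ : ℝ, ‖κ * (m κ * S κ a φ)‖ₑ ^ 2 ∂angle ∂ray ∂ray := by
        rw [lintegral_lintegral_swap]
        exact (Measurable.mul (by fun_prop) hM2).aemeasurable
    _ ≤ ((γ ^ 2).toNNReal : ℝ≥0∞) ^ 2 * ∫⁻ κ : ℝ, C * (‖m κ‖ₑ ^ 2 * ∫⁻ α : ℝ, ENNReal.ofReal (α ^ r) *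
        ∫⁻ θ : ℝ, ‖partialFourier γ f κ (α, θ)‖ₑ ^ 2 ∂angle ∂ray) ∂ray := by
        refine mul_le_mul_right
          (setLIntegral_mono_ae' measurableSet_Ioi (.of_forall fun κ (hκ : 0 < κ) => ?_)) _
        have hκm : Measurable (partialFourier γ f κ) :=
          (measurable_partialFourier hf.measurable).comp
            (g := fun x : ℝ × (ℝ × ℝ) => partialFourier γ f x.1 x.2)
            (f := fun q : ℝ × ℝ => (κ, q)) (by fun_prop)
        have h2 := hC (2 * Real.pi * κ) (partialFourier γ f κ) (N * (2 * N)) N (by positivity)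
          hκm (hf.norm_partialFourier_le κ) (fun p hp => hf.partialFourier_eq_zero κ p hp)
        have h3 : ∀ a φ : ℝ, ‖κ * (m κ * S κ a φ)‖ₑ ^ 2 =
            ENNReal.ofReal (κ ^ 2) * (‖m κ‖ₑ ^ 2 * ‖S κ a φ‖ₑ ^ 2) := by
          intro a φ
          rw [enorm_mul, enorm_mul, mul_pow, mul_pow, ← ofReal_norm (κ : ℂ), Complex.norm_real,
            Real.norm_of_nonneg hκ.le, ENNReal.ofReal_pow hκ.le]
        calc _ = ‖m κ‖ₑ ^ 2 * (ENNReal.ofReal (κ ^ 2) * ∫⁻ a : ℝ, ENNReal.ofReal (a ^ r) *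
                ∫⁻ φ : ℝ, ‖S κ a φ‖ₑ ^ 2 ∂angle ∂ray) := by
              rw [← lintegral_const_mul' _ _ ENNReal.ofReal_ne_top,
                ← lintegral_const_mul' _ _ (by finiteness)]
              refine lintegral_congr fun a => ?_
              simp only [h3]
              rw [lintegral_const_mul' _ _ ENNReal.ofReal_ne_top,
                lintegral_const_mul' _ _ (by finiteness)]
              ring
          _ ≤ ‖m κ‖ₑ ^ 2 * (ENNReal.ofReal ((2 * Real.pi * κ) ^ 2) *
                ∫⁻ a : ℝ, ENNReal.ofReal (a ^ r) *
                ∫⁻ φ : ℝ, ‖S κ a φ‖ₑ ^ 2 ∂angle ∂ray) := by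
              gcongr
              have := Real.pi_gt_three
              nlinarith
          _ ≤ ‖m κ‖ₑ ^ 2 * (C * ∫⁻ α : ℝ, ENNReal.ofReal (α ^ r) *
                ∫⁻ θ : ℝ, ‖partialFourier γ f κ (α, θ)‖ₑ ^ 2 ∂angle ∂ray) :=
              mul_le_mul_right h2 _
          _ = _ := by ring
    _ = _ := by
        rw [lintegral_const_mul' _ _ ENNReal.coe_ne_top, ← mul_assoc]
        push_cast
        rfl

theorem norm_exp_sub_exp_le {x y z : ℝ} (hx : 0 ≤ x) (hy : 0 ≤ y) (hxz : x ≤ z) (hyz : y ≤ z) :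
    |Real.exp (-x) - Real.exp (-y)| ≤ 1 - Real.exp (-z) := by
  have h1 : Real.exp (-x) ≤ 1 := Real.exp_le_one_iff.2 (by linarith)
  have h2 : Real.exp (-y) ≤ 1 := Real.exp_le_one_iff.2 (by linarith)
  have h3 : Real.exp (-z) ≤ Real.exp (-x) := Real.exp_le_exp.2 (by linarith)
  have h4 : Real.exp (-z) ≤ Real.exp (-y) := Real.exp_le_exp.2 (by linarith)
  rw [abs_le]
  constructor <;> linarith

/-- Uniform `L²(μ_r)` bound and Cauchy property of the translates `L f(·, · + iε)`. -/
theorem exists_translate_bound {γ r : ℝ} (hγ : 1 < γ) (hr : -1 < r) (hr' : r < 2 * γ - 1) :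
    ∃ C : ℝ≥0, ∀ (f : hypersurface γ → ℂ) (N : ℝ), BoundedSupport γ N f →
      (∀ ε : ℝ, 0 < ε →
        ∫⁻ ζ, ‖translate γ f ε ζ‖ₑ ^ 2 ∂(mu γ r) ≤ C * ∫⁻ ζ, ‖f ζ‖ₑ ^ 2 ∂(mu γ r)) ∧
      ((∫⁻ ζ, ‖f ζ‖ₑ ^ 2 ∂(mu γ r) ≠ ∞) → ∃ W : ℝ → ℝ≥0∞, Tendsto W (𝓝[>] 0) (𝓝 0) ∧
        ∀ ε δ η : ℝ, 0 < ε → 0 < δ → ε ≤ η → δ ≤ η →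
        ∫⁻ ζ, ‖translate γ f ε ζ - translate γ f δ ζ‖ₑ ^ 2 ∂(mu γ r) ≤ W η) := by
  obtain ⟨C, hC⟩ := exists_multiplier_bound hγ hr hr'
  refine ⟨C, fun f N hf => ?_⟩
  set H : ℝ → ℝ≥0∞ := fun κ => ∫⁻ α : ℝ, ENNReal.ofReal (α ^ r) *
        ∫⁻ θ : ℝ, ‖partialFourier γ f κ (α, θ)‖ₑ ^ 2 ∂angle ∂ray with hH
  have hHm : Measurable H := by
    have h1 : Measurable fun x : (ℝ × ℝ) × ℝ => ‖partialFourier γ f x.1.1 (x.1.2, x.2)‖ₑ ^ 2 :=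
      ((measurable_partialFourier hf.measurable).comp
        (g := fun x : ℝ × (ℝ × ℝ) => partialFourier γ f x.1 x.2)
        (f := fun x : (ℝ × ℝ) × ℝ => (x.1.1, (x.1.2, x.2))) (by fun_prop)).enorm.pow_const 2
    have h2 : Measurable fun x : ℝ × ℝ =>
      ∫⁻ θ : ℝ, ‖partialFourier γ f x.1 (x.2, θ)‖ₑ ^ 2 ∂angle := h1.lintegral_prod_right'
    have h3 : Measurable fun x : ℝ × ℝ => ENNReal.ofReal (x.2 ^ r) *
      ∫⁻ θ : ℝ, ‖partialFourier γ f x.1 (x.2, θ)‖ₑ ^ 2 ∂angle := Measurable.mul (by fun_prop) h2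
    exact h3.lintegral_prod_right'
  have hHf : ∫⁻ κ, H κ ∂ray ≤ ∫⁻ ζ, ‖f ζ‖ₑ ^ 2 ∂(mu γ r) := hf.lintegral_partialFourier_le r
  set E : ℝ → ℝ → ℝ := fun ε κ => Real.exp (-(2 * Real.pi * ε) * κ) with hE
  have hEi : ∀ ε, 0 < ε → Integrable (fun κ : ℝ => (κ : ℂ) * (E ε κ : ℂ)) ray := by
    intro ε hε
    have h1 := (integrable_pow_mul_exp_neg 1 (c := 2 * Real.pi * ε) (by positivity)).ofReal (𝕜 := ℂ)
    refine h1.congr (.of_forall fun κ => ?_)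
    simp [hE]
  have hpol : ∀ F : hypersurface γ → ℂ, Measurable F →
      ∫⁻ ζ, ‖F ζ‖ₑ ^ 2 ∂(mu γ r) = ∫⁻ a : ℝ, ∫⁻ φ : ℝ, ∫⁻ t : ℝ,
        ENNReal.ofReal (a ^ r) * ‖F (polarPoint γ (a, φ, t))‖ₑ ^ 2 ∂volume ∂angle ∂ray := by
    intro F hF
    have hm4 : Measurable fun p : ℝ × ℝ × ℝ =>
        ENNReal.ofReal (p.1 ^ r) * ‖F (polarPoint γ p)‖ₑ ^ 2 :=
      Measurable.mul (by fun_prop) ((hF.comp (measurable_polarPoint γ)).enorm.pow_const 2)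
    rw [lintegral_mu (hF.enorm.pow_const 2).aemeasurable, lintegral_coords hm4]
  constructor
  · intro ε hε
    rw [hpol _ (measurable_translate hf.measurable ε)]
    have h1 := hC f N hf (fun κ => (E ε κ : ℂ)) (by fun_prop) (hEi ε hε)
    refine le_trans (le_of_eq ?_) (h1.trans ?_)
    · refine setLIntegral_congr_fun measurableSet_Ioi fun a (ha : 0 < a) => ?_
      refine lintegral_congr fun φ => lintegral_congr fun t => ?_
      rw [hf.translate_eq hγ hε ha]
    · refine mul_le_mul_right (le_trans ?_ hHf) _
      refine setLIntegral_mono_ae' measurableSet_Ioi (.of_forall fun κ (hκ : 0 < κ) => ?_)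
      refine mul_le_of_le_one_left zero_le (pow_le_one₀ zero_le ?_)
      rw [← ofReal_norm, Complex.norm_real, Real.norm_of_nonneg (Real.exp_pos _).le]
      refine ENNReal.ofReal_le_one.2 (Real.exp_le_one_iff.2 ?_)
      have : 0 < 2 * Real.pi * ε := by positivity
      nlinarith
  · intro hfin
    have hHfin : ∫⁻ κ, H κ ∂ray ≠ ∞ := ne_top_of_le_ne_top hfin hHf
    refine ⟨fun η => C * ∫⁻ κ, ENNReal.ofReal ((1 - E η κ) ^ 2) * H κ ∂ray, ?_, ?_⟩
    · have h0 : Tendsto (fun η => ∫⁻ κ, ENNReal.ofReal ((1 - E η κ) ^ 2) * H κ ∂ray) (𝓝[>] 0)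
          (𝓝 (∫⁻ κ, 0 ∂ray)) := by
        refine tendsto_lintegral_filter_of_dominated_convergence H ?_ ?_ hHfin ?_
        · exact .of_forall fun η => Measurable.mul (by fun_prop) hHm
        · filter_upwards [self_mem_nhdsWithin] with η hη
          have hη0 : (0 : ℝ) < η := hη
          filter_upwards [ae_restrict_mem measurableSet_Ioi] with κ hκ
          have hκ0 : (0 : ℝ) < κ := hκ
          refine mul_le_of_le_one_left zero_le (ENNReal.ofReal_le_one.2 ?_)
          have h1 : 0 < E η κ := Real.exp_pos _
          have h2 : E η κ ≤ 1 := Real.exp_le_one_iff.2 (by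
            have : 0 < 2 * Real.pi * η * κ := by positivity
            linarith)
          nlinarith
        · filter_upwards [ae_lt_top hHm hHfin] with κ hκ
          have h1 : Tendsto (fun η => (1 - E η κ) ^ 2) (𝓝[>] 0) (𝓝 0) := by
            have hc : Continuous fun η => (1 - E η κ) ^ 2 := by fun_prop
            have h0 : (1 - E 0 κ) ^ 2 = 0 := by simp [hE]
            have := hc.tendsto 0
            rw [h0] at this
            exact this.mono_left nhdsWithin_le_nhds
          have h2 := ENNReal.Tendsto.mul_const (b := H κ) (ENNReal.tendsto_ofReal h1)
            (Or.inr hκ.ne)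
          simpa using h2
      have := ENNReal.Tendsto.const_mul (a := (C : ℝ≥0∞)) h0 (Or.inr ENNReal.coe_ne_top)
      simpa using this
    · intro ε δ η hε hδ hεη hδη
      rw [hpol (fun ζ => translate γ f ε ζ - translate γ f δ ζ)
        ((measurable_translate hf.measurable ε).sub (measurable_translate hf.measurable δ))]
      have hi : Integrable (fun κ : ℝ => (κ : ℂ) * ((E ε κ - E δ κ : ℝ) : ℂ)) ray := by
        refine ((hEi ε hε).sub (hEi δ hδ)).congr (.of_forall fun κ => ?_)
        simp only [Pi.sub_apply]
        push_cast
        ring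
      have h1 := hC f N hf (fun κ => ((E ε κ - E δ κ : ℝ) : ℂ)) (by fun_prop) hi
      refine le_trans (le_of_eq ?_) (h1.trans ?_)
      · refine setLIntegral_congr_fun measurableSet_Ioi fun a (ha : 0 < a) => ?_
        refine lintegral_congr fun φ => lintegral_congr fun t => ?_
        rw [hf.translate_eq hγ hε ha, hf.translate_eq hγ hδ ha, ← mul_sub, ← integral_sub]
        · congr 5
          ext κ
          simp only [hE]
          push_cast
          ring
        · exact integrable_exp_mul_ray (hf.integrable_mul_slice hγ ha φ (hEi ε hε)) t
        · exact integrable_exp_mul_ray (hf.integrable_mul_slice hγ ha φ (hEi δ hδ)) t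
      · refine mul_le_mul_right ?_ _
        refine setLIntegral_mono_ae' measurableSet_Ioi (.of_forall fun κ (hκ : 0 < κ) => ?_)
        refine mul_le_mul_left ?_ _
        rw [← ofReal_norm, Complex.norm_real, ← ENNReal.ofReal_pow (norm_nonneg _)]
        refine ENNReal.ofReal_le_ofReal ?_
        refine pow_le_pow_left₀ (norm_nonneg _) ?_ 2
        have hx : ∀ x : ℝ, -(2 * Real.pi * x) * κ = -(2 * Real.pi * x * κ) := fun x => by ring
        simp only [hE, hx, Real.norm_eq_abs]
        apply norm_exp_sub_exp_le <;> first | positivity | gcongr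

/-! ### Extension from truncations to L²(μ_r) -/

section Pairing

variable {γ r : ℝ} {f g : hypersurface γ → ℂ} {z : ℂ × ℂ}

theorem measurable_kernel_right (γ : ℝ) (z : ℂ × ℂ) :
    Measurable fun ζ : hypersurface γ => kernel γ z ζ.1 :=
  measurable_kernel_comp γ measurable_const measurable_subtype_coe

theorem sq_lintegral_mul_kernel_le (hf : AEStronglyMeasurable f (mu γ r)) :
    (∫⁻ ζ, ‖f ζ * kernel γ z ζ.1‖ₑ ∂(mu γ (γ - 1))) ^ 2 ≤
      (∫⁻ ζ, ‖f ζ‖ₑ ^ 2 ∂(mu γ r)) *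
        ∫⁻ ζ, ‖kernel γ z ζ.1‖ₑ ^ 2 ∂(mu γ (2 * (γ - 1) - r)) := by
  have h := sq_lintegral_mul_mu_le (γ := γ) (r := r) (q := 2 * (γ - 1) - r)
    (f := fun ζ => ‖f ζ‖ₑ) (h := fun ζ => ‖kernel γ z ζ.1‖ₑ) hf.enorm
    (measurable_kernel_right γ z).enorm.aemeasurable
  rw [show (r + (2 * (γ - 1) - r)) / 2 = γ - 1 by ring] at h
  simpa only [enorm_mul] using h

theorem lintegral_enorm_sq_lt_top (hf : MemLp f 2 (mu γ r)) :
    ∫⁻ ζ, ‖f ζ‖ₑ ^ 2 ∂(mu γ r) < ∞ := by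
  rw [lintegral_enorm_sq_eq]
  exact ENNReal.pow_lt_top hf.2

theorem integrable_mul_kernel (hγ : 1 < γ) (hr : -1 < r) (hr' : r < 2 * γ - 1)
    (hf : MemLp f 2 (mu γ r)) (hz : z ∈ domain γ) :
    Integrable (fun ζ : hypersurface γ => f ζ * kernel γ z ζ.1) (mu γ (γ - 1)) := by
  refine ⟨(hf.1.mono_ac (mu_absolutelyContinuous γ _ _)).mul
    (measurable_kernel_right γ z).aestronglyMeasurable, ?_⟩
  have h := sq_lintegral_mul_kernel_le (z := z) hf.1
  have h2 := ENNReal.mul_lt_top (lintegral_enorm_sq_lt_top hf)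
    (lintegral_kernel_sq_lt_top (q := 2 * (γ - 1) - r) hγ (by linarith) (by linarith) hz)
  rw [hasFiniteIntegral_iff_enorm]
  by_contra hc
  rw [not_lt_top_iff.1 hc] at h
  simp only [ne_eq, OfNat.ofNat_ne_zero, not_false_eq_true, ENNReal.top_pow, top_le_iff] at h
  exact h2.ne h

theorem lerayIntegral_add (hγ : 1 < γ) (hr : -1 < r) (hr' : r < 2 * γ - 1)
    (hf : MemLp f 2 (mu γ r)) (hg : MemLp g 2 (mu γ r)) (hz : z ∈ domain γ) :
    lerayIntegral γ (f + g) z = lerayIntegral γ f z + lerayIntegral γ g z := by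
  simp only [lerayIntegral, Pi.add_apply, add_mul]
  exact integral_add (integrable_mul_kernel hγ hr hr' hf hz) (integrable_mul_kernel hγ hr hr' hg hz)

theorem lerayIntegral_sub (hγ : 1 < γ) (hr : -1 < r) (hr' : r < 2 * γ - 1)
    (hf : MemLp f 2 (mu γ r)) (hg : MemLp g 2 (mu γ r)) (hz : z ∈ domain γ) :
    lerayIntegral γ (f - g) z = lerayIntegral γ f z - lerayIntegral γ g z := by
  simp only [lerayIntegral, Pi.sub_apply, sub_mul]
  exact integral_sub (integrable_mul_kernel hγ hr hr' hf hz) (integrable_mul_kernel hγ hr hr' hg hz)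

theorem lerayIntegral_smul (c : ℂ) (f : hypersurface γ → ℂ) (z : ℂ × ℂ) :
    lerayIntegral γ (c • f) z = c * lerayIntegral γ f z := by
  simp only [lerayIntegral, Pi.smul_apply, smul_eq_mul, mul_assoc]
  exact integral_const_mul _ _

theorem ennreal_tendsto_zero_of_sq {ι : Type*} {l : Filter ι} {a : ι → ℝ≥0∞}
    (h : Tendsto (fun i => a i ^ 2) l (𝓝 0)) : Tendsto a l (𝓝 0) := by
  have h2 := (ENNReal.continuous_rpow_const (y := (1 / 2 : ℝ))).tendsto 0 |>.comp h
  rw [ENNReal.zero_rpow_of_pos (by norm_num)] at h2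
  refine h2.congr fun i => ?_
  simp only [Function.comp_apply]
  rw [← ENNReal.rpow_natCast, ← ENNReal.rpow_mul]
  norm_num

/-- For fixed z the Leray integral is a bounded functional on L²(μ_r), because the kernel is square
integrable for the dual weight. -/
theorem tendsto_lerayIntegral {ι : Type*} {l : Filter ι} {F : ι → hypersurface γ → ℂ}
    (hγ : 1 < γ) (hr : -1 < r) (hr' : r < 2 * γ - 1) (hf : MemLp f 2 (mu γ r))
    (hF : ∀ i, MemLp (F i) 2 (mu γ r))
    (h : Tendsto (fun i => eLpNorm (F i - f) 2 (mu γ r)) l (𝓝 0)) (hz : z ∈ domain γ) :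
    Tendsto (fun i => lerayIntegral γ (F i) z) l (𝓝 (lerayIntegral γ f z)) := by
  rw [tendsto_iff_edist_tendsto_0]
  refine ennreal_tendsto_zero_of_sq ?_
  have h2 : Tendsto (fun i => eLpNorm (F i - f) 2 (mu γ r) ^ 2 *
      ∫⁻ ζ, ‖kernel γ z ζ.1‖ₑ ^ 2 ∂(mu γ (2 * (γ - 1) - r))) l (𝓝 0) := by
    have := ENNReal.Tendsto.mul_const (ENNReal.Tendsto.pow (n := 2) h) (Or.inr
      (lintegral_kernel_sq_lt_top (q := 2 * (γ - 1) - r) hγ (by linarith) (by linarith) hz).ne)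
    simpa using this
  refine tendsto_of_tendsto_of_tendsto_of_le_of_le tendsto_const_nhds h2 (fun i => zero_le)
    fun i => ?_
  rw [edist_eq_enorm_sub, ← lerayIntegral_sub hγ hr hr' (hF i) hf hz, ← lintegral_enorm_sq_eq]
  refine le_trans ?_ (sq_lintegral_mul_kernel_le ((hF i).sub hf).1)
  exact ENNReal.pow_le_pow_left (enorm_integral_le_lintegral_enorm _)

end Pairing

section Truncation

variable {γ r : ℝ} {f : hypersurface γ → ℂ}

/-- The truncation of `f` to the set where `f` and the coordinates are bounded by `N`. -/
def truncate (γ : ℝ) (f : hypersurface γ → ℂ) (N : ℝ) : hypersurface γ → ℂ :=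
  Set.indicator {ζ | ‖f ζ‖ ≤ N ∧ ‖ζ.1.1‖ ≤ N ∧ |ζ.1.2.re| ≤ N} f

theorem boundedSupport_truncate (hf : Measurable f) {N : ℝ} (hN : 0 ≤ N) :
    BoundedSupport γ N (truncate γ f N) where
  measurable := by
    refine hf.indicator ?_
    have h1 : Measurable fun ζ : hypersurface γ => ‖ζ.1.1‖ :=
      (measurable_fst.comp measurable_subtype_coe).norm
    have h2 : Measurable fun ζ : hypersurface γ => |ζ.1.2.re| :=
      (Complex.measurable_re.comp (measurable_snd.comp measurable_subtype_coe)).norm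
    exact (measurableSet_le hf.norm measurable_const).inter
      ((measurableSet_le h1 measurable_const).inter (measurableSet_le h2 measurable_const) :)
  norm_le ζ := by
    unfold truncate
    by_cases h : ζ ∈ {ζ : hypersurface γ | ‖f ζ‖ ≤ N ∧ ‖ζ.1.1‖ ≤ N ∧ |ζ.1.2.re| ≤ N}
    · rw [Set.indicator_of_mem h]
      exact h.1
    · rw [Set.indicator_of_notMem h, norm_zero]
      exact hN
  eq_zero_of_norm ζ h := Set.indicator_of_notMem (fun h' => (h.trans_le h'.2.1).false) _
  eq_zero_of_re ζ h := Set.indicator_of_notMem (fun h' => (h.trans_le h'.2.2).false) _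

theorem enorm_truncate_le (f : hypersurface γ → ℂ) (N : ℝ) (ζ : hypersurface γ) :
    ‖truncate γ f N ζ‖ₑ ≤ ‖f ζ‖ₑ := by
  rw [truncate, enorm_indicator_eq_indicator_enorm]
  exact Set.indicator_le_self _ _ _

theorem memLp_truncate (hfm : Measurable f) (hf : MemLp f 2 (mu γ r)) {N : ℝ} (hN : 0 ≤ N) :
    MemLp (truncate γ f N) 2 (mu γ r) :=
  hf.mono (boundedSupport_truncate hfm hN).measurable.aestronglyMeasurable
    (.of_forall fun ζ => enorm_le_iff_norm_le.1 (enorm_truncate_le f N ζ))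

theorem truncate_eventually_eq (f : hypersurface γ → ℂ) (ζ : hypersurface γ) :
    ∀ᶠ n : ℕ in atTop, truncate γ f n ζ = f ζ := by
  obtain ⟨m, hm⟩ := exists_nat_ge (max ‖f ζ‖ (max ‖ζ.1.1‖ |ζ.1.2.re|))
  filter_upwards [eventually_ge_atTop m] with n hn
  have hmn : (m : ℝ) ≤ n := by exact_mod_cast hn
  refine Set.indicator_of_mem ?_ _
  have h1 := hm.trans hmn
  simp only [max_le_iff] at h1
  exact h1

theorem tendsto_truncate (hfm : Measurable f) (hf : MemLp f 2 (mu γ r)) :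
    Tendsto (fun n : ℕ => eLpNorm (truncate γ f n - f) 2 (mu γ r)) atTop (𝓝 0) := by
  refine ennreal_tendsto_zero_of_sq ?_
  simp_rw [← lintegral_enorm_sq_eq]
  have h : Tendsto (fun n : ℕ => ∫⁻ ζ, ‖(truncate γ f n - f) ζ‖ₑ ^ 2 ∂(mu γ r)) atTop
      (𝓝 (∫⁻ _, 0 ∂(mu γ r))) := by
    refine tendsto_lintegral_of_dominated_convergence (fun ζ => ‖f ζ‖ₑ ^ 2) ?_ ?_
      (lintegral_enorm_sq_lt_top hf).ne ?_
    · intro n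
      exact (((boundedSupport_truncate hfm n.cast_nonneg).measurable.sub hfm).enorm).pow_const 2
    · refine fun n => .of_forall fun ζ => ENNReal.pow_le_pow_left ?_
      simp only [Pi.sub_apply, truncate]
      by_cases h : ζ ∈ {ζ : hypersurface γ | ‖f ζ‖ ≤ n ∧ ‖ζ.1.1‖ ≤ n ∧ |ζ.1.2.re| ≤ n}
      · rw [Set.indicator_of_mem h]
        simp
      · rw [Set.indicator_of_notMem h]
        simp
    · refine .of_forall fun ζ => tendsto_const_nhds.congr' ?_
      filter_upwards [truncate_eventually_eq f ζ] with n hn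
      simp [hn]
  simpa using h

end Truncation

section Translates

variable {γ r : ℝ} {f : hypersurface γ → ℂ}

theorem aestronglyMeasurable_translate (hf : AEStronglyMeasurable f (mu γ r)) (ε : ℝ) :
    AEStronglyMeasurable (translate γ f ε) (mu γ r) := by
  have h : translate γ f ε = translate γ (hf.mk f) ε := by
    ext ζ
    exact congrFun (lerayIntegral_congr hf.ae_eq_mk) _
  rw [h]
  exact (measurable_translate hf.stronglyMeasurable_mk.measurable ε).aestronglyMeasurable

/-- The translates of the truncations converge pointwise, so Fatou's lemma carries the uniform bound
over to f. -/
theorem exists_eLpNorm_translate_le (hγ : 1 < γ) (hr : -1 < r) (hr' : r < 2 * γ - 1) :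
    ∃ C : ℝ≥0, ∀ f : hypersurface γ → ℂ, MemLp f 2 (mu γ r) → ∀ ε : ℝ, 0 < ε →
      eLpNorm (translate γ f ε) 2 (mu γ r) ≤ C * eLpNorm f 2 (mu γ r) := by
  obtain ⟨C, hC⟩ := exists_translate_bound hγ hr hr'
  refine ⟨NNReal.sqrt C, fun f hf ε hε => ?_⟩
  -- Truncation needs a genuinely measurable function; the Leray integral does not see the choice of
  -- representative.
  wlog hfm : Measurable f generalizing f
  · have h := this (hf.1.mk f) (hf.ae_eq hf.1.ae_eq_mk) hf.1.stronglyMeasurable_mk.measurable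
    rw [← eLpNorm_congr_ae hf.1.ae_eq_mk] at h
    convert h using 2
    ext ζ
    exact congrFun (lerayIntegral_congr hf.1.ae_eq_mk) _
  rw [← ENNReal.pow_le_pow_left_iff two_ne_zero, mul_pow, ← lintegral_enorm_sq_eq,
    ← lintegral_enorm_sq_eq, ← ENNReal.coe_pow, NNReal.sq_sqrt]
  have hlim : ∀ ζ, ‖translate γ f ε ζ‖ₑ ^ 2 =
      liminf (fun n : ℕ => ‖translate γ (truncate γ f n) ε ζ‖ₑ ^ 2) atTop := by
    intro ζ
    refine (Tendsto.liminf_eq ?_).symm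
    exact ENNReal.Tendsto.pow (tendsto_lerayIntegral hγ hr hr' hf
      (fun n => memLp_truncate hfm hf n.cast_nonneg) (tendsto_truncate hfm hf)
      (lift_mem_domain hε ζ)).enorm
  calc ∫⁻ ζ, ‖translate γ f ε ζ‖ₑ ^ 2 ∂(mu γ r)
      = ∫⁻ ζ, liminf (fun n : ℕ => ‖translate γ (truncate γ f n) ε ζ‖ₑ ^ 2) atTop ∂(mu γ r) :=
        lintegral_congr hlim
    _ ≤ liminf (fun n : ℕ => ∫⁻ ζ, ‖translate γ (truncate γ f n) ε ζ‖ₑ ^ 2 ∂(mu γ r)) atTop :=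
        lintegral_liminf_le fun n => (measurable_translate
          (boundedSupport_truncate hfm n.cast_nonneg).measurable ε).enorm.pow_const 2
    _ ≤ liminf (fun _ : ℕ => C * ∫⁻ ζ, ‖f ζ‖ₑ ^ 2 ∂(mu γ r)) atTop := by
        refine liminf_le_liminf (.of_forall fun n => ?_)
        refine ((hC _ _ (boundedSupport_truncate hfm n.cast_nonneg)).1 ε hε).trans ?_
        exact mul_le_mul_right (lintegral_mono fun ζ =>
          ENNReal.pow_le_pow_left (enorm_truncate_le f n ζ)) _
    _ = _ := liminf_const _

/-- The operators `f ↦ L f (·, · + iε)` are bounded on `L²(μ_r)`, uniformly in `ε`. -/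
theorem exists_translateCLM (hγ : 1 < γ) (hr : -1 < r) (hr' : r < 2 * γ - 1) :
    ∃ (C : ℝ≥0) (A : ℝ → Lp ℂ 2 (mu γ r) →L[ℂ] Lp ℂ 2 (mu γ r)),
      (∀ ε, 0 < ε → ∀ f : hypersurface γ → ℂ, ∀ hf : MemLp f 2 (mu γ r),
        A ε (hf.toLp f) =ᵐ[mu γ r] translate γ f ε) ∧ ∀ ε f, ‖A ε f‖ ≤ C * ‖f‖ := by
  obtain ⟨C, hC⟩ := exists_eLpNorm_translate_le hγ hr hr'
  have hmem : ∀ ε : ℝ, 0 < ε → ∀ f : Lp ℂ 2 (mu γ r), MemLp (translate γ f ε) 2 (mu γ r) :=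
    fun ε hε f => ⟨aestronglyMeasurable_translate (Lp.aestronglyMeasurable f) ε,
      (hC _ (Lp.memLp f) ε hε).trans_lt (ENNReal.mul_lt_top ENNReal.coe_lt_top (Lp.memLp f).2)⟩
  let A : ∀ ε : ℝ, 0 < ε → Lp ℂ 2 (mu γ r) →ₗ[ℂ] Lp ℂ 2 (mu γ r) := fun ε hε =>
    { toFun := fun f => (hmem ε hε f).toLp _
      map_add' := fun f g => by
        rw [← MemLp.toLp_add, MemLp.toLp_eq_toLp_iff]
        refine .of_forall fun ζ => ?_
        rw [Pi.add_apply, translate, lerayIntegral_congr (Lp.coeFn_add f g)]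
        exact lerayIntegral_add hγ hr hr' (Lp.memLp f) (Lp.memLp g) (lift_mem_domain hε ζ)
      map_smul' := fun c f => by
        rw [RingHom.id_apply, ← MemLp.toLp_const_smul, MemLp.toLp_eq_toLp_iff]
        refine .of_forall fun ζ => ?_
        rw [translate, lerayIntegral_congr (Lp.coeFn_smul c f)]
        exact lerayIntegral_smul _ _ _ }
  have hA : ∀ ε hε f, ‖A ε hε f‖ ≤ C * ‖f‖ := by
    intro ε hε f
    have h : (A ε hε f : Lp ℂ 2 (mu γ r)) = (hmem ε hε f).toLp _ := rfl
    rw [h, Lp.norm_toLp, Lp.norm_def, ← ENNReal.coe_toReal, ← ENNReal.toReal_mul]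
    exact ENNReal.toReal_mono (ENNReal.mul_ne_top ENNReal.coe_ne_top (Lp.memLp f).2.ne)
      (hC _ (Lp.memLp f) ε hε)
  refine ⟨C, fun ε => if hε : 0 < ε then (A ε hε).mkContinuous C (hA ε hε) else 0, ?_, ?_⟩
  · intro ε hε f hf
    simp only [dif_pos hε]
    refine (MemLp.coeFn_toLp (hmem ε hε _)).trans (.of_forall fun ζ => ?_)
    exact congrFun (lerayIntegral_congr hf.coeFn_toLp) _
  · intro ε f
    by_cases hε : 0 < ε
    · simp only [dif_pos hε]
      exact hA ε hε f
    · simp only [dif_neg hε, zero_apply, norm_zero]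
      positivity

end Translates

/-! ### Strong limit of the translates and boundary values -/

/-- Uniformly bounded operators that converge on a sequence tending to x also converge at x: choose
n with u n close to x, and compare values within e/4. -/
theorem exists_tendsto_of_tendsto_seq {ι E : Type*} [NormedAddCommGroup E] [NormedSpace ℂ E]
    [CompleteSpace E] {l : Filter ι} [l.NeBot] {A : ι → E →L[ℂ] E} {C : ℝ≥0}
    (hA : ∀ i x, ‖A i x‖ ≤ C * ‖x‖) {u : ℕ → E} {x : E} (hu : Tendsto u atTop (𝓝 x))
    (h : ∀ n, ∃ y, Tendsto (fun i => A i (u n)) l (𝓝 y)) :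
    ∃ y, Tendsto (fun i => A i x) l (𝓝 y) := by
  rw [← cauchy_map_iff_exists_tendsto, Metric.cauchy_iff]
  refine ⟨inferInstance, fun e he => ?_⟩
  obtain ⟨n, hn⟩ := ((tendsto_iff_dist_tendsto_zero.1 hu).eventually
    (gt_mem_nhds (show 0 < e / (4 * (C + 1)) by positivity))).exists
  obtain ⟨y, hy⟩ := h n
  refine ⟨(fun i => A i x) '' {i | dist (A i (u n)) y < e / 4}, image_mem_map
    ((tendsto_iff_dist_tendsto_zero.1 hy).eventually (gt_mem_nhds (by positivity))), ?_⟩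
  have hb : ∀ i, dist (A i x) (A i (u n)) ≤ e / 4 := by
    intro i
    rw [dist_eq_norm, ← map_sub]
    refine (hA i _).trans ?_
    rw [← dist_eq_norm, dist_comm]
    have hC : (C : ℝ) ≤ C + 1 := by linarith
    calc (C : ℝ) * dist (u n) x ≤ (C + 1) * (e / (4 * (C + 1))) := by gcongr
      _ = e / 4 := by field_simp
  rintro _ ⟨i, hi, rfl⟩ _ ⟨j, hj, rfl⟩
  have h1 := hb i
  have h2 := hb j
  rw [dist_comm] at h2
  have hi' : dist (A i (u n)) y < e / 4 := hi
  have hj' : dist (A j (u n)) y < e / 4 := hj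
  rw [dist_comm] at hj'
  have h3 := dist_triangle4 (A i x) (A i (u n)) y (A j x)
  have h4 := dist_triangle y (A j (u n)) (A j x)
  linarith

section Limit

variable {γ r : ℝ}

/-- The translates of `L f` define uniformly bounded operators converging strongly. -/
theorem exists_leray_limit (hγ : 1 < γ) (hr : -1 < r) (hr' : r < 2 * γ - 1) :
    ∃ (C : ℝ≥0) (A : ℝ → Lp ℂ 2 (mu γ r) →L[ℂ] Lp ℂ 2 (mu γ r))
      (T : Lp ℂ 2 (mu γ r) →L[ℂ] Lp ℂ 2 (mu γ r)),
      (∀ ε, 0 < ε → ∀ f : hypersurface γ → ℂ, ∀ hf : MemLp f 2 (mu γ r),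
        A ε (hf.toLp f) =ᵐ[mu γ r] translate γ f ε) ∧ (∀ ε f, ‖A ε f‖ ≤ C * ‖f‖) ∧
      ∀ f, Tendsto (fun ε => A ε f) (𝓝[>] 0) (𝓝 (T f)) := by
  obtain ⟨C, A, hA, hC⟩ := exists_translateCLM hγ hr hr'
  obtain ⟨D, hD⟩ := exists_translate_bound hγ hr hr'
  have hconv : ∀ f : Lp ℂ 2 (mu γ r), ∃ g, Tendsto (fun ε => A ε f) (𝓝[>] 0) (𝓝 g) := by
    intro f
    have hfm : Measurable f := (Lp.stronglyMeasurable f).measurable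
    have hn : ∀ n : ℕ, MemLp (truncate γ f n) 2 (mu γ r) :=
      fun n => memLp_truncate hfm (Lp.memLp f) n.cast_nonneg
    have hu : Tendsto (fun n => (hn n).toLp _) atTop (𝓝 f) := by
      have h := (Lp.tendsto_Lp_iff_tendsto_eLpNorm'' _ hn f (Lp.memLp f)).2
        (tendsto_truncate hfm (Lp.memLp f))
      rwa [Lp.toLp_coeFn] at h
    refine exists_tendsto_of_tendsto_seq hC hu fun n => ?_
    obtain ⟨W, hW, hWle⟩ := (hD _ _ (boundedSupport_truncate hfm n.cast_nonneg)).2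
      (lintegral_enorm_sq_lt_top (hn n)).ne
    rw [← cauchy_map_iff_exists_tendsto, EMetric.cauchy_iff]
    refine ⟨NeBot.ne inferInstance, fun e he => ?_⟩
    have h1 : ∀ᶠ η in 𝓝[>] (0 : ℝ), W η < e ^ 2 :=
      hW.eventually (gt_mem_nhds (ENNReal.pow_pos he 2))
    obtain ⟨η, hη, hη0⟩ := (h1.and self_mem_nhdsWithin).exists
    have hη0' : (0 : ℝ) < η := hη0
    refine ⟨_, image_mem_map (Ioc_mem_nhdsGT hη0'), ?_⟩
    rintro _ ⟨ε, hε, rfl⟩ _ ⟨δ, hδ, rfl⟩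
    have h2 := hWle ε δ η hε.1 hδ.1 hε.2 hδ.2
    rw [Lp.edist_def]
    have h3 : eLpNorm (⇑(A ε ((hn n).toLp _)) - ⇑(A δ ((hn n).toLp _))) 2 (mu γ r) =
        eLpNorm (fun ζ => translate γ (truncate γ f n) ε ζ - translate γ (truncate γ f n) δ ζ) 2
          (mu γ r) :=
      eLpNorm_congr_ae ((hA ε hε.1 _ (hn n)).sub (hA δ hδ.1 _ (hn n)))
    rw [h3]
    refine lt_of_not_ge fun h4 => ?_
    rw [lintegral_enorm_sq_eq] at h2
    exact ((ENNReal.pow_le_pow_left h4 (n := 2)).trans h2).not_gt hη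
  choose T hT using hconv
  -- Banach–Steinhaus makes the pointwise limit a bounded operator.
  exact ⟨C, A, continuousLinearMapOfTendsto A (tendsto_pi_nhds.2 hT), hA, hC, hT⟩

/-- The relative density |ζ₁|^(r'-r) is continuous on K, hence bounded, because K avoids ζ₁ = 0.
Convergence in L²(μ_r) thus implies the local L²(σ) convergence in the definition of a boundary
function. -/
theorem exists_restrict_le_smul (γ r r' : ℝ) {K : Set (hypersurface γ)} (hK : IsCompact K)
    (h0 : ∀ z ∈ K, z.1.1 ≠ 0) :
    ∃ c : ℝ≥0, (mu γ r').restrict K ≤ (c : ℝ≥0∞) • mu γ r := by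
  have hcont : ContinuousOn (fun ζ : hypersurface γ => ‖ζ.1.1‖ ^ (r' - r)) K := by
    refine ContinuousOn.rpow_const ?_ fun z hz => Or.inl (norm_ne_zero_iff.2 (h0 z hz))
    exact ((continuous_fst.comp continuous_subtype_val).norm).continuousOn
  obtain ⟨M, hM⟩ := hK.exists_bound_of_continuousOn hcont
  refine ⟨M.toNNReal, ?_⟩
  rw [show r' = r + (r' - r) by ring, mu_add, restrict_withDensity hK.measurableSet]
  calc ((mu γ r).restrict K).withDensity (fun ζ => ENNReal.ofReal (‖ζ.1.1‖ ^ (r' - r)))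
      ≤ ((mu γ r).restrict K).withDensity fun _ => (M.toNNReal : ℝ≥0∞) := by
        refine withDensity_mono ?_
        filter_upwards [ae_restrict_mem hK.measurableSet] with ζ hζ
        exact ENNReal.ofReal_le_ofReal ((le_abs_self _).trans (hM ζ hζ))
    _ = (M.toNNReal : ℝ≥0∞) • (mu γ r).restrict K := withDensity_const _
    _ ≤ _ := by
        gcongr
        exact Measure.restrict_le_self

theorem hasBoundaryFunction_of_tendsto {f : hypersurface γ → ℂ} {g : hypersurface γ → ℂ}
    (hg : AEStronglyMeasurable g (mu γ r))
    (h : Tendsto (fun ε => eLpNorm (translate γ f ε - g) 2 (mu γ r)) (𝓝[>] 0) (𝓝 0)) :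
    HasBoundaryFunction γ (lerayIntegral γ f) g := by
  refine ⟨hg.mono_ac (mu_absolutelyContinuous γ _ _), fun K hK h0 => ?_⟩
  obtain ⟨c, hc⟩ := exists_restrict_le_smul γ r (γ - 1) hK h0
  have h2 : Tendsto (fun ε => (c : ℝ≥0∞) ^ (1 / (2 : ℝ≥0∞)).toReal •
      eLpNorm (translate γ f ε - g) 2 (mu γ r)) (𝓝[>] 0) (𝓝 0) := by
    have := ENNReal.Tendsto.const_mul (a := (c : ℝ≥0∞) ^ (1 / (2 : ℝ≥0∞)).toReal) h
      (Or.inr (ENNReal.rpow_ne_top_of_nonneg (by positivity) ENNReal.coe_ne_top))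
    simpa using this
  refine tendsto_of_tendsto_of_tendsto_of_le_of_le tendsto_const_nhds h2 (fun i => zero_le)
    fun ε => ?_
  rw [← eLpNorm_smul_measure_of_ne_top (by norm_num)]
  exact eLpNorm_mono_measure _ hc

theorem isLerayTransform_of_tendsto (hγ : 1 < γ) (hr : -1 < r) (hr' : r < 2 * γ - 1)
    {A : ℝ → Lp ℂ 2 (mu γ r) →L[ℂ] Lp ℂ 2 (mu γ r)}
    (hA : ∀ ε, 0 < ε → ∀ f : hypersurface γ → ℂ, ∀ hf : MemLp f 2 (mu γ r),
        A ε (hf.toLp f) =ᵐ[mu γ r] translate γ f ε)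
    {f g : Lp ℂ 2 (mu γ r)} (h : Tendsto (fun ε => A ε f) (𝓝[>] 0) (𝓝 g)) :
    IsLerayTransform γ f g := by
  refine ⟨fun z hz => integrable_mul_kernel hγ hr hr' (Lp.memLp f) hz,
    hasBoundaryFunction_of_tendsto (Lp.aestronglyMeasurable g) ?_⟩
  rw [Lp.tendsto_Lp_iff_tendsto_eLpNorm'] at h
  refine h.congr' ?_
  filter_upwards [self_mem_nhdsWithin] with ε hε
  have h2 := hA ε hε f (Lp.memLp f)
  rw [Lp.toLp_coeFn] at h2
  exact eLpNorm_congr_ae (h2.sub .rfl)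

end Limit

/-! ### Reproduction of exponentials and idempotence -/

theorem integrable_inv_sq_add_mul_I {D : ℂ} (hD : 0 < D.re) :
    Integrable fun s : ℝ => 1 / (D + s * Complex.I) ^ 2 := by
  have h := (integrable_inv_one_add_sq.comp_add_right D.im).const_mul (min 1 (D.re ^ 2))⁻¹
  have hm : 0 < min 1 (D.re ^ 2) := lt_min one_pos (by positivity)
  refine h.mono' (Measurable.aestronglyMeasurable (by fun_prop)) (.of_forall fun s => ?_)
  rw [norm_div, norm_one, norm_pow, Complex.sq_norm, Complex.normSq_apply, one_div]
  simp only [Complex.add_re, Complex.add_im, Complex.re_ofReal_mul, Complex.im_ofReal_mul,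
    Complex.I_re, Complex.I_im, mul_zero, mul_one, add_zero]
  rw [← mul_inv]
  refine inv_anti₀ (by positivity) ?_
  have h1 : min 1 (D.re ^ 2) ≤ D.re ^ 2 := min_le_right _ _
  have h2 : min 1 (D.re ^ 2) * (s + D.im) ^ 2 ≤ 1 * (s + D.im) ^ 2 := by
    gcongr
    exact min_le_left _ _
  nlinarith

open FourierTransform in
-- The function (D + is)⁻² is, up to 4π², the Fourier transform of x e^{-2πDx} on x > 0. Fourier
-- inversion applies at κ > 0, where this function is continuous.
theorem integral_exp_div_sq {κ : ℝ} (hκ : 0 < κ) {D : ℂ} (hD : 0 < D.re) :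
    ∫ s : ℝ, Complex.exp (2 * Real.pi * κ * s * Complex.I) * (1 / (D + s * Complex.I) ^ 2) =
      4 * Real.pi ^ 2 * κ * Complex.exp (-(2 * Real.pi * κ * D)) := by
  set h : ℝ → ℂ := (Set.Ioi (0 : ℝ)).indicator
    fun x => (x : ℂ) * Complex.exp (-(2 * Real.pi * D) * x) with hh
  have hre : 0 < (2 * Real.pi * D : ℂ).re := by
    have := Complex.re_ofReal_mul (2 * Real.pi) D
    push_cast at this
    rw [this]; positivity
  have hi : Integrable h := by
    rw [hh, integrable_indicator_iff measurableSet_Ioi]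
    have h1 := integrable_pow_mul_cexp_neg 1 hre
    simp only [pow_one] at h1
    exact h1
  have hF : 𝓕 h = fun s : ℝ => (1 / (4 * Real.pi ^ 2) : ℂ) * (1 / (D + s * Complex.I) ^ 2) := by
    ext s
    rw [Real.fourier_real_eq_integral_exp_smul]
    have h1 := integral_laplace (b := D + s * Complex.I) (by simpa using hD)
    have h2 : ∀ v : ℝ, Complex.exp (((-2 * Real.pi * v * s : ℝ) : ℂ) * Complex.I) • h v =
        (Set.Ioi (0 : ℝ)).indicator
          (fun x => (x : ℂ) * Complex.exp (-(2 * Real.pi * (D + s * Complex.I)) * x)) v := by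
      intro v
      by_cases hv : v ∈ Set.Ioi (0 : ℝ)
      · rw [hh, Set.indicator_of_mem hv, Set.indicator_of_mem hv, smul_eq_mul, mul_left_comm,
          ← Complex.exp_add]
        push_cast
        ring_nf
      · rw [hh, Set.indicator_of_notMem hv, Set.indicator_of_notMem hv, smul_zero]
    simp_rw [h2]
    rw [integral_indicator measurableSet_Ioi, h1, one_div_mul_one_div]
  have hFi : Integrable (𝓕 h) := by
    rw [hF]
    exact (integrable_inv_sq_add_mul_I hD).const_mul _
  have hc : ContinuousAt h κ := by
    have h1 : ContinuousAt (fun x : ℝ => (x : ℂ) * Complex.exp (-(2 * Real.pi * D) * x)) κ := by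
      fun_prop
    refine h1.congr ?_
    filter_upwards [lt_mem_nhds hκ] with x hx
    rw [hh, Set.indicator_of_mem (by exact hx)]
  have h1 := hi.fourierInv_fourier_eq hFi hc
  rw [Real.fourierInv_eq', hF, hh, Set.indicator_of_mem (by exact hκ)] at h1
  have hpi : (Real.pi : ℂ) ≠ 0 := by exact_mod_cast Real.pi_ne_zero
  have h2 : ∫ s : ℝ, Complex.exp (2 * Real.pi * κ * s * Complex.I) *
      (1 / (D + s * Complex.I) ^ 2) = (4 * Real.pi ^ 2 : ℂ) *
      ∫ v : ℝ, Complex.exp (((2 * Real.pi * inner ℝ v κ : ℝ) : ℂ) * Complex.I) •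
        ((1 / (4 * Real.pi ^ 2) : ℂ) * (1 / (D + v * Complex.I) ^ 2)) := by
    rw [← integral_const_mul]
    congr 1
    ext s
    simp only [smul_eq_mul, RCLike.inner_apply, conj_trivial]
    push_cast
    field_simp
  rw [h2, h1]
  ring_nf

/-- Term by term, the Gamma integral n!/c^(n+1) cancels one of the two factorials and leaves an
exponential series. -/
theorem integral_tsum_bessel {c : ℝ} (hc : 0 < c) (x : ℂ) :
    ∫ u : ℝ, (∑' n : ℕ, (x * u) ^ n / (n.factorial : ℂ) ^ 2) * Complex.exp (-c * u) ∂ray =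
      Complex.exp (x / c) / c := by
  set F : ℕ → ℝ → ℂ := fun n u =>
    x ^ n / (n.factorial : ℂ) ^ 2 * ((u : ℂ) ^ n * Complex.exp (-c * u))
  have hre : 0 < (c : ℂ).re := by simpa using hc
  have hFi : ∀ n, Integrable (F n) ray := fun n =>
    (integrable_pow_mul_cexp_neg n hre).const_mul _
  have hFn : ∀ n, ∫ u, ‖F n u‖ ∂ray = (‖x‖ / c) ^ n / n.factorial * c⁻¹ := by
    intro n
    have h1 := integral_pow_mul_cexp_neg n hre
    have h2 : ∫ u : ℝ, u ^ n * Real.exp (-c * u) ∂ray = n.factorial / c ^ (n + 1) := by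
      rw [← Complex.ofReal_inj, ← integral_complex_ofReal]
      push_cast
      exact h1
    have h3 : ∀ᵐ u ∂ray, ‖F n u‖ = ‖x‖ ^ n / (n.factorial : ℝ) ^ 2 *
        (u ^ n * Real.exp (-c * u)) := by
      filter_upwards [ae_restrict_mem measurableSet_Ioi] with u hu
      have hu0 : (0 : ℝ) < u := hu
      simp only [F, norm_mul, norm_div, norm_pow, Complex.norm_natCast, Complex.norm_exp]
      rw [Complex.norm_real, Real.norm_of_nonneg hu0.le]
      norm_num
    rw [integral_congr_ae h3, integral_const_mul, h2, div_pow]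
    have := n.factorial_ne_zero
    field_simp
    ring
  have hs : Summable fun n => ∫ u, ‖F n u‖ ∂ray := by
    simp_rw [hFn]
    exact (Real.summable_pow_div_factorial _).mul_right _
  have h := integral_tsum_of_summable_integral_norm hFi hs
  have e1 : ∀ u : ℝ, (∑' n : ℕ, (x * u) ^ n / (n.factorial : ℂ) ^ 2) * Complex.exp (-c * u) =
      ∑' n, F n u := by
    intro u
    rw [← tsum_mul_right]
    refine tsum_congr fun n => ?_
    simp only [F, mul_pow]
    ring
  simp_rw [e1]
  rw [← h]
  have e2 : ∀ n : ℕ, ∫ u, F n u ∂ray = (x / c) ^ n / n.factorial * (c : ℂ)⁻¹ := by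
    intro n
    simp only [F]
    rw [integral_const_mul, integral_pow_mul_cexp_neg n hre, div_pow]
    have := n.factorial_ne_zero
    have hc' : (c : ℂ) ≠ 0 := by exact_mod_cast hc.ne'
    field_simp
    ring
  simp_rw [e2]
  rw [tsum_mul_right, ← exp_eq_tsum_pow_div]
  rfl

theorem integral_coords_iterated {G : ℝ × ℝ × ℝ → ℂ} (hG : Integrable G coords) :
    ∫ p, G p ∂coords = ∫ α, ∫ θ, ∫ s, G (α, θ, s) ∂volume ∂angle ∂ray := by
  rw [integral_prod _ hG]
  refine integral_congr_ae ?_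
  filter_upwards [hG.prod_right_ae] with α hα
  exact integral_prod _ hα

theorem integrable_comp_polarPoint {γ r : ℝ} {F : hypersurface γ → ℂ}
    (hF : Integrable F (mu γ r)) :
    Integrable (fun p => ((p.1 ^ r : ℝ) : ℂ) * F (polarPoint γ p)) coords := by
  refine ⟨AEStronglyMeasurable.mul (Measurable.aestronglyMeasurable (by fun_prop))
    (aemeasurable_comp_polarPoint hF.1.aemeasurable).aestronglyMeasurable, ?_⟩
  have h := hF.2
  rw [hasFiniteIntegral_iff_enorm] at h ⊢
  rw [lintegral_mu hF.1.enorm] at h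
  refine lt_of_eq_of_lt (lintegral_congr_ae ?_) h
  filter_upwards [ae_coords_pos] with p hp
  rw [enorm_mul, ← ofReal_norm ((p.1 ^ r : ℝ) : ℂ), Complex.norm_real,
    Real.norm_of_nonneg (by positivity)]

/-- The Leray integral reproduces the functions `exp (2πκ(B ζ₁ + i ζ₂))`. -/
theorem integral_exp_mul_kernel {γ κ : ℝ} (hγ : 1 < γ) (hκ : 0 < κ) (B : ℂ) {z : ℂ × ℂ}
    (hz : z ∈ domain γ)
    (hi : Integrable (fun w : hypersurface γ =>
      Complex.exp (2 * Real.pi * κ * (B * w.1.1 + Complex.I * w.1.2)) * kernel γ z w.1)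
      (mu γ (γ - 1))) :
    ∫ w : hypersurface γ, Complex.exp (2 * Real.pi * κ * (B * w.1.1 + Complex.I * w.1.2)) *
      kernel γ z w.1 ∂(mu γ (γ - 1)) =
      Complex.exp (2 * Real.pi * κ * (B * z.1 + Complex.I * z.2)) := by
  rw [integral_mu hi.1, integral_coords_iterated (integrable_comp_polarPoint hi)]
  have hpi : (Real.pi : ℂ) ≠ 0 := by exact_mod_cast Real.pi_ne_zero
  have hs : ∀ α : ℝ, 0 < α → ∀ θ : ℝ, ∫ s : ℝ, ((α ^ (γ - 1) : ℝ) : ℂ) *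
      (Complex.exp (2 * Real.pi * κ * (B * (polarPoint γ (α, θ, s)).1.1 +
        Complex.I * (polarPoint γ (α, θ, s)).1.2)) * kernel γ z (polarPoint γ (α, θ, s)).1) =
      ((α ^ (γ - 1) : ℝ) : ℂ) * γ ^ 2 * κ * Complex.exp (2 * Real.pi * κ * Complex.I * z.2) *
        Complex.exp (-(2 * Real.pi * κ * γ) * (α ^ γ : ℝ)) *
        Complex.exp ((2 * Real.pi * κ * B * α) * Complex.exp (θ * Complex.I) +
          (2 * Real.pi * κ * γ * (α ^ (γ - 1) : ℝ) * z.1) * Complex.exp (-(θ * Complex.I))) := by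
    intro α hα θ
    set D : ℂ := (((γ - 1) * α ^ γ + z.2.im : ℝ) : ℂ) -
        ((γ * α ^ (γ - 1) : ℝ) : ℂ) * (Complex.exp (-(θ * Complex.I)) * z.1) -
        z.2.re * Complex.I with hD
    have hb : ∀ s : ℝ, bracket γ z (polarPoint γ (α, θ, s)).1 = D + s * Complex.I := by
      intro s
      rw [bracket_polarPoint z (by exact hα)]
      push_cast
      rw [hD]
      push_cast
      ring
    have hDre : 0 < D.re := by
      have h1 := bracket_re_pos hγ hz (p := (α, θ, 0)) hα
      rw [hb] at h1
      simpa using h1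
    have h1 : (polarPoint γ (α, θ, 0)).1.1 = α * Complex.exp (θ * Complex.I) := rfl
    have h2 : ∀ s : ℝ, (polarPoint γ (α, θ, s)).1.2 = s + (α ^ γ : ℝ) * Complex.I := by
      intro s
      apply Complex.ext
      · simp [polarPoint]
      · have := norm_polarPoint_fst γ (p := (α, θ, s)) hα.le
        have h3 : (polarPoint γ (α, θ, s)).1.2.im = ‖(polarPoint γ (α, θ, s)).1.1‖ ^ γ := rfl
        rw [h3, this]
        simp
    have h3 : ∀ s : ℝ, ((α ^ (γ - 1) : ℝ) : ℂ) *
        (Complex.exp (2 * Real.pi * κ * (B * (polarPoint γ (α, θ, s)).1.1 +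
          Complex.I * (polarPoint γ (α, θ, s)).1.2)) * kernel γ z (polarPoint γ (α, θ, s)).1) =
        (((α ^ (γ - 1) : ℝ) : ℂ) * (γ ^ 2 / (4 * Real.pi ^ 2)) *
          Complex.exp (2 * Real.pi * κ * (B * (α * Complex.exp (θ * Complex.I)) - (α ^ γ : ℝ)))) *
        (Complex.exp (2 * Real.pi * κ * s * Complex.I) * (1 / (D + s * Complex.I) ^ 2)) := by
      intro s
      rw [kernel_eq, hb, h2, show (polarPoint γ (α, θ, s)).1.1 = α * Complex.exp (θ * Complex.I)
        from rfl]
      have e : Complex.exp (2 * Real.pi * κ * (B * (α * Complex.exp (θ * Complex.I)) +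
          Complex.I * (s + (α ^ γ : ℝ) * Complex.I))) =
          Complex.exp (2 * Real.pi * κ * (B * (α * Complex.exp (θ * Complex.I)) - (α ^ γ : ℝ))) *
          Complex.exp (2 * Real.pi * κ * s * Complex.I) := by
        rw [← Complex.exp_add]
        congr 1
        linear_combination (2 * Real.pi * κ * (α ^ γ : ℝ)) * Complex.I_mul_I
      rw [e]
      push_cast
      ring
    simp_rw [h3]
    rw [integral_const_mul, integral_exp_div_sq hκ hDre]
    have e : Complex.exp (2 * Real.pi * κ * Complex.I * z.2) *
        Complex.exp (-(2 * Real.pi * κ * γ) * (α ^ γ : ℝ)) *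
        Complex.exp ((2 * Real.pi * κ * B * α) * Complex.exp (θ * Complex.I) +
          (2 * Real.pi * κ * γ * (α ^ (γ - 1) : ℝ) * z.1) * Complex.exp (-(θ * Complex.I))) =
        Complex.exp (2 * Real.pi * κ * (B * (α * Complex.exp (θ * Complex.I)) - (α ^ γ : ℝ))) *
        Complex.exp (-(2 * Real.pi * κ * D)) := by
      rw [← Complex.exp_add, ← Complex.exp_add, ← Complex.exp_add]
      congr 1
      have hz2 : z.2 = z.2.re + z.2.im * Complex.I := (Complex.re_add_im _).symm
      rw [hD]
      push_cast
      linear_combination (2 * Real.pi * κ * Complex.I) * hz2 +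
        (2 * Real.pi * κ * z.2.im) * Complex.I_mul_I
    linear_combination (norm := skip) (-((α ^ (γ - 1) : ℝ) : ℂ) * γ ^ 2 * κ) * e
    field_simp
    ring
  -- The angular mean depends on α only through α^γ, since the two coefficients multiply to a
  -- constant times α^(γ-1) · α. The right side is arranged for the substitution u = α^γ, whose
  -- Jacobian is |γ| α^(γ-1).
  have hθ : ∀ α : ℝ, 0 < α → ∫ θ : ℝ, ∫ s : ℝ, ((α ^ (γ - 1) : ℝ) : ℂ) *
      (Complex.exp (2 * Real.pi * κ * (B * (polarPoint γ (α, θ, s)).1.1 +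
        Complex.I * (polarPoint γ (α, θ, s)).1.2)) * kernel γ z (polarPoint γ (α, θ, s)).1)
        ∂volume ∂angle = (2 * Real.pi * γ * κ * Complex.exp (2 * Real.pi * κ * Complex.I * z.2)) *
      ((|γ| * α ^ (γ - 1)) •
        ((fun u : ℝ => (∑' n : ℕ, ((2 * Real.pi * κ) ^ 2 * γ * B * z.1 * u) ^ n /
          (n.factorial : ℂ) ^ 2) * Complex.exp (-(2 * Real.pi * κ * γ : ℝ) * u)) (α ^ γ))) := by
    intro α hα
    simp_rw [hs α hα]
    rw [integral_const_mul, integral_angle_exp_add]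
    have e : (2 * Real.pi * κ * B * α) * (2 * Real.pi * κ * γ * (α ^ (γ - 1) : ℝ) * z.1) =
        (2 * Real.pi * κ) ^ 2 * γ * B * z.1 * (α ^ γ : ℝ) := by
      have h1 : α ^ γ = α ^ (γ - 1) * α := by
        rw [← Real.rpow_add_one hα.ne']
        ring_nf
      rw [h1]
      push_cast
      ring
    rw [e, abs_of_pos (by linarith), Complex.real_smul]
    push_cast
    ring
  rw [setIntegral_congr_fun measurableSet_Ioi fun α hα => hθ α hα, integral_const_mul,
    integral_comp_rpow_Ioi (fun u : ℝ => (∑' n : ℕ, ((2 * Real.pi * κ) ^ 2 * γ * B * z.1 * u) ^ n /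
      (n.factorial : ℂ) ^ 2) * Complex.exp (-(2 * Real.pi * κ * γ : ℝ) * u))
      (by linarith : γ ≠ 0)]
  have hc : 0 < 2 * Real.pi * κ * γ := by positivity
  have hfin := integral_tsum_bessel hc ((2 * Real.pi * κ) ^ 2 * γ * B * z.1)
  rw [hfin]
  have hγ0 : (γ : ℂ) ≠ 0 := by exact_mod_cast (by linarith : γ ≠ 0)
  have hκ0 : (κ : ℂ) ≠ 0 := by exact_mod_cast hκ.ne'
  have e1 : (2 * Real.pi * κ) ^ 2 * γ * B * z.1 / ((2 * Real.pi * κ * γ : ℝ) : ℂ) =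
      2 * Real.pi * κ * (B * z.1) := by
    push_cast
    field_simp
  rw [e1, mul_add, Complex.exp_add]
  push_cast
  field_simp

theorem exists_polarPoint_eq {γ : ℝ} {ζ : hypersurface γ} (h : ζ.1.1 ≠ 0) :
    ∃ p : ℝ × ℝ × ℝ, 0 < p.1 ∧ polarPoint γ p = ζ := by
  refine ⟨(‖ζ.1.1‖, ζ.1.1.arg, ζ.1.2.re), norm_pos_iff.2 h, Subtype.ext (Prod.ext ?_ ?_)⟩
  · exact Complex.norm_mul_exp_arg_mul_I _
  · refine Complex.ext rfl ?_
    have h2 : ζ.1.2.im = ‖ζ.1.1‖ ^ γ := ζ.2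
    simp only [polarPoint, Complex.norm_mul_exp_arg_mul_I]
    exact h2.symm

theorem exists_le_bracket_lift_re {γ ε N : ℝ} (hγ : 1 < γ) (hε : 0 < ε) :
    ∃ c : ℝ, 0 < c ∧ ∀ ζ w : hypersurface γ, ζ.1.1 ≠ 0 → ‖ζ.1.1‖ ≤ N →
      c * (1 + ‖w.1.1‖ ^ γ) ≤ (bracket γ (lift γ ε w) ζ.1).re := by
  obtain ⟨c, hc, h⟩ := exists_coercive_of_le (N := N) hγ hε
  refine ⟨c, hc, fun ζ w hζ hN => ?_⟩
  obtain ⟨p, hp, rfl⟩ := exists_polarPoint_eq hζ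
  rw [norm_polarPoint_fst γ hp.le] at hN
  have h1 := h p.1 ‖w.1.1‖ hp.le hN (norm_nonneg _)
  have h2 := le_bracket_re hγ (lift γ ε w) hp
  have h3 : (lift γ ε w).2.im = ‖w.1.1‖ ^ γ + ε := by
    have : w.1.2.im = ‖w.1.1‖ ^ γ := w.2
    simp [lift, this]
  rw [h3] at h2
  exact h1.trans h2

theorem measurable_bracket (γ : ℝ) :
    Measurable fun q : (ℂ × ℂ) × (ℂ × ℂ) => bracket γ q.1 q.2 := by
  unfold bracket
  fun_prop

theorem integrable_weighted_kernel {γ : ℝ} (hγ : 1 < γ) {z : ℂ × ℂ} (hz : z ∈ domain γ) :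
    Integrable (fun w : hypersurface γ => ((1 + ‖w.1.1‖ ^ γ) ^ 2)⁻¹ * ‖kernel γ z w.1‖)
      (mu γ (γ - 1)) := by
  have hm : Measurable fun w : hypersurface γ => ((1 + ‖w.1.1‖ ^ γ) ^ 2)⁻¹ * ‖kernel γ z w.1‖ := by
    have h1 : Measurable fun w : hypersurface γ => ‖w.1.1‖ :=
      (measurable_fst.comp measurable_subtype_coe).norm
    exact (((h1.pow_const γ).const_add 1).pow_const 2).inv.mul (measurable_kernel_right γ z).norm
  refine ⟨hm.aestronglyMeasurable, ?_⟩
  rw [hasFiniteIntegral_iff_enorm]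
  refine lt_of_eq_of_lt (lintegral_congr fun w => ?_) (lintegral_weighted_kernel_lt_top hγ hz)
  rw [enorm_mul, enorm_norm, Real.enorm_of_nonneg (by positivity)]

theorem norm_inv_sq_le {c x : ℝ} {b : ℂ} (hc : 0 < c) (hx : 0 < x) (h : c * x ≤ b.re) :
    ‖b‖⁻¹ ^ 2 ≤ (c ^ 2)⁻¹ * (x ^ 2)⁻¹ := by
  have h1 : c * x ≤ ‖b‖ := h.trans ((le_abs_self _).trans (Complex.abs_re_le_norm b))
  rw [← mul_inv, ← mul_pow, ← inv_pow]
  gcongr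

/-- The Leray integral of the kernel of `L (·, · + iε)` is the kernel of its translate. -/
theorem integral_kernel_mul_kernel {γ ε : ℝ} (hγ : 1 < γ) (hε : 0 < ε) {z : ℂ × ℂ}
    (hz : z ∈ domain γ) {ζ : hypersurface γ} (hζ : ζ.1.1 ≠ 0) :
    ∫ w : hypersurface γ, kernel γ (lift γ ε w) ζ.1 * kernel γ z w.1 ∂(mu γ (γ - 1)) =
      kernel γ (z.1, z.2 + ε * Complex.I) ζ.1 := by
  obtain ⟨c, hc, hcb⟩ := exists_le_bracket_lift_re (N := ‖ζ.1.1‖) hγ hε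
  have hb : ∀ w : hypersurface γ, c * (1 + ‖w.1.1‖ ^ γ) ≤ (bracket γ (lift γ ε w) ζ.1).re :=
    fun w => hcb ζ w hζ le_rfl
  have hb0 : ∀ w : hypersurface γ, 0 < (bracket γ (lift γ ε w) ζ.1).re :=
    fun w => lt_of_lt_of_le (by positivity) (hb w)
  have hbm : Measurable fun w : hypersurface γ => bracket γ (lift γ ε w) ζ.1 :=
    (measurable_bracket γ).comp (f := fun w => (lift γ ε w, ζ.1))
      ((measurable_lift γ ε).prodMk measurable_const)
  -- Only the first kernel is expanded by Laplace. Its bracket has real part at least c (1 + |w₁|^γ)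
  -- thanks to the lift, so the κ-integral yields the weight that makes the second kernel
  -- integrable.
  set G : hypersurface γ → ℝ → ℂ := fun w κ =>
    (κ : ℂ) * Complex.exp (-(2 * Real.pi * bracket γ (lift γ ε w) ζ.1) * κ) * kernel γ z w.1 with hG
  have hGm : Measurable (Function.uncurry G) := by
    have h1 : Measurable fun q : hypersurface γ × ℝ => bracket γ (lift γ ε q.1) ζ.1 :=
      hbm.comp measurable_fst
    have h2 : Measurable fun q : hypersurface γ × ℝ => kernel γ z q.1.1 :=
      (measurable_kernel_right γ z).comp measurable_fst
    refine Measurable.mul (Measurable.mul (by fun_prop) ?_) h2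
    exact Complex.measurable_exp.comp (((h1.const_mul _).neg).mul (by fun_prop))
  have hGi : Integrable (Function.uncurry G) ((mu γ (γ - 1)).prod ray) := by
    refine ⟨hGm.aestronglyMeasurable, ?_⟩
    rw [hasFiniteIntegral_iff_enorm, lintegral_prod _ hGm.enorm.aemeasurable]
    have hfin := (integrable_weighted_kernel hγ hz).const_mul
      (1 / (4 * Real.pi ^ 2) * (c ^ 2)⁻¹)
    refine lt_of_le_of_lt (lintegral_mono fun w => ?_) hfin.lintegral_lt_top
    have h1 : ∫⁻ κ, ‖Function.uncurry G (w, κ)‖ₑ ∂ray =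
        (∫⁻ κ : ℝ, ENNReal.ofReal
          (κ * Real.exp (-(2 * Real.pi * (bracket γ (lift γ ε w) ζ.1).re) * κ)) ∂ray) *
          ‖kernel γ z w.1‖ₑ := by
      rw [← lintegral_mul_const _ (by fun_prop)]
      refine setLIntegral_congr_fun measurableSet_Ioi fun κ (hκ : 0 < κ) => ?_
      simp only [Function.uncurry, hG]
      rw [enorm_mul, ← ofReal_norm (_ * Complex.exp _), norm_mul, Complex.norm_real,
        Real.norm_of_nonneg hκ.le, Complex.norm_exp]
      congr 5
      rw [Complex.re_mul_ofReal, Complex.neg_re]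
      have := Complex.re_ofReal_mul (2 * Real.pi) (bracket γ (lift γ ε w) ζ.1)
      push_cast at this
      rw [this]
    rw [h1, lintegral_laplace (hb0 w), ← ofReal_norm, ← ENNReal.ofReal_mul (by positivity)]
    refine ENNReal.ofReal_le_ofReal ?_
    have h2 := norm_inv_sq_le (b := ((bracket γ (lift γ ε w) ζ.1).re : ℂ)) hc
      (show 0 < 1 + ‖w.1.1‖ ^ γ by positivity) (by simpa using hb w)
    rw [Complex.norm_real, Real.norm_of_nonneg (hb0 w).le, inv_pow, ← one_div] at h2
    rw [← one_div_mul_one_div]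
    calc 1 / (4 * Real.pi ^ 2) * (1 / (bracket γ (lift γ ε w) ζ.1).re ^ 2) * ‖kernel γ z w.1‖
        ≤ 1 / (4 * Real.pi ^ 2) * ((c ^ 2)⁻¹ * ((1 + ‖w.1.1‖ ^ γ) ^ 2)⁻¹) * ‖kernel γ z w.1‖ := by
          gcongr
      _ = _ := by ring
  have hk : ∀ w : hypersurface γ, kernel γ (lift γ ε w) ζ.1 * kernel γ z w.1 =
      γ ^ 2 * ∫ κ, G w κ ∂ray := by
    intro w
    rw [integral_mul_const, integral_laplace (hb0 w), kernel_eq]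
    push_cast
    ring
  have hz' : (z.1, z.2 + ε * Complex.I) ∈ domain γ := by
    have h : ‖z.1‖ ^ γ < z.2.im := hz
    simp only [domain, Set.mem_ofPred_eq, Complex.add_im, Complex.im_ofReal_mul, Complex.I_im]
    linarith
  have hb' : 0 < (bracket γ (z.1, z.2 + ε * Complex.I) ζ.1).re := by
    obtain ⟨p, hp, rfl⟩ := exists_polarPoint_eq hζ
    exact bracket_re_pos hγ hz' hp
  simp_rw [hk]
  rw [integral_const_mul, integral_integral_swap hGi]
  have hinner : ∀ᵐ κ ∂ray, ∫ w, G w κ ∂(mu γ (γ - 1)) = (κ : ℂ) *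
      Complex.exp (-(2 * Real.pi * bracket γ (z.1, z.2 + ε * Complex.I) ζ.1) * κ) := by
    filter_upwards [hGi.prod_left_ae, ae_restrict_mem measurableSet_Ioi] with κ hκi hκ
    have hκ0 : (0 : ℝ) < κ := hκ
    -- At fixed κ the dependence on w is a nonzero constant E times exp(2πκ(B w₁ + i w₂)), exactly
    -- the functions that the Leray integral reproduces.
    set B : ℂ := γ * (starRingEnd ℂ) ζ.1.1 * ((‖ζ.1.1‖ ^ (γ - 2) : ℝ) : ℂ) with hB
    set E : ℂ := (κ : ℂ) * Complex.exp (-(2 * Real.pi * (B * ζ.1.1 + Complex.I * ζ.1.2 + ε)) * κ)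
      with hE
    have hE0 : E ≠ 0 := mul_ne_zero (by exact_mod_cast hκ0.ne') (Complex.exp_ne_zero _)
    have e : ∀ u : ℂ × ℂ, (κ : ℂ) *
        Complex.exp (-(2 * Real.pi * bracket γ (u.1, u.2 + ε * Complex.I) ζ.1) * κ) =
        E * Complex.exp (2 * Real.pi * κ * (B * u.1 + Complex.I * u.2)) := by
      intro u
      rw [hE, mul_assoc (κ : ℂ) (Complex.exp _), ← Complex.exp_add, bracket]
      congr 2
      linear_combination (2 * Real.pi * κ * ε) * Complex.I_mul_I
    have e2 : ∀ w : hypersurface γ, G w κ =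
        E * (Complex.exp (2 * Real.pi * κ * (B * w.1.1 + Complex.I * w.1.2)) * kernel γ z w.1) := by
      intro w
      rw [← mul_assoc, ← e w.1]
      rfl
    rw [e z]
    simp_rw [e2]
    rw [integral_const_mul, integral_exp_mul_kernel hγ hκ0 B hz]
    -- The exponential times the kernel inherits integrability from the Fubini section, after
    -- division by E.
    have h3 : Integrable (fun w => G w κ) (mu γ (γ - 1)) := hκi
    simp_rw [e2] at h3
    exact (integrable_const_mul_iff (isUnit_iff_ne_zero.2 hE0) _).1 h3
  rw [integral_congr_ae hinner, integral_laplace hb', kernel_eq]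
  push_cast
  ring

/-- Translating `L f` upwards and applying the Leray integral again translates `L f`. -/
theorem BoundedSupport.lerayIntegral_translate {γ N ε : ℝ} {f : hypersurface γ → ℂ}
    (hf : BoundedSupport γ N f) (hγ : 1 < γ) (hε : 0 < ε) {z : ℂ × ℂ} (hz : z ∈ domain γ) :
    lerayIntegral γ (translate γ f ε) z = lerayIntegral γ f (z.1, z.2 + ε * Complex.I) := by
  obtain ⟨c, hc, hcb⟩ := exists_le_bracket_lift_re (N := N) hγ hε
  set H : hypersurface γ → hypersurface γ → ℂ := fun w ζ =>
    f ζ * (kernel γ (lift γ ε w) ζ.1 * kernel γ z w.1) with hH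
  have hHm : Measurable (Function.uncurry H) := by
    refine (hf.measurable.comp measurable_snd).mul (Measurable.mul ?_ ?_)
    · exact measurable_kernel_comp γ ((measurable_lift γ ε).comp measurable_fst)
        (measurable_subtype_coe.comp measurable_snd)
    · exact (measurable_kernel_right γ z).comp measurable_fst
  have hHi : Integrable (Function.uncurry H) ((mu γ (γ - 1)).prod (mu γ (γ - 1))) := by
    -- On the support of f the first kernel is O((1 + |w₁|^γ)⁻²) uniformly in ζ, so the double
    -- integral is dominated by a product.
    have hdom := ((integrable_weighted_kernel hγ hz).mul_prod (hf.integrable_mu hγ).norm).const_mul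
      (γ ^ 2 / (4 * Real.pi ^ 2) * (c ^ 2)⁻¹)
    refine hdom.mono' hHm.aestronglyMeasurable ?_
    have hae := (Measure.quasiMeasurePreserving_snd (μ := mu γ (γ - 1))
      (ν := mu γ (γ - 1))).ae (ae_mu_norm_pos γ (γ - 1))
    filter_upwards [hae] with q hq
    simp only [Function.uncurry, hH]
    by_cases hN : ‖q.2.1.1‖ ≤ N
    · have h1 := norm_inv_sq_le hc (show 0 < 1 + ‖q.1.1.1‖ ^ γ by positivity)
        (hcb q.2 q.1 (norm_pos_iff.1 hq) hN)
      rw [norm_mul, norm_mul, kernel_eq γ (lift γ ε q.1), norm_div, norm_pow, Complex.norm_real,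
        Real.norm_of_nonneg (by positivity), div_eq_mul_inv _ (‖_‖ ^ 2), ← inv_pow]
      calc ‖f q.2‖ * (γ ^ 2 / (4 * Real.pi ^ 2) * ‖bracket γ (lift γ ε q.1) q.2.1‖⁻¹ ^ 2 *
            ‖kernel γ z q.1.1‖)
          ≤ ‖f q.2‖ * (γ ^ 2 / (4 * Real.pi ^ 2) * ((c ^ 2)⁻¹ * ((1 + ‖q.1.1.1‖ ^ γ) ^ 2)⁻¹) *
            ‖kernel γ z q.1.1‖) := by gcongr
        _ = _ := by ring
    · rw [hf.eq_zero_of_norm _ (not_le.1 hN)]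
      simp
  have h1 : lerayIntegral γ (translate γ f ε) z =
      ∫ w, ∫ ζ, H w ζ ∂(mu γ (γ - 1)) ∂(mu γ (γ - 1)) := by
    refine integral_congr_ae (.of_forall fun w => ?_)
    simp only [hH, translate, lerayIntegral]
    rw [← integral_mul_const]
    simp_rw [mul_assoc]
  rw [h1, integral_integral_swap hHi]
  refine integral_congr_ae ?_
  filter_upwards [ae_mu_norm_pos γ (γ - 1)] with ζ hζ
  simp only [hH]
  rw [integral_const_mul, integral_kernel_mul_kernel hγ hε hz (norm_pos_iff.1 hζ)]

theorem BoundedSupport.translate_translate {γ N ε : ℝ} {f : hypersurface γ → ℂ}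
    (hf : BoundedSupport γ N f) (hγ : 1 < γ) (hε : 0 < ε) :
    translate γ (translate γ f ε) ε = translate γ f (2 * ε) := by
  ext ζ
  rw [translate, hf.lerayIntegral_translate hγ hε (lift_mem_domain hε ζ), translate]
  congr 1
  simp only [lift, Prod.mk.injEq, true_and]
  push_cast
  ring

/-- On functions of bounded support A ε (A ε u) = A (2ε) u. As ε → 0 the left side tends to T (T u)
and the right side to T u; truncations are dense, so T T = T. -/
theorem lerayBoundedProjection_of_mem {γ r : ℝ} (hγ : 1 < γ) (hr : -1 < r)
    (hr' : r < 2 * γ - 1) : LerayBoundedProjection γ r := by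
  obtain ⟨C, A, T, hA, hC, hT⟩ := exists_leray_limit hγ hr hr'
  refine ⟨T, fun f => isLerayTransform_of_tendsto hγ hr hr' hA (hT f), ?_⟩
  have hdense : ∀ f : hypersurface γ → ℂ, ∀ N : ℝ, BoundedSupport γ N f →
      ∀ hf : MemLp f 2 (mu γ r), T (T (hf.toLp f)) = T (hf.toLp f) := by
    intro f N hN hf
    set u := hf.toLp f
    have h1 : ∀ ε, 0 < ε → A ε (A ε u) = A (2 * ε) u := by
      intro ε hε
      have h2 : A ε u =ᵐ[mu γ r] translate γ f ε := hA ε hε f hf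
      have h3 := hA ε hε (A ε u) (Lp.memLp _)
      rw [Lp.toLp_coeFn] at h3
      refine Lp.ext ((h3.trans ?_).trans (hA (2 * ε) (by positivity) f hf).symm)
      rw [← hN.translate_translate hγ hε]
      refine .of_forall fun ζ => ?_
      exact congrFun (lerayIntegral_congr h2) _
    have h2 : Tendsto (fun ε : ℝ => A (2 * ε) u) (𝓝[>] 0) (𝓝 (T u)) := by
      refine (hT u).comp (tendsto_nhdsWithin_iff.2 ⟨?_, ?_⟩)
      · have : Tendsto (fun ε : ℝ => 2 * ε) (𝓝 0) (𝓝 (2 * 0)) := tendsto_id.const_mul 2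
        rw [mul_zero] at this
        exact this.mono_left nhdsWithin_le_nhds
      · filter_upwards [self_mem_nhdsWithin] with ε hε
        have : (0 : ℝ) < ε := hε
        exact mul_pos two_pos this
    -- Split A ε (A ε u) = A ε (A ε u - T u) + A ε (T u); the uniform bound on A ε kills the first
    -- term.
    have h3 : Tendsto (fun ε : ℝ => A ε (A ε u)) (𝓝[>] 0) (𝓝 (T (T u))) := by
      have h4 : Tendsto (fun ε : ℝ => A ε (A ε u - T u)) (𝓝[>] 0) (𝓝 0) := by
        have h5 : Tendsto (fun ε : ℝ => C * ‖A ε u - T u‖) (𝓝[>] 0) (𝓝 0) := by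
          have := (tendsto_iff_norm_sub_tendsto_zero.1 (hT u)).const_mul (C : ℝ)
          rwa [mul_zero] at this
        exact squeeze_zero_norm (fun ε => hC ε _) h5
      have h6 := h4.add (hT (T u))
      simpa using h6
    refine tendsto_nhds_unique h3 (h2.congr' ?_)
    filter_upwards [self_mem_nhdsWithin] with ε hε
    exact (h1 ε hε).symm
  ext1 f
  have hfm : Measurable f := (Lp.stronglyMeasurable f).measurable
  have hn : ∀ n : ℕ, MemLp (truncate γ f n) 2 (mu γ r) :=
    fun n => memLp_truncate hfm (Lp.memLp f) n.cast_nonneg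
  have hu : Tendsto (fun n => (hn n).toLp _) atTop (𝓝 f) := by
    have h := (Lp.tendsto_Lp_iff_tendsto_eLpNorm'' _ hn f (Lp.memLp f)).2
      (tendsto_truncate hfm (Lp.memLp f))
    rwa [Lp.toLp_coeFn] at h
  refine tendsto_nhds_unique (((T.comp T).continuous.tendsto f).comp hu) ?_
  refine ((T.continuous.tendsto f).comp hu).congr fun n => ?_
  exact (hdense _ _ (boundedSupport_truncate hfm n.cast_nonneg) (hn n)).symm

/-! ### Uniqueness of boundary functions -/

theorem isClosed_hypersurface {γ : ℝ} (hγ : 0 < γ) : IsClosed (hypersurface γ) := by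
  refine isClosed_eq (by fun_prop) ?_
  exact (continuous_norm.comp continuous_fst).rpow_const fun _ => Or.inr hγ.le

/-- An exhaustion of `M_γ \ {ζ₁ = 0}` by compact sets. -/
theorem exists_compact_exhaustion {γ : ℝ} (hγ : 0 < γ) :
    ∃ K : ℕ → Set (hypersurface γ), (∀ n, IsCompact (K n) ∧ ∀ z ∈ K n, z.1.1 ≠ 0) ∧
      ∀ z : hypersurface γ, z.1.1 ≠ 0 → ∃ n, z ∈ K n := by
  refine ⟨fun n => (Subtype.val : hypersurface γ → ℂ × ℂ) ⁻¹'
    (Metric.closedBall (0 : ℂ × ℂ) n ∩ {z | ((n : ℝ) + 1)⁻¹ ≤ ‖z.1‖}), fun n => ⟨?_, ?_⟩, ?_⟩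
  · refine (isClosed_hypersurface hγ).isClosedEmbedding_subtypeVal.isCompact_preimage ?_
    refine (isCompact_closedBall _ _).inter_right (isClosed_le continuous_const ?_)
    exact continuous_norm.comp continuous_fst
  · intro z hz
    have h : ((n : ℝ) + 1)⁻¹ ≤ ‖z.1.1‖ := hz.2
    exact norm_pos_iff.1 (lt_of_lt_of_le (by positivity) h)
  · intro z hz
    have h0 := norm_pos_iff.2 hz
    obtain ⟨n, hn⟩ := exists_nat_ge (max ‖z.1‖ ‖z.1.1‖⁻¹)
    refine ⟨n, ?_, ?_⟩
    · rw [mem_closedBall_zero_iff]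
      exact (le_max_left _ _).trans hn
    · have h1 := (le_max_right _ _).trans hn
      exact inv_le_of_inv_le₀ h0 (by linarith)

/-- Two L² limits of the same family agree on each compact set of the exhaustion, and the uncovered
set ζ₁ = 0 is null. -/
theorem HasBoundaryFunction.ae_eq {γ r : ℝ} (hγ : 0 < γ) {f g h : hypersurface γ → ℂ}
    (hf : AEStronglyMeasurable f (mu γ r))
    (hg : HasBoundaryFunction γ (lerayIntegral γ f) g)
    (hh : HasBoundaryFunction γ (lerayIntegral γ f) h) : g =ᵐ[mu γ r] h := by
  refine (mu_absolutelyContinuous γ r (γ - 1)).ae_eq ?_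
  obtain ⟨K, hK, hcover⟩ := exists_compact_exhaustion hγ
  have hfm : AEStronglyMeasurable f (mu γ (γ - 1)) := hf.mono_ac (mu_absolutelyContinuous γ _ _)
  have h1 : ∀ n, g =ᵐ[(mu γ (γ - 1)).restrict (K n)] h := by
    intro n
    have t1 := (hg.2 (K n) (hK n).1 (hK n).2).add (hh.2 (K n) (hK n).1 (hK n).2)
    rw [add_zero] at t1
    have hm : ∀ ε, AEStronglyMeasurable (translate γ f ε) ((mu γ (γ - 1)).restrict (K n)) :=
      fun ε => (aestronglyMeasurable_translate hfm ε).mono_measure Measure.restrict_le_self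
    have hgm : AEStronglyMeasurable g ((mu γ (γ - 1)).restrict (K n)) :=
      hg.1.mono_measure Measure.restrict_le_self
    have hhm : AEStronglyMeasurable h ((mu γ (γ - 1)).restrict (K n)) :=
      hh.1.mono_measure Measure.restrict_le_self
    have h2 : eLpNorm (h - g) 2 ((mu γ (γ - 1)).restrict (K n)) ≤ 0 := by
      refine ge_of_tendsto' t1 fun ε => ?_
      have := eLpNorm_sub_le ((hm ε).sub hgm) ((hm ε).sub hhm) (p := 2) (by norm_num)
      rwa [sub_sub_sub_cancel_left] at this
    have h3 := (eLpNorm_eq_zero_iff (hhm.sub hgm) (by norm_num)).1 (le_antisymm h2 zero_le)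
    filter_upwards [h3] with ζ hζ
    exact (sub_eq_zero.1 hζ).symm
  have h2 : ∀ᵐ ζ ∂(mu γ (γ - 1)), ∀ n, ζ ∈ K n → g ζ = h ζ :=
    ae_all_iff.2 fun n => (ae_restrict_iff' (hK n).1.measurableSet).1 (h1 n)
  filter_upwards [h2, ae_mu_norm_pos γ (γ - 1)] with ζ hζ h0
  obtain ⟨n, hn⟩ := hcover ζ (norm_pos_iff.1 h0)
  exact hζ n hn

/-- By uniqueness every Leray transform of f agrees almost everywhere with T f, so the operator norm
of T serves as the constant. -/
theorem LerayBoundedProjection.lerayBounded {γ r : ℝ} (hγ : 0 < γ)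
    (h : LerayBoundedProjection γ r) : LerayBounded γ r := by
  obtain ⟨T, hT, -⟩ := h
  refine ⟨‖T‖₊, fun f g hf hg => ?_⟩
  have h1 : HasBoundaryFunction γ (lerayIntegral γ f) (T (hf.toLp f)) := by
    have := (hT (hf.toLp f)).2
    rwa [lerayIntegral_congr hf.coeFn_toLp] at this
  rw [eLpNorm_congr_ae (hg.2.ae_eq hγ hf.1 h1), ← Lp.enorm_def, ← Lp.enorm_toLp hf]
  have := T.le_opNNNorm (hf.toLp f)
  simp only [enorm]
  exact_mod_cast this

/-! ### Explicit transforms of radial test functions -/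

/-- Laplace for (1 - is)⁻² leaves the s-integral of `integral_exp_div_sq`, and a final Gamma
integral of κ² gives the cube. -/
theorem integral_inv_sq_mul_inv_sq {D : ℂ} (hD : 0 < D.re) :
    ∫ s : ℝ, 1 / (1 - s * Complex.I) ^ 2 * (1 / (D + s * Complex.I) ^ 2) =
      4 * Real.pi / (1 + D) ^ 3 := by
  have hpi : (Real.pi : ℂ) ≠ 0 := by exact_mod_cast Real.pi_ne_zero
  set F : ℝ → ℝ → ℂ := fun s κ => Complex.exp (2 * Real.pi * κ * s * Complex.I) *
    (1 / (D + s * Complex.I) ^ 2 * (κ * Complex.exp (-(2 * Real.pi : ℝ) * κ)))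
  have hκi : Integrable (fun κ : ℝ => (κ : ℂ) * Complex.exp (-(2 * Real.pi : ℝ) * κ)) ray := by
    have := integrable_pow_mul_cexp_neg 1 (c := ((2 * Real.pi : ℝ) : ℂ))
      (by rw [Complex.ofReal_re]; positivity)
    simp only [pow_one] at this
    exact this
  have hFi : Integrable (Function.uncurry F) ((volume : Measure ℝ).prod ray) := by
    refine ((integrable_inv_sq_add_mul_I hD).mul_prod hκi).bdd_mul (c := 1)
      (f := fun q : ℝ × ℝ => Complex.exp (2 * Real.pi * q.2 * q.1 * Complex.I))
      (Continuous.aestronglyMeasurable (by fun_prop)) (.of_forall fun q => ?_)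
    have := Complex.norm_exp_ofReal_mul_I (2 * Real.pi * q.2 * q.1)
    push_cast at this
    exact this.le
  have h1 : ∀ s : ℝ, 1 / (1 - s * Complex.I) ^ 2 * (1 / (D + s * Complex.I) ^ 2) =
      4 * Real.pi ^ 2 * ∫ κ, F s κ ∂ray := by
    intro s
    have h2 := integral_laplace (b := 1 - s * Complex.I) (by simp)
    have h3 : ∀ κ : ℝ, F s κ = 1 / (D + s * Complex.I) ^ 2 *
        (κ * Complex.exp (-(2 * Real.pi * (1 - s * Complex.I)) * κ)) := by
      intro κ
      have e : Complex.exp (-(2 * Real.pi * (1 - s * Complex.I)) * κ) =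
          Complex.exp (2 * Real.pi * κ * s * Complex.I) *
            Complex.exp (-(2 * Real.pi : ℝ) * κ) := by
        rw [← Complex.exp_add]
        congr 1
        push_cast
        ring
      simp only [F]
      rw [e]
      ring
    simp_rw [h3]
    rw [integral_const_mul, h2]
    field_simp
  simp_rw [h1]
  rw [integral_const_mul, integral_integral_swap hFi]
  have h4 : ∀ κ ∈ Set.Ioi (0 : ℝ), ∫ s, F s κ =
      4 * Real.pi ^ 2 * ((κ : ℂ) ^ 2 * Complex.exp (-(2 * Real.pi * (1 + D)) * κ)) := by
    intro κ hκ
    simp only [F]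
    simp_rw [← mul_assoc]
    rw [integral_mul_const, integral_mul_const, integral_exp_div_sq hκ hD]
    have e : Complex.exp (-(2 * Real.pi * (1 + D)) * κ) =
        Complex.exp (-(2 * Real.pi * κ * D)) * Complex.exp (-(2 * Real.pi : ℝ) * κ) := by
      rw [← Complex.exp_add]
      congr 1
      push_cast
      ring
    rw [e]
    ring
  have hre : 0 < (2 * Real.pi * (1 + D) : ℂ).re := by
    have := Complex.re_ofReal_mul (2 * Real.pi) (1 + D)
    push_cast at this
    rw [this, Complex.add_re, Complex.one_re]
    positivity
  rw [setIntegral_congr_fun measurableSet_Ioi h4, integral_const_mul,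
    integral_pow_mul_cexp_neg 2 hre]
  have hD1 : 1 + D ≠ 0 := by
    intro h
    have := congrArg Complex.re h
    simp only [Complex.add_re, Complex.one_re, Complex.zero_re] at this
    linarith
  norm_num
  field_simp
  norm_num

/-- In the expansion in powers of e^{-iθ} only the constant term has nonzero mean. A Laplace
integral reduces this to `integral_angle_exp_add` with E = 0. -/
theorem integral_angle_inv_cube {c G : ℂ} (h : ‖G‖ < c.re) :
    ∫ θ : ℝ, 1 / (c - G * Complex.exp (-(θ * Complex.I))) ^ 3 ∂angle = 2 * Real.pi / c ^ 3 := by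
  have hn : ∀ θ : ℝ, ‖Complex.exp (-(θ * Complex.I))‖ = 1 := by
    intro θ
    have := Complex.norm_exp_ofReal_mul_I (-θ)
    push_cast at this
    rwa [neg_mul] at this
  have hre : ∀ θ : ℝ, c.re - ‖G‖ ≤ (c - G * Complex.exp (-(θ * Complex.I))).re := by
    intro θ
    rw [Complex.sub_re]
    have h1 := (Complex.re_le_norm (G * Complex.exp (-(θ * Complex.I))))
    rw [norm_mul, hn, mul_one] at h1
    linarith
  set F : ℝ → ℝ → ℂ := fun θ κ =>
    (κ : ℂ) ^ 2 * Complex.exp (-(c - G * Complex.exp (-(θ * Complex.I))) * κ)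
  have hFi : Integrable (Function.uncurry F) (angle.prod ray) := by
    have hd := (integrable_const (μ := angle) (1 : ℝ)).mul_prod
      (integrable_pow_mul_exp_neg 2 (sub_pos.2 h))
    refine hd.mono' (Continuous.aestronglyMeasurable (by
      simp only [Function.uncurry_def, F]; fun_prop)) ?_
    have hpos : ∀ᵐ q : ℝ × ℝ ∂(angle.prod ray), 0 < q.2 :=
      Measure.quasiMeasurePreserving_snd.ae (ae_restrict_mem measurableSet_Ioi)
    filter_upwards [hpos] with q hq
    simp only [Function.uncurry, F, norm_mul, norm_pow, Complex.norm_real, Real.norm_eq_abs,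
      abs_of_pos hq, Complex.norm_exp, Complex.re_mul_ofReal, Complex.neg_re, one_mul]
    gcongr
    exact hre q.1
  have hc : 0 < c.re := (norm_nonneg G).trans_lt h
  have h1 : ∀ θ : ℝ, 1 / (c - G * Complex.exp (-(θ * Complex.I))) ^ 3 =
      1 / 2 * ∫ κ, F θ κ ∂ray := by
    intro θ
    rw [integral_pow_mul_cexp_neg 2 ((sub_pos.2 h).trans_le (hre θ))]
    norm_num
    ring
  simp_rw [h1]
  rw [integral_const_mul, integral_integral_swap hFi]
  have h2 : ∀ κ : ℝ, ∫ θ, F θ κ ∂angle = (2 * Real.pi) * ((κ : ℂ) ^ 2 * Complex.exp (-c * κ)) := by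
    intro κ
    have e : ∀ θ : ℝ, F θ κ = (κ : ℂ) ^ 2 * Complex.exp (-c * κ) *
        Complex.exp (0 * Complex.exp (θ * Complex.I) + (G * κ) * Complex.exp (-(θ * Complex.I))) := by
      intro θ
      simp only [F]
      rw [mul_assoc, ← Complex.exp_add]
      congr 2
      ring
    simp_rw [e]
    rw [integral_const_mul, integral_angle_exp_add, tsum_eq_single 0]
    · simp
      ring
    · intro n hn
      simp [hn]
  simp_rw [h2]
  rw [integral_const_mul, integral_pow_mul_cexp_neg 2 hc]
  norm_num
  ring

/-- The vertical factor (1 - is)⁻² makes the s-integral explicit, and the angular mean then removes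
all dependence on z₁. -/
theorem lerayIntegral_radial {γ : ℝ} (hγ : 1 < γ) {h : ℝ → ℂ} {f : hypersurface γ → ℂ}
    (hf : ∀ ζ, f ζ = h ‖ζ.1.1‖ * (1 / (1 - ζ.1.2.re * Complex.I) ^ 2)) {z : ℂ × ℂ}
    (hz : z ∈ domain γ)
    (hi : Integrable (fun ζ : hypersurface γ => f ζ * kernel γ z ζ.1) (mu γ (γ - 1))) :
    lerayIntegral γ f z = 2 * γ ^ 2 * ∫ α : ℝ, h α * (α ^ (γ - 1) : ℝ) *
      (1 / (1 + (γ - 1) * (α ^ γ : ℝ) - Complex.I * z.2) ^ 3) ∂ray := by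
  have hpi : (Real.pi : ℂ) ≠ 0 := by exact_mod_cast Real.pi_ne_zero
  rw [lerayIntegral, integral_mu hi.1, integral_coords_iterated (integrable_comp_polarPoint hi),
    ← integral_const_mul]
  refine setIntegral_congr_fun measurableSet_Ioi fun α (hα : 0 < α) => ?_
  set c : ℂ := 1 + (γ - 1) * (α ^ γ : ℝ) - Complex.I * z.2 with hc
  set G : ℂ := γ * (α ^ (γ - 1) : ℝ) * z.1 with hG
  have hGc : ‖G‖ < c.re := by
    have hz' : ‖z.1‖ ^ γ < z.2.im := hz
    have h1 := young_rpow hγ hα.le (norm_nonneg z.1)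
    have h2 : ‖G‖ = γ * α ^ (γ - 1) * ‖z.1‖ := by
      rw [hG, norm_mul, norm_mul, Complex.norm_real, Complex.norm_real,
        Real.norm_of_nonneg (by linarith), Real.norm_of_nonneg (by positivity)]
    have h3 : c.re = 1 + (γ - 1) * α ^ γ + z.2.im := by
      have e : c = ((1 + (γ - 1) * α ^ γ : ℝ) : ℂ) - Complex.I * z.2 := by
        rw [hc]; push_cast; ring
      rw [e, Complex.sub_re, Complex.ofReal_re, Complex.I_mul_re]
      ring
    rw [h2, h3]
    linarith
  have hs : ∀ θ : ℝ, ∫ s : ℝ, ((α ^ (γ - 1) : ℝ) : ℂ) *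
      (f (polarPoint γ (α, θ, s)) * kernel γ z (polarPoint γ (α, θ, s)).1) =
      h α * (α ^ (γ - 1) : ℝ) * (γ ^ 2 / Real.pi) *
        (1 / (c - G * Complex.exp (-(θ * Complex.I))) ^ 3) := by
    intro θ
    set D : ℂ := c - 1 - G * Complex.exp (-(θ * Complex.I)) with hD
    have hb : ∀ s : ℝ, bracket γ z (polarPoint γ (α, θ, s)).1 = D + s * Complex.I := by
      intro s
      rw [bracket_polarPoint z (by exact hα), hD, hc, hG]
      have hz2 : z.2 = z.2.re + z.2.im * Complex.I := (Complex.re_add_im _).symm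
      push_cast
      linear_combination Complex.I * hz2 + (z.2.im : ℂ) * Complex.I_mul_I
    have hDre : 0 < D.re := by
      have h1 := bracket_re_pos hγ hz (p := (α, θ, 0)) hα
      rw [hb] at h1
      simpa using h1
    have h1 : ∀ s : ℝ, ((α ^ (γ - 1) : ℝ) : ℂ) *
        (f (polarPoint γ (α, θ, s)) * kernel γ z (polarPoint γ (α, θ, s)).1) =
        (h α * (α ^ (γ - 1) : ℝ) * (γ ^ 2 / (4 * Real.pi ^ 2))) *
        (1 / (1 - s * Complex.I) ^ 2 * (1 / (D + s * Complex.I) ^ 2)) := by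
      intro s
      rw [hf, kernel_eq, hb, norm_polarPoint_fst γ (by exact hα.le),
        show (polarPoint γ (α, θ, s)).1.2.re = s from rfl]
      push_cast
      ring
    simp_rw [h1]
    rw [integral_const_mul, integral_inv_sq_mul_inv_sq hDre,
      show 1 + D = c - G * Complex.exp (-(θ * Complex.I)) by rw [hD]; ring]
    field_simp
  simp_rw [hs]
  rw [integral_const_mul, integral_angle_inv_cube hGc]
  field_simp

/-- The integral of `α ^ p` over `[δ, 1]`. -/
def powerMass (p δ : ℝ) : ℝ≥0∞ := ∫⁻ α in Set.Icc δ 1, ENNReal.ofReal (α ^ p)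

theorem integrableOn_rpow_Icc (p : ℝ) {δ : ℝ} (hδ : 0 < δ) :
    IntegrableOn (fun α : ℝ => α ^ p) (Set.Icc δ 1) := by
  refine ContinuousOn.integrableOn_compact isCompact_Icc ?_
  exact continuousOn_id.rpow_const fun x hx => Or.inl (hδ.trans_le hx.1).ne'

theorem powerMass_lt_top (p : ℝ) {δ : ℝ} (hδ : 0 < δ) : powerMass p δ < ∞ :=
  (integrableOn_rpow_Icc p hδ).lintegral_lt_top

theorem powerMass_pos (p : ℝ) {δ : ℝ} (hδ : 0 < δ) (hδ' : δ < 1) : 0 < powerMass p δ := by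
  rw [powerMass, setLIntegral_pos_iff (by fun_prop)]
  have h : Set.Icc δ 1 ⊆ (Function.support fun α : ℝ => ENNReal.ofReal (α ^ p)) ∩ Set.Icc δ 1 := by
    refine fun x hx => ⟨?_, hx⟩
    have := Real.rpow_pos_of_pos (hδ.trans_le hx.1) p
    simpa using this
  refine lt_of_lt_of_le ?_ (measure_mono h)
  rw [Real.volume_Icc]
  simpa using hδ'

theorem restrict_ray_Icc {δ : ℝ} (hδ : 0 < δ) :
    ray.restrict (Set.Icc δ 1) = volume.restrict (Set.Icc δ 1) :=
  Measure.restrict_restrict_of_subset fun _ hx => hδ.trans_le hx.1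

/-- A radial profile times a Cauchy-type factor in the vertical variable. -/
def radialTest (γ p δ : ℝ) (ζ : hypersurface γ) : ℂ :=
  ((Set.Icc δ 1).indicator (fun α : ℝ => α ^ p) ‖ζ.1.1‖ : ℝ) *
    (1 / (1 - ζ.1.2.re * Complex.I) ^ 2)

theorem measurable_radialTest (γ p δ : ℝ) : Measurable (radialTest γ p δ) := by
  have h1 : Measurable fun ζ : hypersurface γ => ‖ζ.1.1‖ :=
    (measurable_fst.comp measurable_subtype_coe).norm
  have h2 : Measurable fun ζ : hypersurface γ => ζ.1.2.re :=
    Complex.measurable_re.comp (measurable_snd.comp measurable_subtype_coe)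
  have h3 : Measurable ((Set.Icc δ 1).indicator (fun α : ℝ => α ^ p)) :=
    Measurable.indicator (by fun_prop) measurableSet_Icc
  have h4 := h3.comp h1
  refine (Complex.measurable_ofReal.comp h4).mul ?_
  have h5 : Measurable fun x : ℝ => (1 / (1 - x * Complex.I) ^ 2 : ℂ) := by fun_prop
  exact h5.comp h2

/-- The squared norm factorises; c is the integral of (1 + s²)⁻² over θ and s, independent of p, q
and δ. -/
theorem exists_lintegral_radialTest_eq (γ : ℝ) : ∃ c : ℝ≥0∞, c ≠ ∞ ∧ ∀ p q δ : ℝ, 0 < δ →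
    ∫⁻ ζ, ‖radialTest γ p δ ζ‖ₑ ^ 2 ∂(mu γ q) = powerMass (q + 2 * p) δ * c := by
  refine ⟨∫⁻ x : ℝ × ℝ, ENNReal.ofReal ((1 + x.2 ^ 2)⁻¹ ^ 2) ∂(angle.prod volume), ?_, ?_⟩
  · refine ne_of_lt ?_
    have h : Integrable (fun x : ℝ × ℝ => (1 : ℝ) * (1 + x.2 ^ 2)⁻¹) (angle.prod volume) :=
      (integrable_const (μ := angle) (1 : ℝ)).mul_prod integrable_inv_one_add_sq
    refine lt_of_le_of_lt (lintegral_mono fun x => ENNReal.ofReal_le_ofReal ?_) h.lintegral_lt_top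
    rw [one_mul]
    refine pow_le_of_le_one (by positivity) (inv_le_one_of_one_le₀ ?_) two_ne_zero
    nlinarith [sq_nonneg x.2]
  · intro p q δ hδ
    rw [lintegral_mu ((measurable_radialTest γ p δ).enorm.pow_const 2).aemeasurable]
    have h1 : ∀ᵐ x : ℝ × ℝ × ℝ ∂coords, ENNReal.ofReal (x.1 ^ q) *
        ‖radialTest γ p δ (polarPoint γ x)‖ₑ ^ 2 =
        (Set.Icc δ 1).indicator (fun α : ℝ => ENNReal.ofReal (α ^ (q + 2 * p))) x.1 *
          ENNReal.ofReal ((1 + x.2.2 ^ 2)⁻¹ ^ 2) := by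
      filter_upwards [ae_coords_pos] with x hx
      rw [radialTest, norm_polarPoint_fst γ hx.le,
        show (polarPoint γ x).1.2.re = x.2.2 from rfl]
      by_cases hm : x.1 ∈ Set.Icc δ 1
      · rw [Set.indicator_of_mem hm, Set.indicator_of_mem hm, enorm_mul, mul_pow, ← mul_assoc,
          ← ofReal_norm, ← ofReal_norm, Complex.norm_real, Real.norm_of_nonneg (by positivity),
          ← ENNReal.ofReal_pow (by positivity), ← ENNReal.ofReal_mul (by positivity),
          ← ENNReal.ofReal_pow (by positivity), norm_div, norm_pow, norm_one, Complex.sq_norm,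
          Complex.normSq_apply]
        congr 2
        · rw [Real.rpow_add hx, mul_comm 2 p, Real.rpow_mul hx.le]
          norm_num
        · simp
          ring
      · rw [Set.indicator_of_notMem hm, Set.indicator_of_notMem hm]
        simp
    rw [lintegral_congr_ae h1, lintegral_prod_mul (f := fun α : ℝ => (Set.Icc δ 1).indicator
      (fun α : ℝ => ENNReal.ofReal (α ^ (q + 2 * p))) α) (g := fun y : ℝ × ℝ =>
      ENNReal.ofReal ((1 + y.2 ^ 2)⁻¹ ^ 2))
      (Measurable.indicator (by fun_prop) measurableSet_Icc).aemeasurable (by fun_prop),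
      lintegral_indicator measurableSet_Icc, restrict_ray_Icc hδ]
    rfl

theorem memLp_radialTest (γ p q : ℝ) {δ : ℝ} (hδ : 0 < δ) :
    MemLp (radialTest γ p δ) 2 (mu γ q) := by
  refine ⟨(measurable_radialTest γ p δ).aestronglyMeasurable, ?_⟩
  obtain ⟨c, hc, h⟩ := exists_lintegral_radialTest_eq γ
  have h1 := h p q δ hδ
  rw [lintegral_enorm_sq_eq] at h1
  by_contra hcon
  rw [not_lt_top_iff.1 hcon] at h1
  have h2 := ENNReal.mul_ne_top (powerMass_lt_top (q + 2 * p) hδ).ne hc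
  rw [← h1] at h2
  simp at h2

/-- The Leray integral of `radialTest γ p δ`, as a function of `z₂`. -/
def radialTransform (γ p δ : ℝ) (u : ℂ) : ℂ :=
  2 * γ ^ 2 * ∫ α : ℝ in Set.Icc δ 1, ((α ^ (p + (γ - 1)) : ℝ) : ℂ) *
    (1 / (1 + (γ - 1) * (α ^ γ : ℝ) - Complex.I * u) ^ 3)

theorem lerayIntegral_radialTest {γ : ℝ} (hγ : 1 < γ) (p : ℝ) {δ : ℝ} (hδ : 0 < δ) {z : ℂ × ℂ}
    (hz : z ∈ domain γ) :
    lerayIntegral γ (radialTest γ p δ) z = radialTransform γ p δ z.2 := by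
  rw [lerayIntegral_radial hγ (f := radialTest γ p δ) (h := fun x => (((Set.Icc δ 1).indicator
    (fun α : ℝ => α ^ p) x : ℝ) : ℂ)) (fun ζ => rfl) hz (integrable_mul_kernel (r := γ - 1) hγ
    (by linarith) (by linarith) (memLp_radialTest γ p (γ - 1) hδ) hz), radialTransform,
    ← restrict_ray_Icc hδ, ← integral_indicator measurableSet_Icc]
  congr 1
  refine setIntegral_congr_fun measurableSet_Ioi fun α (hα : 0 < α) => ?_
  by_cases hm : α ∈ Set.Icc δ 1
  · simp only [Set.indicator_of_mem hm]
    rw [Real.rpow_add hα]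
    push_cast
    ring
  · simp only [Set.indicator_of_notMem hm]
    simp

theorem radial_denominator_re {γ α : ℝ} (u : ℂ) :
    (1 + (γ - 1) * (α ^ γ : ℝ) - Complex.I * u : ℂ).re = 1 + (γ - 1) * α ^ γ + u.im := by
  have e : (1 + (γ - 1) * (α ^ γ : ℝ) - Complex.I * u : ℂ) =
      ((1 + (γ - 1) * α ^ γ : ℝ) : ℂ) - Complex.I * u := by
    push_cast; ring
  rw [e, Complex.sub_re, Complex.ofReal_re, Complex.I_mul_re]
  ring

theorem norm_inv_cube_sub_le {a b : ℂ} (ha : 1 ≤ ‖a‖) (hb : 1 ≤ ‖b‖) :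
    ‖1 / a ^ 3 - 1 / b ^ 3‖ ≤ 3 * ‖a - b‖ := by
  have ha0 : a ≠ 0 := norm_pos_iff.1 (by linarith)
  have hb0 : b ≠ 0 := norm_pos_iff.1 (by linarith)
  have e : 1 / a ^ 3 - 1 / b ^ 3 =
      (b - a) * (a⁻¹ * b⁻¹ * (a⁻¹ ^ 2 + a⁻¹ * b⁻¹ + b⁻¹ ^ 2)) := by
    field_simp
    ring
  have h1 : ‖a⁻¹‖ ≤ 1 := by rw [norm_inv]; exact inv_le_one_of_one_le₀ ha
  have h2 : ‖b⁻¹‖ ≤ 1 := by rw [norm_inv]; exact inv_le_one_of_one_le₀ hb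
  have h3 : ‖a⁻¹ ^ 2 + a⁻¹ * b⁻¹ + b⁻¹ ^ 2‖ ≤ 3 := by
    refine (norm_add₃_le).trans ?_
    rw [norm_pow, norm_pow, norm_mul]
    nlinarith [norm_nonneg a⁻¹, norm_nonneg b⁻¹, mul_le_one₀ h1 (norm_nonneg _) h2]
  rw [e, norm_mul, norm_sub_rev b a, norm_mul, norm_mul, mul_comm]
  refine mul_le_mul_of_nonneg_right ?_ (norm_nonneg _)
  have h4 := mul_le_one₀ h1 (norm_nonneg _) h2
  nlinarith [norm_nonneg (a⁻¹ ^ 2 + a⁻¹ * b⁻¹ + b⁻¹ ^ 2)]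

theorem one_le_norm_radial_denominator {γ α : ℝ} (hγ : 1 < γ) (hα : 0 ≤ α) {u : ℂ}
    (hu : 0 ≤ u.im) : 1 ≤ ‖(1 + (γ - 1) * (α ^ γ : ℝ) - Complex.I * u : ℂ)‖ := by
  refine le_trans ?_ (Complex.re_le_norm _)
  rw [radial_denominator_re]
  have : 0 ≤ (γ - 1) * α ^ γ := mul_nonneg (by linarith) (by positivity)
  linarith

theorem integrableOn_radial {γ : ℝ} (hγ : 1 < γ) (p : ℝ) {δ : ℝ} (hδ : 0 < δ) {u : ℂ}
    (hu : 0 ≤ u.im) :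
    IntegrableOn (fun α : ℝ => ((α ^ (p + (γ - 1)) : ℝ) : ℂ) *
      (1 / (1 + (γ - 1) * (α ^ γ : ℝ) - Complex.I * u) ^ 3)) (Set.Icc δ 1) := by
  refine (integrableOn_rpow_Icc (p + (γ - 1)) hδ).ofReal.mul_bdd (c := 1)
    (Measurable.aestronglyMeasurable (by fun_prop)) ?_
  filter_upwards [ae_restrict_mem measurableSet_Icc] with α hα
  rw [norm_div, norm_one, norm_pow, one_div]
  exact inv_le_one_of_one_le₀ (one_le_pow₀
    (one_le_norm_radial_denominator hγ (hδ.le.trans hα.1) hu))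

/-- The denominators have modulus at least 1 up to the boundary Im u = 0, so the explicit formula is
Lipschitz there and serves as its own boundary function. -/
theorem norm_radialTransform_sub_le {γ : ℝ} (hγ : 1 < γ) (p : ℝ) {δ : ℝ} (hδ : 0 < δ) :
    ∃ C : ℝ, ∀ u v : ℂ, 0 ≤ u.im → 0 ≤ v.im →
      ‖radialTransform γ p δ u - radialTransform γ p δ v‖ ≤ C * ‖u - v‖ := by
  refine ⟨2 * γ ^ 2 * ∫ α in Set.Icc δ 1, α ^ (p + (γ - 1)) * 3, fun u v hu hv => ?_⟩
  rw [radialTransform, radialTransform, ← mul_sub, ← integral_sub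
    (integrableOn_radial hγ p hδ hu) (integrableOn_radial hγ p hδ hv), norm_mul, mul_assoc,
    ← integral_mul_const]
  have e : ‖(2 * γ ^ 2 : ℂ)‖ = 2 * γ ^ 2 := by
    have : (2 * γ ^ 2 : ℂ) = ((2 * γ ^ 2 : ℝ) : ℂ) := by push_cast; rfl
    rw [this, Complex.norm_real, Real.norm_of_nonneg (by positivity)]
  rw [e]
  refine mul_le_mul_of_nonneg_left ?_ (by positivity)
  refine norm_integral_le_of_norm_le
    (((integrableOn_rpow_Icc (p + (γ - 1)) hδ).mul_const 3).mul_const _) ?_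
  filter_upwards [ae_restrict_mem measurableSet_Icc] with α hα
  have hα0 : 0 ≤ α := hδ.le.trans hα.1
  rw [← mul_sub, norm_mul, Complex.norm_real, Real.norm_of_nonneg (by positivity), mul_assoc]
  refine mul_le_mul_of_nonneg_left ?_ (by positivity)
  refine (norm_inv_cube_sub_le (one_le_norm_radial_denominator hγ hα0 hu)
    (one_le_norm_radial_denominator hγ hα0 hv)).trans (le_of_eq ?_)
  rw [show (1 + (γ - 1) * (α ^ γ : ℝ) - Complex.I * u -
    (1 + (γ - 1) * (α ^ γ : ℝ) - Complex.I * v) : ℂ) = -(Complex.I * (u - v)) by ring, norm_neg,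
    norm_mul, Complex.norm_I, one_mul]

theorem measure_lt_top_of_isCompact {γ : ℝ} (hγ : 1 < γ) {K : Set (hypersurface γ)}
    (hK : IsCompact K) : mu γ (γ - 1) K < ∞ := by
  obtain ⟨M, hM⟩ := (hK.image continuous_subtype_val).isBounded.exists_norm_le
  have hM' : ∀ z ∈ K, ‖z.1‖ ≤ M := fun z hz => hM _ ⟨z, hz, rfl⟩
  have hb : BoundedSupport γ (max M 1) (K.indicator fun _ => (1 : ℂ)) :=
    { measurable := measurable_const.indicator hK.measurableSet
      norm_le := fun ζ => (norm_indicator_le_norm_self _ _).trans (by simp)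
      eq_zero_of_norm := fun ζ h => Set.indicator_of_notMem (fun hζ => not_le.2 h
        ((norm_fst_le _).trans ((hM' ζ hζ).trans (le_max_left _ _)))) _
      eq_zero_of_re := fun ζ h => Set.indicator_of_notMem (fun hζ => not_le.2 h
        ((Complex.abs_re_le_norm _).trans ((norm_snd_le _).trans
          ((hM' ζ hζ).trans (le_max_left _ _))))) _ }
  have h1 := hb.integrable_mu hγ
  rw [integrable_indicator_iff hK.measurableSet, integrableOn_const_iff] at h1
  simpa using h1

theorem isLerayTransform_radialTest {γ : ℝ} (hγ : 1 < γ) (p : ℝ) {δ : ℝ} (hδ : 0 < δ) :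
    IsLerayTransform γ (radialTest γ p δ) fun ζ => radialTransform γ p δ ζ.1.2 := by
  have him : ∀ ζ : hypersurface γ, 0 ≤ ζ.1.2.im := fun ζ => by
    have h : ζ.1.2.im = ‖ζ.1.1‖ ^ γ := ζ.2
    rw [h]; positivity
  refine ⟨fun z hz => integrable_mul_kernel (r := γ - 1) hγ (by linarith) (by linarith)
    (memLp_radialTest γ p (γ - 1) hδ) hz, ?_, fun K hK h0 => ?_⟩
  · have hm : StronglyMeasurable fun q : ℂ × ℝ => ((q.2 ^ (p + (γ - 1)) : ℝ) : ℂ) *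
        (1 / (1 + (γ - 1) * (q.2 ^ γ : ℝ) - Complex.I * q.1) ^ 3) :=
      Measurable.stronglyMeasurable (by fun_prop)
    have h1 : Measurable fun u => radialTransform γ p δ u :=
      (hm.integral_prod_right' (ν := volume.restrict (Set.Icc δ 1))).measurable.const_mul _
    exact (h1.comp (measurable_snd.comp measurable_subtype_coe)).aestronglyMeasurable
  · obtain ⟨C, hC⟩ := norm_radialTransform_sub_le hγ p hδ
    have hKfin := measure_lt_top_of_isCompact hγ hK
    have hlim : Tendsto (fun ε : ℝ => (mu γ (γ - 1) K) ^ (2 : ℝ≥0∞).toReal⁻¹ *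
        ENNReal.ofReal (C * ε)) (𝓝[>] 0) (𝓝 0) := by
      have h1 : Tendsto (fun ε : ℝ => C * ε) (𝓝[>] 0) (𝓝 (C * 0)) :=
        (tendsto_id.const_mul C).mono_left nhdsWithin_le_nhds
      have h2 := ENNReal.Tendsto.const_mul
        (a := (mu γ (γ - 1) K) ^ (2 : ℝ≥0∞).toReal⁻¹) (ENNReal.tendsto_ofReal h1)
        (Or.inr (ENNReal.rpow_ne_top_of_nonneg (by positivity) hKfin.ne))
      simpa using h2
    refine tendsto_of_tendsto_of_tendsto_of_le_of_le' tendsto_const_nhds hlim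
      (.of_forall fun _ => zero_le) ?_
    filter_upwards [self_mem_nhdsWithin] with ε hε
    have hε0 : (0 : ℝ) < ε := hε
    have h1 := eLpNorm_le_of_ae_bound (p := 2) (μ := (mu γ (γ - 1)).restrict K) (C := C * ε)
      (f := fun z : hypersurface γ => lerayIntegral γ (radialTest γ p δ)
        (z.1.1, z.1.2 + (ε : ℂ) * Complex.I) - radialTransform γ p δ z.1.2)
      (.of_forall fun ζ => by
        change ‖lerayIntegral γ (radialTest γ p δ) (lift γ ε ζ) - _‖ ≤ _
        rw [lerayIntegral_radialTest hγ p hδ (lift_mem_domain hε0 ζ)]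
        refine (hC _ _ ?_ (him ζ)).trans (le_of_eq ?_)
        · have := him ζ
          simp only [lift, Complex.add_im, Complex.im_ofReal_mul, Complex.I_im]
          linarith
        · simp [lift, abs_of_pos hε0])
    rwa [Measure.restrict_apply_univ] at h1

/-! ### Lower bounds and necessity of the range of r -/

/-- The numerator of the real part is x(x² - 3y²), at least 1/4 when x ≥ 1 and y² ≤ 1/4: the
argument of x + iy stays below π/6, so its cube remains in the right half plane. -/
theorem le_inv_cube_re {x y M : ℝ} (hx : 1 ≤ x) (hxM : x ≤ M) (hy : |y| ≤ 1 / 2) :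
    1 / 4 / (M ^ 2 + 1) ^ 3 ≤ (1 / (x + y * Complex.I : ℂ) ^ 3).re := by
  have hy2 : y ^ 2 ≤ 1 / 4 := by
    have := sq_abs y
    nlinarith [abs_nonneg y]
  have h0 : 0 < x ^ 2 + y ^ 2 := by nlinarith [sq_nonneg y]
  have hn : (x + y * Complex.I : ℂ) ≠ 0 := by
    intro h
    have := congrArg Complex.re h
    simp at this
    linarith
  have hn' : (x - y * Complex.I : ℂ) ≠ 0 := by
    intro h
    have := congrArg Complex.re h
    simp at this
    linarith
  have e : (1 / (x + y * Complex.I : ℂ) ^ 3) =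
      (((x ^ 3 - 3 * x * y ^ 2) / (x ^ 2 + y ^ 2) ^ 3 : ℝ) : ℂ) +
        (((y ^ 3 - 3 * x ^ 2 * y) / (x ^ 2 + y ^ 2) ^ 3 : ℝ) : ℂ) * Complex.I := by
    have e1 : ((x ^ 2 + y ^ 2 : ℝ) : ℂ) = (x + y * Complex.I) * (x - y * Complex.I) := by
      push_cast
      linear_combination ((y : ℂ) ^ 2) * Complex.I_mul_I
    have e2 : ((x ^ 3 - 3 * x * y ^ 2 : ℝ) : ℂ) + ((y ^ 3 - 3 * x ^ 2 * y : ℝ) : ℂ) * Complex.I =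
        (x - y * Complex.I) ^ 3 := by
      push_cast
      linear_combination ((y : ℂ) ^ 3 * Complex.I - 3 * x * (y : ℂ) ^ 2) * Complex.I_mul_I
    rw [Complex.ofReal_div, Complex.ofReal_div, Complex.ofReal_pow, e1, div_mul_eq_mul_div,
      ← add_div, e2]
    field_simp
  rw [e, Complex.add_re, Complex.ofReal_re, Complex.re_ofReal_mul, Complex.I_re, mul_zero, add_zero]
  have h1 : 1 / 4 ≤ x ^ 3 - 3 * x * y ^ 2 := by nlinarith [sq_nonneg y, mul_self_nonneg (x - 1)]
  have h2 : x ^ 2 + y ^ 2 ≤ M ^ 2 + 1 := by nlinarith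
  gcongr

/-- Near the origin the integrand has positive real part, so there is no cancellation in α and the
transform is comparable from below to the mass of its weight. -/
theorem exists_le_enorm_radialTransform {γ : ℝ} (hγ : 1 < γ) :
    ∃ b : ℝ≥0∞, b ≠ 0 ∧ b ≠ ∞ ∧ ∀ (p δ : ℝ), 0 < δ → ∀ ζ : hypersurface γ, ‖ζ.1.1‖ ≤ 1 →
      |ζ.1.2.re| ≤ 1 / 2 → b * powerMass (p + (γ - 1)) δ ≤ ‖radialTransform γ p δ ζ.1.2‖ₑ := by
  -- The real part 1 + (γ - 1) α^γ + Im ζ₂ of the denominator is at most γ + 1, because α^γ and Im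
  -- ζ₂ are at most 1.
  set c : ℝ := 1 / 4 / ((γ + 1) ^ 2 + 1) ^ 3 with hc
  have hc0 : 0 < c := by positivity
  refine ⟨ENNReal.ofReal (2 * γ ^ 2 * c), ?_, ENNReal.ofReal_ne_top, fun p δ hδ ζ h1 h2 => ?_⟩
  · rw [ne_eq, ENNReal.ofReal_eq_zero, not_le]
    positivity
  have him : ζ.1.2.im = ‖ζ.1.1‖ ^ γ := ζ.2
  have him0 : 0 ≤ ζ.1.2.im := by rw [him]; positivity
  have him1 : ζ.1.2.im ≤ 1 := by
    rw [him]
    exact Real.rpow_le_one (norm_nonneg _) h1 (by linarith)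
  have hi := integrableOn_radial hγ p hδ him0
  have hpow := integrableOn_rpow_Icc (p + (γ - 1)) hδ
  rw [powerMass, ← ofReal_integral_eq_lintegral_ofReal hpow, ← ENNReal.ofReal_mul (by positivity),
    ← ofReal_norm]
  · refine ENNReal.ofReal_le_ofReal (le_trans ?_ (Complex.re_le_norm _))
    have e : (2 * γ ^ 2 : ℂ) = ((2 * γ ^ 2 : ℝ) : ℂ) := by push_cast; rfl
    have hre := integral_re hi
    simp only [RCLike.re_to_complex] at hre
    rw [radialTransform, e, Complex.re_ofReal_mul, ← hre, mul_assoc, ← integral_const_mul]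
    refine mul_le_mul_of_nonneg_left ?_ (by positivity)
    refine setIntegral_mono_on (hpow.const_mul c) hi.re measurableSet_Icc fun α hα => ?_
    have hα0 : 0 ≤ α := hδ.le.trans hα.1
    have e2 : (1 + (γ - 1) * (α ^ γ : ℝ) - Complex.I * ζ.1.2 : ℂ) =
        ((1 + (γ - 1) * α ^ γ + ζ.1.2.im : ℝ) : ℂ) + ((-ζ.1.2.re : ℝ) : ℂ) * Complex.I := by
      have hz2 : ζ.1.2 = ζ.1.2.re + ζ.1.2.im * Complex.I := (Complex.re_add_im _).symm
      push_cast
      linear_combination (-Complex.I) * hz2 - (ζ.1.2.im : ℂ) * Complex.I_mul_I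
    have hα1 : α ^ γ ≤ 1 := Real.rpow_le_one hα0 hα.2 (by linarith)
    have hα2 : 0 ≤ α ^ γ := by positivity
    have hb := le_inv_cube_re (x := 1 + (γ - 1) * α ^ γ + ζ.1.2.im) (y := -ζ.1.2.re) (M := γ + 1)
      (by nlinarith) (by nlinarith) (by rwa [abs_neg])
    rw [e2, Complex.re_ofReal_mul, mul_comm]
    exact mul_le_mul_of_nonneg_left hb (by positivity)
  · filter_upwards [ae_restrict_mem measurableSet_Icc] with α hα
    have hα0 : 0 ≤ α := hδ.le.trans hα.1
    simp only [Pi.zero_apply]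
    positivity

theorem le_mu_bidisc (γ r : ℝ) : ∫⁻ α in Set.Ioc 0 1, ENNReal.ofReal (α ^ r) ≤
    mu γ r {ζ | ‖ζ.1.1‖ ≤ 1 ∧ |ζ.1.2.re| ≤ 1 / 2} := by
  set S : Set (hypersurface γ) := {ζ | ‖ζ.1.1‖ ≤ 1 ∧ |ζ.1.2.re| ≤ 1 / 2} with hS
  have hSm : MeasurableSet S := by
    have h1 : Measurable fun ζ : hypersurface γ => ‖ζ.1.1‖ :=
      (measurable_fst.comp measurable_subtype_coe).norm
    have h2 : Measurable fun ζ : hypersurface γ => |ζ.1.2.re| :=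
      (Complex.measurable_re.comp (measurable_snd.comp measurable_subtype_coe)).norm
    exact (measurableSet_le h1 measurable_const).inter (measurableSet_le h2 measurable_const)
  rw [← lintegral_indicator_one hSm,
    lintegral_mu (measurable_one.indicator hSm).aemeasurable]
  have h1 : ∀ᵐ x : ℝ × ℝ × ℝ ∂coords,
      (Set.Ioc 0 1).indicator (fun α : ℝ => ENNReal.ofReal (α ^ r)) x.1 *
        (Set.univ ×ˢ Set.Icc (-(1 / 2)) (1 / 2) : Set (ℝ × ℝ)).indicator 1 x.2 =
      ENNReal.ofReal (x.1 ^ r) * S.indicator 1 (polarPoint γ x) := by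
    filter_upwards [ae_coords_pos] with x hx
    by_cases ha : x.1 ≤ 1
    · rw [Set.indicator_of_mem (show x.1 ∈ Set.Ioc 0 1 from ⟨hx, ha⟩)]
      congr 1
      by_cases hs : |x.2.2| ≤ 1 / 2
      · rw [Set.indicator_of_mem (show x.2 ∈ (Set.univ ×ˢ Set.Icc (-(1 / 2)) (1 / 2) : Set (ℝ × ℝ)) from
            ⟨Set.mem_univ _, abs_le.1 hs⟩),
          Set.indicator_of_mem (show polarPoint γ x ∈ S from
            ⟨by rwa [norm_polarPoint_fst γ hx.le], hs⟩)]
        rfl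
      · rw [Set.indicator_of_notMem (fun h => hs (abs_le.2 h.2)),
          Set.indicator_of_notMem (fun h => hs h.2)]
    · rw [Set.indicator_of_notMem (fun h => ha h.2), Set.indicator_of_notMem (fun h : polarPoint γ x ∈ S => ha (by
        have := h.1
        rwa [norm_polarPoint_fst γ hx.le] at this))]
      simp
  rw [← lintegral_congr_ae h1, lintegral_prod_mul
    (f := (Set.Ioc 0 1).indicator fun α : ℝ => ENNReal.ofReal (α ^ r))
    (g := (Set.univ ×ˢ Set.Icc (-(1 / 2)) (1 / 2) : Set (ℝ × ℝ)).indicator 1)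
    (Measurable.indicator (by fun_prop) measurableSet_Ioc).aemeasurable
    (measurable_one.indicator (MeasurableSet.univ.prod measurableSet_Icc)).aemeasurable,
    lintegral_indicator measurableSet_Ioc, Measure.restrict_restrict_of_subset
      (fun x hx => hx.1), lintegral_indicator_one (MeasurableSet.univ.prod measurableSet_Icc),
    Measure.prod_prod]
  -- The remaining factor is the measure 2π · 1 of the (θ, s)-rectangle.
  refine le_mul_of_one_le_right zero_le ?_
  rw [Measure.restrict_apply_univ, Real.volume_Ico, Real.volume_Icc]
  rw [← ENNReal.ofReal_mul (by linarith [Real.pi_pos]), ENNReal.one_le_ofReal]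
  have := Real.two_le_pi
  linarith

/-- Testing on `radialTest` gives b² V² μ_r(S) ≤ C² c V; since V is finite and nonzero for δ in (0,
1), one factor V cancels and the bound is uniform in δ. -/
theorem LerayBounded.powerMass_mul_le {γ r : ℝ} (hγ : 1 < γ) (h : LerayBounded γ r) :
    ∃ D : ℝ≥0∞, D ≠ ∞ ∧ ∀ δ : ℝ, 0 < δ → δ < 1 → powerMass (2 * γ - 2 - r) δ *
      ∫⁻ α in Set.Ioc 0 1, ENNReal.ofReal (α ^ r) ≤ D := by
  obtain ⟨C, hC⟩ := h
  obtain ⟨c, hc, hcf⟩ := exists_lintegral_radialTest_eq γ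
  obtain ⟨b, hb0, hb, hbg⟩ := exists_le_enorm_radialTransform hγ
  refine ⟨(C : ℝ≥0∞) ^ 2 * c / b ^ 2, ENNReal.div_ne_top
    (ENNReal.mul_ne_top (ENNReal.pow_ne_top ENNReal.coe_ne_top) hc) (pow_ne_zero 2 hb0),
    fun δ hδ hδ' => ?_⟩
  -- This exponent makes r + 2p (the squared norm) and p + γ - 1 (the lower bound of the transform)
  -- both equal to 2γ - 2 - r, so the same V occurs on both sides.
  set p : ℝ := γ - 1 - r with hp
  set V := powerMass (2 * γ - 2 - r) δ with hV
  set S : Set (hypersurface γ) := {ζ | ‖ζ.1.1‖ ≤ 1 ∧ |ζ.1.2.re| ≤ 1 / 2} with hS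
  have h1 := ENNReal.pow_le_pow_left (n := 2) (hC _ _ (memLp_radialTest γ p r hδ)
    (isLerayTransform_radialTest hγ p hδ))
  rw [mul_pow, ← lintegral_enorm_sq_eq, ← lintegral_enorm_sq_eq, hcf p r δ hδ,
    show r + 2 * p = 2 * γ - 2 - r by rw [hp]; ring, ← hV] at h1
  have h2 : (b * V) ^ 2 * mu γ r S ≤
      ∫⁻ ζ, ‖radialTransform γ p δ ζ.1.2‖ₑ ^ 2 ∂(mu γ r) := by
    refine le_trans ?_ (mul_meas_ge_le_lintegral₀ ?_ ((b * V) ^ 2))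
    · refine mul_le_mul_right (measure_mono fun ζ hζ => ?_) _
      have := hbg p δ hδ ζ hζ.1 hζ.2
      rw [show p + (γ - 1) = 2 * γ - 2 - r by rw [hp]; ring] at this
      exact ENNReal.pow_le_pow_left this
    · exact ((isLerayTransform_radialTest hγ p hδ).2.1.mono_ac
        (mu_absolutelyContinuous γ _ _)).enorm.pow_const 2
  have hV0 : V ≠ 0 := (powerMass_pos _ hδ hδ').ne'
  have hVt : V ≠ ∞ := (powerMass_lt_top _ hδ).ne
  have h3 : V * (V * b ^ 2 * mu γ r S) ≤ V * (C ^ 2 * c) := by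
    calc V * (V * b ^ 2 * mu γ r S) = (b * V) ^ 2 * mu γ r S := by ring
      _ ≤ C ^ 2 * (V * c) := h2.trans h1
      _ = V * (C ^ 2 * c) := by ring
  have h4 := (ENNReal.mul_le_mul_iff_right hV0 hVt).1 h3
  rw [ENNReal.le_div_iff_mul_le (Or.inl (pow_ne_zero 2 hb0)) (Or.inl (ENNReal.pow_ne_top hb))]
  refine le_trans ?_ h4
  rw [mul_right_comm]
  exact mul_le_mul_right (le_mu_bidisc γ r) _

theorem neg_one_lt_of_lintegral_rpow_ne_top {p : ℝ}
    (h : ∫⁻ α in Set.Ioc (0 : ℝ) 1, ENNReal.ofReal (α ^ p) ≠ ∞) : -1 < p := by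
  rw [← intervalIntegral.integrableOn_Ioo_rpow_iff one_pos]
  have h1 : IntegrableOn (fun α : ℝ => α ^ p) (Set.Ioc 0 1) := by
    refine ⟨Measurable.aestronglyMeasurable (by fun_prop), ?_⟩
    rw [hasFiniteIntegral_iff_ofReal]
    · exact lt_top_iff_ne_top.2 h
    · filter_upwards [ae_restrict_mem measurableSet_Ioc] with α hα
      exact Real.rpow_nonneg hα.1.le p
  exact h1.mono_set Set.Ioo_subset_Ioc_self

/-- Continuity from below along an exhaustion of (0, 1]. The shift by 2 keeps each δ strictly below
1, so that V is nonzero. -/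
theorem tendsto_powerMass (p : ℝ) : Tendsto (fun n : ℕ => powerMass p ((n : ℝ) + 2)⁻¹) atTop
    (𝓝 (∫⁻ α in Set.Ioc (0 : ℝ) 1, ENNReal.ofReal (α ^ p))) := by
  have hU : Set.Ioc (0 : ℝ) 1 = ⋃ n : ℕ, Set.Icc ((n : ℝ) + 2)⁻¹ 1 := by
    ext x
    simp only [Set.mem_Ioc, Set.mem_iUnion, Set.mem_Icc, exists_and_right, and_congr_left_iff]
    refine fun _ => ⟨fun hx => ?_, fun ⟨n, hn⟩ => lt_of_lt_of_le (by positivity) hn⟩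
    obtain ⟨n, hn⟩ := exists_nat_ge x⁻¹
    exact ⟨n, inv_le_of_inv_le₀ hx (by linarith)⟩
  have hmono : Monotone fun n : ℕ => Set.Icc ((n : ℝ) + 2)⁻¹ 1 := by
    intro m n hmn
    refine Set.Icc_subset_Icc_left (inv_anti₀ (by positivity) ?_)
    have : (m : ℝ) ≤ n := by exact_mod_cast hmn
    linarith
  have h := tendsto_measure_iUnion_atTop (μ := (volume : Measure ℝ).withDensity
    fun α => ENNReal.ofReal (α ^ p)) hmono
  rw [← hU, withDensity_apply _ measurableSet_Ioc] at h
  refine h.congr fun n => ?_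
  rw [Function.comp_apply, withDensity_apply _ measurableSet_Icc]
  rfl

/-- In the uniformly bounded product neither factor vanishes. An infinite integral of α^r is
excluded by a single δ, which gives r > -1; letting δ → 0 gives 2γ - 2 - r > -1. -/
theorem LerayBounded.mem_Ioo {γ r : ℝ} (hγ : 1 < γ) (h : LerayBounded γ r) :
    r ∈ Set.Ioo (-1) (2 * γ - 1) := by
  obtain ⟨D, hD, hle⟩ := h.powerMass_mul_le hγ
  have hr : -1 < r := by
    refine neg_one_lt_of_lintegral_rpow_ne_top fun htop => hD ?_
    have h1 := hle (1 / 2) (by norm_num) (by norm_num)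
    rw [htop, ENNReal.mul_top (powerMass_pos _ (by norm_num) (by norm_num)).ne', top_le_iff] at h1
    exact h1
  refine ⟨hr, ?_⟩
  have hA : (∫⁻ α in Set.Ioc (0 : ℝ) 1, ENNReal.ofReal (α ^ r)) ≠ 0 := by
    refine ((powerMass_pos r (δ := 1 / 2) (by norm_num) (by norm_num)).trans_le ?_).ne'
    exact lintegral_mono_set fun x hx => ⟨lt_of_lt_of_le (by norm_num) hx.1, hx.2⟩
  have h2 : -1 < 2 * γ - 2 - r := by
    refine neg_one_lt_of_lintegral_rpow_ne_top fun htop => hD ?_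
    have h3 := le_of_tendsto' (ENNReal.Tendsto.mul_const (tendsto_powerMass (2 * γ - 2 - r))
      (Or.inr ?_)) fun n => hle ((n : ℝ) + 2)⁻¹ (by positivity) (inv_lt_one_of_one_lt₀ (by
        have : (0 : ℝ) ≤ n := n.cast_nonneg
        linarith))
    · rwa [htop, ENNReal.top_mul hA, top_le_iff] at h3
    · intro hAt
      have h1 := hle (1 / 2) (by norm_num) (by norm_num)
      rw [hAt, ENNReal.mul_top (powerMass_pos _ (by norm_num) (by norm_num)).ne', top_le_iff] at h1
      exact hD h1
  linarith

end LerayModel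

end

theorem theorem1p2 (γ r : ℝ) (hγ : 1 < γ) :
    (LerayModel.LerayBoundedProjection γ r ↔ r ∈ Set.Ioo (-1) (2 * γ - 1)) ∧
    (LerayModel.LerayBounded γ r ↔ r ∈ Set.Ioo (-1) (2 * γ - 1)) := by
  have h1 : r ∈ Set.Ioo (-1) (2 * γ - 1) → LerayModel.LerayBoundedProjection γ r :=
    fun h => LerayModel.lerayBoundedProjection_of_mem hγ h.1 h.2
  have h2 : LerayModel.LerayBoundedProjection γ r → LerayModel.LerayBounded γ r :=
    fun h => h.lerayBounded (one_pos.trans hγ)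
  have h3 : LerayModel.LerayBounded γ r → r ∈ Set.Ioo (-1) (2 * γ - 1) := fun h => h.mem_Ioo hγ
  exact ⟨⟨fun h => h3 (h2 h), h1⟩, h3, fun h => h2 (h1 h)⟩
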